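/- **Theorem (Almost quadratic time algorithm).** Fix integers $m_1,m_2,T\ge 0$ and a constant $\epsilon_0>0$, let $d=d(n)=O(\log n)$ and $R=R(n)=o(\sqrt{\log n})$, and put $D=d+2$. Then for every $k\in\mathbb N$ there is an algorithm (a single real RAM program) that runs in time $O(n^{2+o(1)})$ and that, for all sufficiently large $n$ and on every admissible instance of size $n$ of the second-order MeanFlow architecture described below, outputs an $n\times n\times d$ tensor whose entries all differ from those of the exact output of the architecture by at most $n^{-k}$. *Architecture.* Write $\|\cdot\|_\infty$ for the largest absolute value of an entry. A feature map is a matrix $X\in\mathbb R^{N\times D}$ with $N=n^2$ rows (tokens). A transformer layer has parameters $W_Q,W_K,W_V,W\in\mathbb R^{D\times D}$ and $b\in\mathbb R^D$. Put $\mathsf{LN}(X)_{i,j}=(X_{i,j}-\mu_i)/\sigma_i$ with $\mu_i=\frac1D\sum_jX_{i,j}$ and $\sigma_i^2=\frac1D\sum_j(X_{i,j}-\mu_i)^2$; $\mathsf{Attn}(X)=\mathrm{diag}(A\mathbf 1)^{-1}A\,XW_V$ with $A_{i,j}=\exp\big((XW_Q(XW_K)^\top)_{i,j}/D\big)$; and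 $\mathsf{MLP}(X)_{i,*}=W X_{i,*}+b$. The layer maps $X$ to $\mathsf{MLP}(\mathsf{LN}(Y))+Y$, where $Y=\mathsf{Attn}(\mathsf{LN}(X))+X$. A $\mathsf{ViT}$ with $m$ layers is a composition of $m$ such layers, each with its own parameters. An instance consists of two such models $\mathsf{ViT}_1,\mathsf{ViT}_2$ with $m_1$ and $m_2$ layers, times $1\ge t_0>t_1>\dots>t_T\ge 0$, and an input tensor $Z_0\in\mathbb R^{n\times n\times d}$, read as an $n^2\times d$ matrix. The output of the architecture is $Z_T$, where $$Z_i=Z_{i-1}+(t_i-t_{i-1})\,\mathsf{ViT}_1\big(Z_{i-1}\,\|\,t_i\mathbf 1\,\|\,t_{i-1}\mathbf 1\big)_{*,1:d}+\tfrac12(t_i-t_{i-1})^2\,\mathsf{ViT}_2\big(Z_{i-1}\,\|\,t_i\mathbf 1\,\|\,t_{i-1}\mathbf 1\big)_{*,1:d}$$ for $1\le i\le T$, and $\|$ inside the parentheses is concatenation of columns. *Admissible instances.* In the exact computation of $Z_T$, for every transformer layer and every input $X$ that it receives: the matrices $W_Q,W_K,W_V,W$ and the query, key and value matrices $\mathsf{LN}(X)W_Q$,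 $\mathsf{LN}(X)W_K$, $\mathsf{LN}(X)W_V$ have all entries of absolute value at most $R(n)$; and layer normalization does not amplify small errors at either of its two inputs $V\in\{X,\,Y\}$, that is, for all $\epsilon\le\epsilon_0$ and all $V'$, $\|V'-V\|_\infty\le\epsilon$ implies $\|\mathsf{LN}(V')-\mathsf{LN}(V)\|_\infty\le\epsilon$. *Model of computation.* A unit-cost real RAM with natural-number registers (constants, $+$, truncated $-$, comparison), real registers (rational constants, $+,-,\times,/,\sqrt{\cdot}$, comparison), conversion of natural numbers to reals, and indirectly addressed memories for both types. The input is $n$, $d$, and the list of all real entries of $Z_0$, of the times and of the parameters. The program may depend on $d(\cdot),R(\cdot),m_1,m_2,T,\epsilon_0,k$, but not on $n$ or on the instance. -/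

import Mathlib

open Filter Topology Asymptotics

namespace SecondOrderMeanFlow

/-! ## The architecture -/

/-- The parameters of one transformer layer of width `D`: query, key and value weights of the
attention layer, weight and bias of the MLP layer. -/
structure Layer (D : ℕ) where
  WQ : Matrix (Fin D) (Fin D) ℝ
  WK : Matrix (Fin D) (Fin D) ℝ
  WV : Matrix (Fin D) (Fin D) ℝ
  W : Matrix (Fin D) (Fin D) ℝ
  b : Fin D → ℝ

section Architecture

variable {N : Type} [Fintype N] [DecidableEq N] {D : ℕ}

/-- The attention matrix `A = exp(Q Kᵀ / D)` (entrywise exponential), with `Q = X W_Q`,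
`K = X W_K` and `D` the embedding dimension. -/
noncomputable def attnMatrix (L : Layer D) (X : Matrix N (Fin D) ℝ) : Matrix N N ℝ :=
  fun i j => Real.exp (((X * L.WQ) * (X * L.WK).transpose) i j / (D : ℝ))

/-- The attention layer `diag(A 1)⁻¹ A X W_V`. -/
noncomputable def attn (L : Layer D) (X : Matrix N (Fin D) ℝ) : Matrix N (Fin D) ℝ :=
  Matrix.diagonal (fun i => (∑ j, attnMatrix L X i j)⁻¹) * attnMatrix L X * (X * L.WV)

/-- The MLP layer, row by row `x ↦ W x + b`. -/
noncomputable def mlp (L : Layer D) (X : Matrix N (Fin D) ℝ) : Matrix N (Fin D) ℝ :=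
  fun i => L.W.mulVec (X i) + L.b

/-- The mean of a row. -/
noncomputable def rowMean (x : Fin D → ℝ) : ℝ := (∑ j, x j) / (D : ℝ)

/-- The variance of a row. -/
noncomputable def rowVar (x : Fin D → ℝ) : ℝ := (∑ j, (x j - rowMean x) ^ 2) / (D : ℝ)

/-- Layer normalization: every row is centred and divided by its standard deviation. -/
noncomputable def layerNorm (X : Matrix N (Fin D) ℝ) : Matrix N (Fin D) ℝ :=
  fun i j => (X i j - rowMean (X i)) / Real.sqrt (rowVar (X i))

/-- The attention block with residual connection, `Y = Attn(LN(X)) + X`. -/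
noncomputable def layerMid (L : Layer D) (X : Matrix N (Fin D) ℝ) : Matrix N (Fin D) ℝ :=
  attn L (layerNorm X) + X

/-- One transformer layer, `MLP(LN(Y)) + Y` with `Y = Attn(LN(X)) + X`. -/
noncomputable def layerOut (L : Layer D) (X : Matrix N (Fin D) ℝ) : Matrix N (Fin D) ℝ :=
  mlp L (layerNorm (layerMid L X)) + layerMid L X

/-- The vision transformer with the given list of layers, the head of the list acting first. -/
noncomputable def vit : List (Layer D) → Matrix N (Fin D) ℝ → Matrix N (Fin D) ℝ
  | [], X => X
  | L :: Ls, X => vit Ls (layerOut L X)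

/-- The concatenation `Z ‖ t 1 ‖ s 1` along the feature dimension. -/
def withTimes {d : ℕ} (Z : Matrix N (Fin d) ℝ) (t s : ℝ) : Matrix N (Fin (d + 2)) ℝ :=
  fun i => Fin.append (Z i) ![t, s]

/-- The first `d` columns. -/
def firstCols {d : ℕ} (X : Matrix N (Fin (d + 2)) ℝ) : Matrix N (Fin d) ℝ :=
  fun i l => X i (Fin.castAdd 2 l)

/-- One step of second-order MeanFlow sampling, from time `s` to time `t`. -/
noncomputable def smfStep {d : ℕ} (V₁ V₂ : List (Layer (d + 2))) (s t : ℝ)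
    (Z : Matrix N (Fin d) ℝ) : Matrix N (Fin d) ℝ :=
  Z + (t - s) • firstCols (vit V₁ (withTimes Z t s))
    + ((1 / 2 : ℝ) * (t - s) ^ 2) • firstCols (vit V₂ (withTimes Z t s))

/-- Second-order MeanFlow sampling started from `Z` at time `s`, through the listed later
time steps. -/
noncomputable def smf {d : ℕ} (V₁ V₂ : List (Layer (d + 2))) :
    ℝ → List ℝ → Matrix N (Fin d) ℝ → Matrix N (Fin d) ℝ
  | _, [], Z => Z
  | s, t :: ts, Z => smf V₁ V₂ t ts (smfStep V₁ V₂ s t Z)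

/-! ## The standing assumptions on an instance -/

/-- All entries are bounded by `r` in absolute value, that is `‖A‖_∞ ≤ r`. -/
def EntriesLE {M K : Type} (A : Matrix M K ℝ) (r : ℝ) : Prop := ∀ i j, |A i j| ≤ r

/-- At the input `X`, layer normalization does not increase an entrywise error of size
at most `ε₀`. -/
def LNStableAt (ε₀ : ℝ) (X : Matrix N (Fin D) ℝ) : Prop :=
  ∀ ε ≤ ε₀, ∀ X' : Matrix N (Fin D) ℝ,
    EntriesLE (X' - X) ε → EntriesLE (layerNorm X' - layerNorm X) ε

/-- The assumptions on a layer applied to `X`: weight matrices and query, key and value matrices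
have entries bounded by `R`, and both layer normalizations are stable at their inputs. -/
def LayerAdmissible (R ε₀ : ℝ) (L : Layer D) (X : Matrix N (Fin D) ℝ) : Prop :=
  EntriesLE L.WQ R ∧ EntriesLE L.WK R ∧ EntriesLE L.WV R ∧ EntriesLE L.W R ∧
  EntriesLE (layerNorm X * L.WQ) R ∧ EntriesLE (layerNorm X * L.WK) R ∧
  EntriesLE (layerNorm X * L.WV) R ∧
  LNStableAt ε₀ X ∧ LNStableAt ε₀ (layerMid L X)

/-- Every layer of the vision transformer is admissible at the input it receives. -/
def VitAdmissible (R ε₀ : ℝ) : List (Layer D) → Matrix N (Fin D) ℝ → Prop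
  | [], _ => True
  | L :: Ls, X => LayerAdmissible R ε₀ L X ∧ VitAdmissible R ε₀ Ls (layerOut L X)

/-- Both vision transformers are admissible at every step of the sampling. -/
def SmfAdmissible {d : ℕ} (R ε₀ : ℝ) (V₁ V₂ : List (Layer (d + 2))) :
    ℝ → List ℝ → Matrix N (Fin d) ℝ → Prop
  | _, [], _ => True
  | s, t :: ts, Z =>
      VitAdmissible R ε₀ V₁ (withTimes Z t s) ∧ VitAdmissible R ε₀ V₂ (withTimes Z t s) ∧
      SmfAdmissible R ε₀ V₁ V₂ t ts (smfStep V₁ V₂ s t Z)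

end Architecture

/-- An input of the sampling problem: an `n × n × d` tensor (`n²` tokens with `d` channels),
vision transformers with `m₁` and `m₂` layers of width `d + 2`, and the time schedule
`t₀ > t₁ > ⋯ > t_T` in `[0, 1]`. -/
structure Inst (n d m₁ m₂ T : ℕ) where
  Z : Matrix (Fin n × Fin n) (Fin d) ℝ
  V₁ : List (Layer (d + 2))
  V₂ : List (Layer (d + 2))
  t₀ : ℝ
  ts : List ℝ
  length_V₁ : V₁.length = m₁
  length_V₂ : V₂.length = m₂
  length_ts : ts.length = T
  times_mem : ∀ t ∈ t₀ :: ts, t ∈ Set.Icc (0 : ℝ) 1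
  times_decreasing : (t₀ :: ts).Pairwise (fun s t => t < s)

namespace Inst

variable {n d m₁ m₂ T : ℕ}

/-- The exact output of the architecture. -/
noncomputable def output (I : Inst n d m₁ m₂ T) : Matrix (Fin n × Fin n) (Fin d) ℝ :=
  smf I.V₁ I.V₂ I.t₀ I.ts I.Z

/-- The standing assumptions with entry bound `R` and stability radius `ε₀`. -/
def Admissible (I : Inst n d m₁ m₂ T) (R ε₀ : ℝ) : Prop :=
  SmfAdmissible R ε₀ I.V₁ I.V₂ I.t₀ I.ts I.Z

end Inst

/-! ## The machine model: a unit-cost real RAM -/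

/-- The state: finitely many of the registers occur in a given program; the memories are
accessed indirectly, through addresses in natural-number registers. -/
structure RamState where
  ireg : ℕ → ℕ
  imem : ℕ → ℕ
  freg : ℕ → ℝ
  fmem : ℕ → ℝ

/-- The elementary instructions (the first argument names the target). -/
inductive Instr where
  | iconst (r c : ℕ)
  | iadd (r a b : ℕ)
  | isub (r a b : ℕ)
  | iload (r a : ℕ)
  | istore (a b : ℕ)
  | fconst (r : ℕ) (q : ℚ)
  | fofNat (r a : ℕ)
  | fadd (r a b : ℕ)
  | fsub (r a b : ℕ)
  | fmul (r a b : ℕ)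
  | fdiv (r a b : ℕ)
  | fsqrt (r a : ℕ)
  | fload (r a : ℕ)
  | fstore (a b : ℕ)

/-- The effect of an elementary instruction. There is no conversion from reals to
natural numbers. -/
noncomputable def Instr.run : Instr → RamState → RamState
  | .iconst r c, s => { s with ireg := Function.update s.ireg r c }
  | .iadd r a b, s => { s with ireg := Function.update s.ireg r (s.ireg a + s.ireg b) }
  | .isub r a b, s => { s with ireg := Function.update s.ireg r (s.ireg a - s.ireg b) }
  | .iload r a, s => { s with ireg := Function.update s.ireg r (s.imem (s.ireg a)) }
  | .istore a b, s => { s with imem := Function.update s.imem (s.ireg a) (s.ireg b) }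
  | .fconst r q, s => { s with freg := Function.update s.freg r (q : ℝ) }
  | .fofNat r a, s => { s with freg := Function.update s.freg r (s.ireg a : ℝ) }
  | .fadd r a b, s => { s with freg := Function.update s.freg r (s.freg a + s.freg b) }
  | .fsub r a b, s => { s with freg := Function.update s.freg r (s.freg a - s.freg b) }
  | .fmul r a b, s => { s with freg := Function.update s.freg r (s.freg a * s.freg b) }
  | .fdiv r a b, s => { s with freg := Function.update s.freg r (s.freg a / s.freg b) }
  | .fsqrt r a, s => { s with freg := Function.update s.freg r (Real.sqrt (s.freg a)) }
  | .fload r a, s => { s with freg := Function.update s.freg r (s.fmem (s.ireg a)) }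
  | .fstore a b, s => { s with fmem := Function.update s.fmem (s.ireg a) (s.freg b) }

/-- Real RAM programs. `iteI a b` and `loop a b` test whether natural-number register `a` is
below register `b`; `iteF a b` makes the same test on real registers. -/
inductive Prog where
  | instr (i : Instr)
  | seq (p q : Prog)
  | iteI (a b : ℕ) (p q : Prog)
  | iteF (a b : ℕ) (p q : Prog)
  | loop (a b : ℕ) (p : Prog)

/-- `Exec p s t s'`: started in the state `s`, the program `p` halts after exactly `t` steps, in
the state `s'`. Every elementary instruction and every test is one step. -/
inductive Exec : Prog → RamState → ℕ → RamState → Prop where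
  | instr (i : Instr) (s : RamState) : Exec (.instr i) s 1 (i.run s)
  | seq {p q : Prog} {s s' s'' : RamState} {t t' : ℕ} :
      Exec p s t s' → Exec q s' t' s'' → Exec (.seq p q) s (t + t') s''
  | iteI_true {a b : ℕ} {p q : Prog} {s s' : RamState} {t : ℕ} :
      s.ireg a < s.ireg b → Exec p s t s' → Exec (.iteI a b p q) s (t + 1) s'
  | iteI_false {a b : ℕ} {p q : Prog} {s s' : RamState} {t : ℕ} :
      ¬ s.ireg a < s.ireg b → Exec q s t s' → Exec (.iteI a b p q) s (t + 1) s'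
  | iteF_true {a b : ℕ} {p q : Prog} {s s' : RamState} {t : ℕ} :
      s.freg a < s.freg b → Exec p s t s' → Exec (.iteF a b p q) s (t + 1) s'
  | iteF_false {a b : ℕ} {p q : Prog} {s s' : RamState} {t : ℕ} :
      ¬ s.freg a < s.freg b → Exec q s t s' → Exec (.iteF a b p q) s (t + 1) s'
  | loop_done {a b : ℕ} {p : Prog} {s : RamState} :
      ¬ s.ireg a < s.ireg b → Exec (.loop a b p) s 1 s
  | loop_step {a b : ℕ} {p : Prog} {s s' s'' : RamState} {t t' : ℕ} :
      s.ireg a < s.ireg b → Exec p s t s' → Exec (.loop a b p) s' t' s'' →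
      Exec (.loop a b p) s (t + t' + 1) s''

/-- The machine is deterministic: final state and running time are unique. -/
theorem Exec.deterministic {p : Prog} {s s₁ s₂ : RamState} {t₁ t₂ : ℕ}
    (h₁ : Exec p s t₁ s₁) (h₂ : Exec p s t₂ s₂) : t₁ = t₂ ∧ s₁ = s₂ := by
  induction h₁ generalizing t₂ s₂ with
  | instr i s => cases h₂; exact ⟨rfl, rfl⟩
  | seq _ _ ih ih' =>
    cases h₂ with
    | seq k k' =>
      obtain ⟨rfl, rfl⟩ := ih k
      obtain ⟨rfl, rfl⟩ := ih' k'
      exact ⟨rfl, rfl⟩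
  | iteI_true c _ ih =>
    cases h₂ with
    | iteI_true _ k => obtain ⟨rfl, rfl⟩ := ih k; exact ⟨rfl, rfl⟩
    | iteI_false c' _ => exact absurd c c'
  | iteI_false c _ ih =>
    cases h₂ with
    | iteI_true c' _ => exact absurd c' c
    | iteI_false _ k => obtain ⟨rfl, rfl⟩ := ih k; exact ⟨rfl, rfl⟩
  | iteF_true c _ ih =>
    cases h₂ with
    | iteF_true _ k => obtain ⟨rfl, rfl⟩ := ih k; exact ⟨rfl, rfl⟩
    | iteF_false c' _ => exact absurd c c'
  | iteF_false c _ ih =>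
    cases h₂ with
    | iteF_true c' _ => exact absurd c' c
    | iteF_false _ k => obtain ⟨rfl, rfl⟩ := ih k; exact ⟨rfl, rfl⟩
  | loop_done c =>
    cases h₂ with
    | loop_done _ => exact ⟨rfl, rfl⟩
    | loop_step c' _ _ => exact absurd c' c
  | loop_step c _ _ ih ih' =>
    cases h₂ with
    | loop_done c' => exact absurd c c'
    | loop_step _ k k' =>
      obtain ⟨rfl, rfl⟩ := ih k
      obtain ⟨rfl, rfl⟩ := ih' k'
      exact ⟨rfl, rfl⟩

/-! ## Input and output -/

/-- A matrix, row by row. -/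
def encodeMatrix {a b : ℕ} (A : Matrix (Fin a) (Fin b) ℝ) : List ℝ :=
  (List.ofFn fun i => List.ofFn (A i)).flatten

/-- An `n × n × d` tensor, row by row: the entry `(i, j, l)` is at position `(i n + j) d + l`. -/
def encodeTensor {n d : ℕ} (Z : Matrix (Fin n × Fin n) (Fin d) ℝ) : List ℝ :=
  (List.ofFn fun i => (List.ofFn fun j => List.ofFn (Z (i, j))).flatten).flatten

/-- The parameters of a layer. -/
def Layer.encode {D : ℕ} (L : Layer D) : List ℝ :=
  encodeMatrix L.WQ ++ encodeMatrix L.WK ++ encodeMatrix L.WV ++ encodeMatrix L.W ++ List.ofFn L.b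

namespace Inst

variable {n d m₁ m₂ T : ℕ}

/-- The whole input as a list of reals. -/
def encode (I : Inst n d m₁ m₂ T) : List ℝ :=
  encodeTensor I.Z ++ (I.t₀ :: I.ts) ++ (I.V₁.map Layer.encode).flatten
    ++ (I.V₂.map Layer.encode).flatten

/-- The initial state: `n` and `d` in the first two natural-number registers, the input in the
real memory from address `0` on, and zero elsewhere. -/
def initState (I : Inst n d m₁ m₂ T) : RamState where
  ireg := fun r => if r = 0 then n else if r = 1 then d else 0
  imem := fun _ => 0
  freg := fun _ => 0
  fmem := fun a => I.encode.getD a 0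

end Inst

/-- The `n × n × d` tensor that a state holds in its real memory from address `0` on. -/
def RamState.tensor (s : RamState) (n d : ℕ) : Matrix (Fin n × Fin n) (Fin d) ℝ :=
  fun i l => s.fmem (((i.1 : ℕ) * n + i.2) * d + l)

end SecondOrderMeanFlow

namespace SecondOrderMeanFlow

/-! ## Running programs within a time bound -/

/-! Attention is the only expensive operation: with `N = n²` tokens, the attention matrix has `n⁴`
entries. It is never formed. The scaled inner products of queries and keys are at most `ρ²` with `ρ
= |R| + 1`, and `ρ² = o(log n)`. Hence the Taylor polynomial of the exponential, of a degree `G`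
that is an arbitrarily small multiple of `log n`, is accurate up to any fixed power of `1 / n`. By
the multinomial theorem, this polynomial of `∑ q_l k_l / D` is a sum, over the monomials of degree
at most `G` in `D` variables, of a function of the query times a function of the key (`Wp.featC`).
There are `(D + G).choose G` monomials, which is `n ^ o(1)` because `D = O(log n)` and `G ≤ α log n`
with `α` as small as desired (`eventually_degBound`). So the approximate attention matrix factors
through `n ^ o(1)` features. Summing over the keys once per feature, and then over the features once
per query, takes time `n ^ (2 + o(1))` (`Wp.layerC`).

The function `R` is arbitrary, so a program cannot evaluate it. The degree is therefore found at run
time from the largest entries of the computed queries and keys (`Wp.degC`). The bound `ρ` occurs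
only in the proof that the search stops early.

Errors: the Taylor polynomial gives every attention weight with a small relative error, so the
weighted means are accurate independently of the number of tokens (`weighted_mean_error`). Together
with the assumed stability of layer normalization at the exact inputs, this shows that one layer
turns an entrywise error `e` into a polylogarithmic multiple of `e`, hence into at most `n * e`
(`apxOut_error`). A sampling step costs at most a factor `n ^ (m₁ + m₂ + 1)` (`Wp.stepC`). As `T`,
`m₁` and `m₂` are fixed, it suffices to start from an allowance `n ^ (-M)` with a constant `M`.

Machine: the algorithm is written in a small command language, compiled to the RAM (`NE.comp_spec`,
`RE.comp_spec`) and verified with weakest-precondition rules that carry the running time along.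
Small registers (dimension, degree, number of features) are bounded by a parameter `S`. Time bounds
have the form `κ * N ^ k * S ^ h`, where `k` counts nested big loops. For the whole program `k = 1`,
with `κ` and `h` fixed (`PB.mainC`), while `S = ⌊n ^ δ⌋` is eventually a valid bound for each `δ >
0`. So one and the same program runs in time `O(n ^ (2 + x))` for every `x > 0`, and a diagonal
argument (`exists_tendsto_zero_of_eventually`) turns this into a single exponent `2 + γ n` with `γ`
tending to zero. -/

/-- The program `p`, started in `s`, halts in `s'` after at most `t` steps. -/
def Runs (p : Prog) (s : RamState) (t : ℕ) (s' : RamState) : Prop :=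
  ∃ t' ≤ t, Exec p s t' s'

theorem Runs.mono {p : Prog} {s s' : RamState} {t t' : ℕ} (h : Runs p s t s') (ht : t ≤ t') :
    Runs p s t' s' := by
  obtain ⟨u, hu, h⟩ := h
  exact ⟨u, hu.trans ht, h⟩

theorem Runs.seq {p q : Prog} {s s' s'' : RamState} {t t' : ℕ} (h : Runs p s t s')
    (h' : Runs q s' t' s'') : Runs (.seq p q) s (t + t') s'' := by
  obtain ⟨u, hu, h⟩ := h
  obtain ⟨u', hu', h'⟩ := h'
  exact ⟨u + u', by omega, .seq h h'⟩

theorem Runs.instr (i : Instr) (s : RamState) : Runs (.instr i) s 1 (i.run s) :=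
  ⟨1, le_rfl, .instr i s⟩

/-- Induction on the number `k` of passes still to come, with the invariant at `B - k`. Every pass
pays one step for its test, and the final `+ 1` is the test that fails. -/
theorem Runs.loop {a b : ℕ} {p : Prog} (I : ℕ → RamState → Prop) {B t : ℕ}
    (hI : ∀ i s, I i s → s.ireg a = i ∧ s.ireg b = B)
    (step : ∀ i < B, ∀ s, I i s → ∃ s', Runs p s t s' ∧ I (i + 1) s')
    {s : RamState} (h0 : I 0 s) :
    ∃ s', Runs (.loop a b p) s (B * (t + 1) + 1) s' ∧ I B s' := by
  suffices H : ∀ k ≤ B, ∀ s, I (B - k) s →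
      ∃ s', Runs (.loop a b p) s (k * (t + 1) + 1) s' ∧ I B s' from
    H B le_rfl s (by simpa using h0)
  intro k
  induction k with
  | zero =>
    intro _ s hs
    refine ⟨s, ⟨1, by omega, .loop_done ?_⟩, by simpa using hs⟩
    have := hI _ _ hs
    omega
  | succ k ih =>
    intro hk s hs
    obtain ⟨s₁, ⟨t₁, ht₁, h₁⟩, hs₁⟩ := step (B - (k + 1)) (by omega) s hs
    rw [show B - (k + 1) + 1 = B - k by omega] at hs₁
    obtain ⟨s₂, ⟨t₂, ht₂, h₂⟩, hs₂⟩ := ih (by omega) s₁ hs₁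
    refine ⟨s₂, ⟨t₁ + t₂ + 1, ?_, .loop_step ?_ h₁ h₂⟩, hs₂⟩
    · have : (k + 1) * (t + 1) = k * (t + 1) + t + 1 := by ring
      omega
    · have := hI _ _ hs
      omega

/-- A nonempty sequence of elementary instructions. -/
def block : Instr → List Instr → Prog
  | i, [] => .instr i
  | i, j :: l => .seq (.instr i) (block j l)

theorem Runs.block (i : Instr) (l : List Instr) (s : RamState) :
    Runs (block i l) s (l.length + 1) ((i :: l).foldl (fun s i => i.run s) s) := by
  induction l generalizing i s with
  | nil => exact Runs.instr i s
  | cons j l ih =>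
    exact ((Runs.instr i s).seq (ih j (i.run s))).mono (by simp; omega)

/-! ## Expressions -/

/-- Natural-number expressions; a product has a register as its right factor. -/
inductive NE where
  | const (c : ℕ)
  | var (v : ℕ)
  | add (a b : NE)
  | sub (a b : NE)
  | mul (a : NE) (v : ℕ)
  | ld (a : NE)

/-- Real expressions; `sum v b e` is the sum of `e` over the values of the register `v` below that
of the register `b`. -/
inductive RE where
  | const (q : ℚ)
  | var (v : ℕ)
  | ofNat (a : NE)
  | add (a b : RE)
  | sub (a b : RE)
  | mul (a b : RE)
  | div (a b : RE)
  | sqrt (a : RE)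
  | ld (a : NE)
  | sum (v b : ℕ) (e : RE)

/-- Assignment to a natural-number register. -/
def RamState.setI (s : RamState) (v x : ℕ) : RamState :=
  { s with ireg := Function.update s.ireg v x }

/-- Assignment to a real register. -/
def RamState.setF (s : RamState) (v : ℕ) (x : ℝ) : RamState :=
  { s with freg := Function.update s.freg v x }

/-- Assignment to a cell of the natural-number memory. -/
def RamState.setIM (s : RamState) (a x : ℕ) : RamState :=
  { s with imem := Function.update s.imem a x }

/-- Assignment to a cell of the real memory. -/
def RamState.setFM (s : RamState) (a : ℕ) (x : ℝ) : RamState :=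
  { s with fmem := Function.update s.fmem a x }

section Setters
variable (s : RamState) (v a x u : ℕ) (y : ℝ)
@[simp] theorem setI_ireg : (s.setI v x).ireg u = if u = v then x else s.ireg u := by
  simp [RamState.setI, Function.update_apply]
@[simp] theorem setI_freg : (s.setI v x).freg = s.freg := rfl
@[simp] theorem setI_imem : (s.setI v x).imem = s.imem := rfl
@[simp] theorem setI_fmem : (s.setI v x).fmem = s.fmem := rfl
@[simp] theorem setF_ireg : (s.setF v y).ireg = s.ireg := rfl
@[simp] theorem setF_freg : (s.setF v y).freg u = if u = v then y else s.freg u := by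
  simp [RamState.setF, Function.update_apply]
@[simp] theorem setF_imem : (s.setF v y).imem = s.imem := rfl
@[simp] theorem setF_fmem : (s.setF v y).fmem = s.fmem := rfl
@[simp] theorem setIM_ireg : (s.setIM v x).ireg = s.ireg := rfl
@[simp] theorem setIM_freg : (s.setIM v x).freg = s.freg := rfl
@[simp] theorem setIM_imem : (s.setIM v x).imem u = if u = v then x else s.imem u := by
  simp [RamState.setIM, Function.update_apply]
@[simp] theorem setIM_fmem : (s.setIM v x).fmem = s.fmem := rfl
@[simp] theorem setFM_ireg : (s.setFM v y).ireg = s.ireg := rfl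
@[simp] theorem setFM_freg : (s.setFM v y).freg = s.freg := rfl
@[simp] theorem setFM_imem : (s.setFM v y).imem = s.imem := rfl
@[simp] theorem setFM_fmem : (s.setFM v y).fmem u = if u = v then y else s.fmem u := by
  simp [RamState.setFM, Function.update_apply]
end Setters

/-- The registers that hold small numbers. -/
def sm (v : ℕ) : Bool := v == 1 || (6 ≤ v && v < 20)

/-- The value of a natural-number expression. -/
def NE.eval (s : RamState) : NE → ℕ
  | .const c => c
  | .var v => s.ireg v
  | .add a b => a.eval s + b.eval s
  | .sub a b => a.eval s - b.eval s
  | .mul a v => a.eval s * s.ireg v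
  | .ld a => s.imem (a.eval s)

/-- The value of a real expression. -/
noncomputable def RE.eval : RE → RamState → ℝ
  | .const q, _ => q
  | .var v, s => s.freg v
  | .ofNat a, s => (a.eval s : ℝ)
  | .add a b, s => a.eval s + b.eval s
  | .sub a b, s => a.eval s - b.eval s
  | .mul a b, s => a.eval s * b.eval s
  | .div a b, s => a.eval s / b.eval s
  | .sqrt a, s => Real.sqrt (a.eval s)
  | .ld a, s => s.fmem (a.eval s)
  | .sum v b e, s => ∑ i ∈ Finset.range (s.ireg b), e.eval (s.setI v i)

/-- Well-formedness: variables are the first 24 registers, factors are small registers. -/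
def NE.ok : NE → Bool
  | .const _ => true
  | .var v => v < 24
  | .add a b => a.ok && b.ok
  | .sub a b => a.ok && b.ok
  | .mul a v => a.ok && sm v
  | .ld a => a.ok

/-- Well-formedness: variables are the first 24 natural-number and the first 8 real registers,
and the range of a sum is a small register or register 2. -/
def RE.ok : RE → Bool
  | .const _ => true
  | .var v => v < 8
  | .ofNat a => a.ok
  | .add a b => a.ok && b.ok
  | .sub a b => a.ok && b.ok
  | .mul a b => a.ok && b.ok
  | .div a b => a.ok && b.ok
  | .sqrt a => a.ok
  | .ld a => a.ok
  | .sum v b e => ((sm v && sm b) || (v == 4 && b == 2)) && e.ok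

/-- A time bound for the evaluation, when small registers are at most `S`. -/
def NE.bd (S : ℕ) : NE → ℕ
  | .const _ => 1
  | .var _ => 2
  | .add a b => a.bd S + b.bd S + 1
  | .sub a b => a.bd S + b.bd S + 1
  | .mul a _ => a.bd S + (3 * S + 6)
  | .ld a => a.bd S + 1

/-- A time bound for the evaluation, when small registers are at most `S` and register 2 is at
most `N`. -/
def RE.bd (N S : ℕ) : RE → ℕ
  | .const _ => 1
  | .var _ => 2
  | .ofNat a => a.bd S + 1
  | .add a b => a.bd N S + b.bd N S + 1
  | .sub a b => a.bd N S + b.bd N S + 1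
  | .mul a b => a.bd N S + b.bd N S + 1
  | .div a b => a.bd N S + b.bd N S + 1
  | .sqrt a => a.bd N S + 1
  | .ld a => a.bd S + 1
  | .sum _ b e => (if sm b then S else N) * (e.bd N S + 6) + 9

/-- Compilation; the result is in register `r`, registers from `r` on are scratch space. -/
def NE.comp : NE → ℕ → Prog
  | .const c, r => .instr (.iconst r c)
  | .var v, r => block (.iconst r 0) [.iadd r v r]
  | .add a b, r => .seq (a.comp r) (.seq (b.comp (r + 1)) (.instr (.iadd r r (r + 1))))
  | .sub a b, r => .seq (a.comp r) (.seq (b.comp (r + 1)) (.instr (.isub r r (r + 1))))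
  -- The machine cannot multiply natural numbers, so the left factor is added up as many times as
  -- register `v` says. The cost is linear in that register, which is why it has to be small.
  | .mul a v, r => .seq (a.comp r)
      (.seq (block (.iconst (r + 1) 0) [.iconst (r + 2) 0, .iconst (r + 3) 1])
      (.seq (.loop (r + 2) v (block (.iadd (r + 1) (r + 1) r) [.iadd (r + 2) (r + 2) (r + 3)]))
        (block (.iconst r 0) [.iadd r (r + 1) r])))
  | .ld a, r => .seq (a.comp r) (.instr (.iload r r))

/-- Compilation; the result is in the real register `q`, registers from `r` and real registers
from `q` on are scratch space. -/
def RE.comp : RE → ℕ → ℕ → Prog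
  | .const c, _, q => .instr (.fconst q c)
  | .var v, _, q => block (.fconst q 0) [.fadd q v q]
  | .ofNat a, r, q => .seq (a.comp r) (.instr (.fofNat q r))
  | .add a b, r, q => .seq (a.comp r q) (.seq (b.comp r (q + 1)) (.instr (.fadd q q (q + 1))))
  | .sub a b, r, q => .seq (a.comp r q) (.seq (b.comp r (q + 1)) (.instr (.fsub q q (q + 1))))
  | .mul a b, r, q => .seq (a.comp r q) (.seq (b.comp r (q + 1)) (.instr (.fmul q q (q + 1))))
  | .div a b, r, q => .seq (a.comp r q) (.seq (b.comp r (q + 1)) (.instr (.fdiv q q (q + 1))))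
  | .sqrt a, r, q => .seq (a.comp r q) (.instr (.fsqrt q q))
  | .ld a, r, q => .seq (a.comp r) (.instr (.fload q r))
  -- The old value of `v` is saved in `r` and restored at the end, and the counter is a scratch
  -- register. Evaluating a sum thus leaves every variable as it was.
  | .sum v b e, r, q =>
      .seq (block (.iconst r 0) [.iadd r v r, .iconst (r + 1) 0, .iadd (r + 1) b (r + 1),
        .iconst (r + 2) 0, .fconst q 0])
      (.seq (.loop (r + 2) (r + 1) (.seq (block (.iconst v 0) [.iadd v (r + 2) v])
          (.seq (e.comp (r + 4) (q + 1))
            (block (.fadd q q (q + 1)) [.iconst (r + 3) 1, .iadd (r + 2) (r + 2) (r + 3)]))))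
        (block (.iconst v 0) [.iadd v r v]))

theorem sm_lt {v : ℕ} (h : sm v = true) : v < 24 := by
  simp [sm] at h; omega

theorem NE.eval_congr {s s' : RamState} (hi : ∀ v < 24, s.ireg v = s'.ireg v)
    (hm : s.imem = s'.imem) (e : NE) (he : e.ok = true) : e.eval s = e.eval s' := by
  induction e with
  | const c => rfl
  | var v => exact hi v (by simpa [NE.ok] using he)
  | add a b iha ihb | sub a b iha ihb =>
    simp only [NE.ok, Bool.and_eq_true] at he
    simp [NE.eval, iha he.1, ihb he.2]
  | mul a v ih =>
    simp only [NE.ok, Bool.and_eq_true] at he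
    simp [NE.eval, ih he.1, hi v (sm_lt he.2)]
  | ld a ih => simp [NE.eval, ih he, hm]

theorem RE.eval_congr {s s' : RamState} (hi : ∀ v < 24, s.ireg v = s'.ireg v)
    (hm : s.imem = s'.imem) (hf : ∀ v < 8, s.freg v = s'.freg v) (hM : s.fmem = s'.fmem)
    (e : RE) (he : e.ok = true) : e.eval s = e.eval s' := by
  induction e generalizing s s' with
  | const c => rfl
  | var v => exact hf v (by simpa [RE.ok] using he)
  | ofNat a => simp [RE.eval, NE.eval_congr hi hm a he]
  | add a b iha ihb | sub a b iha ihb | mul a b iha ihb | div a b iha ihb =>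
    simp only [RE.ok, Bool.and_eq_true] at he
    simp [RE.eval, iha hi hm hf hM he.1, ihb hi hm hf hM he.2]
  | sqrt a ih => simp [RE.eval, ih hi hm hf hM he]
  | ld a => simp [RE.eval, NE.eval_congr hi hm a he, hM]
  | sum v b e ih =>
    simp only [RE.ok, Bool.and_eq_true] at he
    have hb : b < 24 := by
      have := he.1
      simp [sm] at this; omega
    simp only [RE.eval, hi b hb]
    refine Finset.sum_congr rfl fun i _ => ih (fun u hu => ?_) hm hf hM he.2
    simp [hi u hu]

/-- Small registers are at most `S`, register 2 is at most `N`. -/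
def Small (N S : ℕ) (s : RamState) : Prop := (∀ v, sm v = true → s.ireg v ≤ S) ∧ s.ireg 2 ≤ N

/-- Stack discipline: the value appears in `r` and everything below `r` survives, so a second
operand compiled at `r + 1` cannot destroy the first. -/
theorem NE.comp_spec {N S : ℕ} (e : NE) (he : e.ok = true) (r : ℕ) (hr : 24 ≤ r) (s : RamState)
    (hs : Small N S s) :
    ∃ s', Runs (e.comp r) s (e.bd S) s' ∧ s'.ireg r = e.eval s ∧
      (∀ x < r, s'.ireg x = s.ireg x) ∧ s'.imem = s.imem ∧ s'.freg = s.freg ∧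
      s'.fmem = s.fmem := by
  induction e generalizing r s with
  | const c =>
    refine ⟨_, Runs.instr _ _, by simp [Instr.run, NE.eval], ?_, rfl, rfl, rfl⟩
    intro x hx
    simp [Instr.run, hx.ne]
  | var v =>
    have hv : v < 24 := by simpa [NE.ok] using he
    refine ⟨_, Runs.block _ _ _, ?_, ?_, rfl, rfl, rfl⟩
    · simp [Instr.run, NE.eval, show v ≠ r by omega]
    · intro x hx
      simp [Instr.run, hx.ne]
  | add a b iha ihb | sub a b iha ihb =>
    simp only [NE.ok, Bool.and_eq_true] at he
    obtain ⟨s₁, h₁, e₁, k₁, i₁, f₁, m₁⟩ := iha he.1 r hr s hs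
    have hs₁ : Small N S s₁ :=
      ⟨fun v hv => by rw [k₁ v (by have := sm_lt hv; omega)]; exact hs.1 v hv,
        by rw [k₁ 2 (by omega)]; exact hs.2⟩
    obtain ⟨s₂, h₂, e₂, k₂, i₂, f₂, m₂⟩ := ihb he.2 (r + 1) (by omega) s₁ hs₁
    refine ⟨_, (h₁.seq (h₂.seq (Runs.instr _ _))).mono (by simp [NE.bd]; omega), ?_, ?_, ?_, ?_,
      ?_⟩
    · have : b.eval s₁ = b.eval s :=
        NE.eval_congr (fun v hv => k₁ v (by omega)) i₁ b he.2
      simp [Instr.run, NE.eval, k₂ r (by omega), e₁, e₂, this]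
    · intro x hx
      simp [Instr.run, hx.ne, k₂ x (by omega), k₁ x hx]
    · simp [Instr.run, i₁, i₂]
    · simp [Instr.run, f₁, f₂]
    · simp [Instr.run, m₁, m₂]
  | ld a ih =>
    obtain ⟨s₁, h₁, e₁, k₁, i₁, f₁, m₁⟩ := ih he r hr s hs
    refine ⟨_, h₁.seq (Runs.instr _ _), ?_, ?_, ?_, ?_, ?_⟩
    · simp [Instr.run, NE.eval, e₁, i₁]
    · intro x hx
      simp [Instr.run, hx.ne, k₁ x hx]
    all_goals simp [Instr.run, *]
  | mul a v ih =>
    simp only [NE.ok, Bool.and_eq_true] at he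
    have hv := sm_lt he.2
    obtain ⟨s₁, h₁, e₁, k₁, i₁, f₁, m₁⟩ := ih he.1 r hr s hs
    have h₂ := Runs.block (.iconst (r + 1) 0) [.iconst (r + 2) 0, .iconst (r + 3) 1] s₁
    set s₂ := List.foldl (fun s i => Instr.run i s) s₁
      (.iconst (r + 1) 0 :: [.iconst (r + 2) 0, .iconst (r + 3) 1]) with hs₂
    obtain ⟨s₃, h₃, l1, l2, l3, l4, l5, l6⟩ := Runs.loop (a := r + 2) (b := v)
      (p := block (.iadd (r + 1) (r + 1) r) [.iadd (r + 2) (r + 2) (r + 3)])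
      (t := 2) (B := s.ireg v) (s := s₂)
      (fun i s' => s'.ireg (r + 1) = s₁.ireg r * i ∧ s'.ireg (r + 2) = i ∧ s'.ireg (r + 3) = 1 ∧
        (∀ x < r + 1, s'.ireg x = s₁.ireg x) ∧
        s'.imem = s₁.imem ∧ s'.freg = s₁.freg ∧ s'.fmem = s₁.fmem)
      (fun i s' h => ⟨h.2.1, by rw [h.2.2.2.1 v (by omega), k₁ v (by omega)]⟩)
      (fun i _ s' h => by
        obtain ⟨l1, l2, l3, l4, l5⟩ := h
        refine ⟨_, Runs.block _ _ _, ?_, ?_, ?_, ?_, l5⟩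
        · simp [Instr.run, l1, l4 r (by omega)]; ring
        · simp [Instr.run, l2, l3]
        · simp [Instr.run, l3]
        · intro x hx
          simp [Instr.run, l4 x hx, show x ≠ r + 1 by omega,
            show x ≠ r + 2 by omega])
      (by
        refine ⟨?_, ?_, ?_, ?_, rfl, rfl, rfl⟩
        · simp [hs₂, Instr.run]
        · simp [hs₂, Instr.run]
        · simp [hs₂, Instr.run]
        · intro x hx
          simp [hs₂, Instr.run, show x ≠ r + 1 by omega,
            show x ≠ r + 2 by omega, show x ≠ r + 3 by omega])
    refine ⟨_, (h₁.seq (h₂.seq (h₃.seq (Runs.block _ _ _)))).mono ?_, ?_, ?_, ?_, ?_, ?_⟩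
    · have := hs.1 v he.2
      simp [NE.bd]; omega
    · simp [Instr.run, NE.eval, l1, e₁]
    · intro x hx
      simp [Instr.run, hx.ne, k₁ x hx, l4 x (by omega)]
    · simp [Instr.run, l5, i₁]
    · simp [Instr.run, l6.1, f₁]
    · simp [Instr.run, l6.2, m₁]

theorem Small.congr {N S : ℕ} {s s' : RamState} (hs : Small N S s)
    (h : ∀ v < 24, s'.ireg v = s.ireg v) : Small N S s' :=
  ⟨fun v hv => by rw [h v (sm_lt hv)]; exact hs.1 v hv, by rw [h 2 (by omega)]; exact hs.2⟩

/-- The same discipline in both register files. For a sum, real register `q` accumulates the partial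
sums while the summand is compiled at `q + 1`, above the four scratch registers of the loop. -/
theorem RE.comp_spec {N S : ℕ} (e : RE) (he : e.ok = true) (r q : ℕ) (hr : 24 ≤ r) (hq : 8 ≤ q)
    (s : RamState) (hs : Small N S s) :
    ∃ s', Runs (e.comp r q) s (e.bd N S) s' ∧ s'.freg q = e.eval s ∧
      (∀ x < r, s'.ireg x = s.ireg x) ∧ s'.imem = s.imem ∧ (∀ x < q, s'.freg x = s.freg x) ∧
      s'.fmem = s.fmem := by
  induction e generalizing r q s with
  | const c =>
    refine ⟨_, Runs.instr _ _, by simp [Instr.run, RE.eval], ?_, rfl, ?_, rfl⟩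
    · intro x hx
      simp [Instr.run]
    · intro x hx
      simp [Instr.run, hx.ne]
  | var v =>
    have hv : v < 8 := by simpa [RE.ok] using he
    refine ⟨_, Runs.block _ _ _, ?_, ?_, rfl, ?_, rfl⟩
    · simp [Instr.run, RE.eval, show v ≠ q by omega]
    · intro x hx
      simp [Instr.run]
    · intro x hx
      simp [Instr.run, hx.ne]
  | ofNat a =>
    obtain ⟨s₁, h₁, e₁, k₁, i₁, f₁, m₁⟩ := NE.comp_spec a he r hr s hs
    refine ⟨_, h₁.seq (Runs.instr _ _), ?_, ?_, ?_, ?_, ?_⟩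
    · simp [Instr.run, RE.eval, e₁]
    · intro x hx
      simp [Instr.run, k₁ x hx]
    · simp [Instr.run, i₁]
    · intro x hx
      simp [Instr.run, hx.ne, f₁]
    · simp [Instr.run, m₁]
  | add a b iha ihb | sub a b iha ihb | mul a b iha ihb | div a b iha ihb =>
    simp only [RE.ok, Bool.and_eq_true] at he
    obtain ⟨s₁, h₁, e₁, k₁, i₁, f₁, m₁⟩ := iha he.1 r q hr hq s hs
    obtain ⟨s₂, h₂, e₂, k₂, i₂, f₂, m₂⟩ := ihb he.2 r (q + 1) hr (by omega) s₁
      (hs.congr fun v hv => k₁ v (by omega))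
    refine ⟨_, (h₁.seq (h₂.seq (Runs.instr _ _))).mono (by simp [RE.bd]; omega), ?_, ?_, ?_, ?_,
      ?_⟩
    · have : b.eval s₁ = b.eval s :=
        RE.eval_congr (fun v hv => k₁ v (by omega)) i₁ (fun v hv => f₁ v (by omega)) m₁ b he.2
      simp [Instr.run, RE.eval, f₂ q (by omega), e₁, e₂, this]
    · intro x hx
      simp [Instr.run, k₂ x hx, k₁ x hx]
    · simp [Instr.run, i₁, i₂]
    · intro x hx
      simp [Instr.run, hx.ne, f₂ x (by omega), f₁ x hx]
    · simp [Instr.run, m₁, m₂]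
  | sqrt a ih =>
    obtain ⟨s₁, h₁, e₁, k₁, i₁, f₁, m₁⟩ := ih he r q hr hq s hs
    refine ⟨_, h₁.seq (Runs.instr _ _), ?_, ?_, ?_, ?_, ?_⟩
    · simp [Instr.run, RE.eval, e₁]
    · intro x hx
      simp [Instr.run, k₁ x hx]
    · simp [Instr.run, i₁]
    · intro x hx
      simp [Instr.run, hx.ne, f₁ x hx]
    · simp [Instr.run, m₁]
  | ld a =>
    obtain ⟨s₁, h₁, e₁, k₁, i₁, f₁, m₁⟩ := NE.comp_spec a he r hr s hs
    refine ⟨_, h₁.seq (Runs.instr _ _), ?_, ?_, ?_, ?_, ?_⟩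
    · simp [Instr.run, RE.eval, e₁, m₁]
    · intro x hx
      simp [Instr.run, k₁ x hx]
    · simp [Instr.run, i₁]
    · intro x hx
      simp [Instr.run, hx.ne, f₁]
    · simp [Instr.run, m₁]
  | sum v b e ih =>
    simp only [RE.ok, Bool.and_eq_true] at he
    have hvb : v < 24 ∧ b < 24 := by
      have := he.1
      simp [sm] at this; omega
    obtain ⟨hv, hb⟩ := hvb
    have hb' : s.ireg b ≤ if sm b then S else N := by
      have := he.1
      split_ifs with h
      · exact hs.1 b h
      · simp [h] at this
        rw [this.2]; exact hs.2
    have h₂ := Runs.block (.iconst r 0) [.iadd r v r, .iconst (r + 1) 0, .iadd (r + 1) b (r + 1),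
        .iconst (r + 2) 0, .fconst q 0] s
    set s₂ := List.foldl (fun s i => Instr.run i s) s
      (.iconst r 0 :: [.iadd r v r, .iconst (r + 1) 0, .iadd (r + 1) b (r + 1),
        .iconst (r + 2) 0, .fconst q 0]) with hs₂
    obtain ⟨s₃, h₃, l1, l2, l3, l4, l5, l6, l7, l8⟩ := Runs.loop (a := r + 2) (b := r + 1)
      (p := .seq (block (.iconst v 0) [.iadd v (r + 2) v])
          (.seq (e.comp (r + 4) (q + 1))
            (block (.fadd q q (q + 1)) [.iconst (r + 3) 1, .iadd (r + 2) (r + 2) (r + 3)])))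
      (t := e.bd N S + 5) (B := s.ireg b) (s := s₂)
      (fun i s' => s'.freg q = ∑ j ∈ Finset.range i, e.eval (s.setI v j) ∧ s'.ireg (r + 2) = i ∧
        s'.ireg (r + 1) = s.ireg b ∧ s'.ireg r = s.ireg v ∧
        (∀ x < r, x ≠ v → s'.ireg x = s.ireg x) ∧
        s'.imem = s.imem ∧ (∀ x < q, s'.freg x = s.freg x) ∧ s'.fmem = s.fmem)
      (fun i s' h => ⟨h.2.1, h.2.2.1⟩)
      (fun i hi s' h => by
        obtain ⟨l1, l2, l3, l4, l5, l6, l7, l8⟩ := h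
        have g₁ := Runs.block (.iconst v 0) [.iadd v (r + 2) v] s'
        set u₁ := List.foldl (fun s i => Instr.run i s) s'
          (.iconst v 0 :: [.iadd v (r + 2) v]) with hu₁
        have a1 : ∀ x, x ≠ v → u₁.ireg x = s'.ireg x := fun x hx => by
          simp [hu₁, Instr.run, Function.update_apply, hx]
        have a2 : u₁.ireg v = i := by
          simp [hu₁, Instr.run, l2, show r + 2 ≠ v by omega]
        have a3 : ∀ x < r, u₁.ireg x = (s.setI v i).ireg x := by
          intro x hx
          by_cases hxv : x = v
          · subst hxv; simp [a2]
          · rw [a1 x hxv, l5 x hx hxv]; simp [hxv]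
        -- Writing the index into `v` keeps the bounds: either the range is small as well and `i <
        -- S`, or `v` is register 4, which is subject to no bound.
        have hS : Small N S (s.setI v i) := by
          have := he.1
          refine ⟨fun x hx => ?_, ?_⟩
          · by_cases hxv : x = v
            · subst hxv
              have hsb : sm b = true := by
                by_contra hsb
                simp [hsb] at this
                rw [this.1] at hx
                simp [sm] at hx
              simp [hsb] at hb'
              simp; omega
            · simp [hxv]; exact hs.1 x hx
          · have : 2 ≠ v := by
              rintro rfl
              simp [sm] at this
            simp [this]; exact hs.2
        obtain ⟨u₂, g₂, e₂, k₂, i₂, f₂, m₂⟩ := ih he.2 (r + 4) (q + 1) (by omega) (by omega) u₁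
          (hS.congr fun x hx => a3 x (by omega))
        have e₃ : e.eval u₁ = e.eval (s.setI v i) :=
          RE.eval_congr (fun x hx => a3 x (by omega)) (by simp [hu₁, Instr.run, l6])
            (fun x hx => by simp [hu₁, Instr.run, l7 x (by omega)])
            (by simp [hu₁, Instr.run, l8]) e he.2
        refine ⟨_, (g₁.seq (g₂.seq (Runs.block _ _ _))).mono (by simp; omega), ?_, ?_, ?_, ?_, ?_,
          ?_, ?_, ?_⟩
        · simp [Instr.run, Finset.sum_range_succ, e₂, e₃, f₂ q (by omega), ← l1]
          simp [hu₁, Instr.run]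
        · simp [Instr.run, k₂ (r + 2) (by omega),
            a1 (r + 2) (by omega), l2]
        · simp [Instr.run, k₂ (r + 1) (by omega),
            a1 (r + 1) (by omega), l3]
        · simp [Instr.run, k₂ r (by omega),
            a1 r (by omega), l4]
        · intro x hx hxv
          simp [Instr.run, k₂ x (by omega), a1 x hxv, l5 x hx hxv,
            show x ≠ r + 2 by omega, show x ≠ r + 3 by omega]
        · simp [Instr.run, i₂, hu₁, l6]
        · intro x hx
          simp [Instr.run, hx.ne, f₂ x (by omega)]
          simp [hu₁, Instr.run, l7 x hx]
        · simp [Instr.run, m₂, hu₁, l8])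
      (by
        refine ⟨?_, ?_, ?_, ?_, ?_, ?_, ?_, ?_⟩
        · simp [hs₂, Instr.run]
        · simp [hs₂, Instr.run, Function.update_apply]
        · simp [hs₂, Instr.run, Function.update_apply, show b ≠ r by omega, show b ≠ r + 1 by omega]
        · simp [hs₂, Instr.run, Function.update_apply, show v ≠ r by omega]
        · intro x hx hxv
          simp [hs₂, Instr.run, Function.update_apply, hx.ne, show x ≠ r + 1 by omega,
            show x ≠ r + 2 by omega]
        · simp [hs₂, Instr.run]
        · intro x hx
          simp [hs₂, Instr.run, hx.ne]
        · simp [hs₂, Instr.run])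
    refine ⟨_, (h₂.seq (h₃.seq (Runs.block _ _ _))).mono ?_, ?_, ?_, ?_, ?_, ?_⟩
    · have := Nat.mul_le_mul_right (e.bd N S + 6) hb'
      simp only [RE.bd, List.length, Nat.add_assoc, Nat.reduceAdd] at this ⊢
      omega
    · simp [Instr.run, RE.eval, l1]
    · intro x hx
      by_cases hxv : x = v
      · subst hxv
        simp [Instr.run, l4, show r ≠ x by omega]
      · simp [Instr.run, Function.update_apply, hxv, l5 x hx hxv]
    · simp [Instr.run, l6]
    · intro x hx
      simp [Instr.run, l7 x hx]
    · simp [Instr.run, l8]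

/-! ## Commands -/

/-- A command: its code, given the first free scratch register, and a bound on its running time
when small registers are at most `S` and ranges of big loops are at most `N`. -/
structure Cmd where
  comp : ℕ → Prog
  bd : ℕ → ℕ → ℕ

namespace Cmd

/-- Sequential composition. -/
def seq (c₁ c₂ : Cmd) : Cmd where
  comp r := .seq (c₁.comp r) (c₂.comp r)
  bd N S := c₁.bd N S + c₂.bd N S

/-- Assignment to a natural-number variable. -/
def iset (v : ℕ) (e : NE) : Cmd where
  comp r := .seq (e.comp r) (block (.iconst v 0) [.iadd v r v])
  bd _ S := e.bd S + 2

/-- Assignment to a real variable. -/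
def fset (v : ℕ) (e : RE) : Cmd where
  comp r := .seq (e.comp r 8) (block (.fconst v 0) [.fadd v 8 v])
  bd N S := e.bd N S + 2

/-- Assignment to a cell of the natural-number memory. -/
def iput (a e : NE) : Cmd where
  comp r := .seq (a.comp r) (.seq (e.comp (r + 1)) (.instr (.istore r (r + 1))))
  bd _ S := a.bd S + e.bd S + 1

/-- Assignment to a cell of the real memory. -/
def fput (a : NE) (e : RE) : Cmd where
  comp r := .seq (a.comp r) (.seq (e.comp (r + 1) 8) (.instr (.fstore r 8)))
  bd N S := a.bd S + e.bd N S + 1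

/-- Conditional execution. -/
def ifF (e₁ e₂ : RE) (c : Cmd) : Cmd where
  comp r := .seq (e₁.comp r 8) (.seq (e₂.comp r 9) (.iteF 8 9 (c.comp r) (.instr (.iconst r 0))))
  bd N S := e₁.bd N S + e₂.bd N S + c.bd N S + 2

/-- The loop in which `v` runs from `0` to `b - 1`; a big loop may have `N` passes, another
loop `S` passes. -/
def forC (big : Bool) (v : ℕ) (b : NE) (c : Cmd) : Cmd where
  comp r := .seq (b.comp r) (.seq (.instr (.iconst (r + 1) 0))
    (.loop (r + 1) r (.seq (block (.iconst v 0) [.iadd v (r + 1) v])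
      (.seq (c.comp (r + 3)) (block (.iconst (r + 2) 1) [.iadd (r + 1) (r + 1) (r + 2)])))))
  bd N S := b.bd S + 2 + (if big then N else S) * (c.bd N S + 5)

end Cmd

/-! ### Program logic: states modulo scratch registers, and weakest preconditions -/

/-- The state without its scratch registers. -/
def RamState.abs (s : RamState) : RamState :=
  { s with ireg := fun x => if x < 24 then s.ireg x else 0
           freg := fun x => if x < 8 then s.freg x else 0 }

theorem abs_ireg (s : RamState) {v : ℕ} (hv : v < 24) : s.abs.ireg v = s.ireg v := by
  simp [RamState.abs, hv]

theorem abs_freg (s : RamState) {v : ℕ} (hv : v < 8) : s.abs.freg v = s.freg v := by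
  simp [RamState.abs, hv]

theorem abs_fmem (s : RamState) : s.abs.fmem = s.fmem := rfl

theorem RamState.ext' {s s' : RamState} (h₁ : ∀ v, s.ireg v = s'.ireg v)
    (h₂ : s.imem = s'.imem) (h₃ : ∀ v, s.freg v = s'.freg v) (h₄ : s.fmem = s'.fmem) :
    s = s' := by
  cases s; cases s'
  simp only [RamState.mk.injEq]
  exact ⟨funext h₁, h₂, funext h₃, h₄⟩

theorem abs_eq {s s' : RamState} (hi : ∀ v < 24, s'.ireg v = s.ireg v)
    (hm : s'.imem = s.imem) (hf : ∀ v < 8, s'.freg v = s.freg v) (hM : s'.fmem = s.fmem) :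
    s'.abs = s.abs := by
  refine RamState.ext' (fun v => ?_) hm (fun v => ?_) hM
  · by_cases h : v < 24 <;> simp [RamState.abs, h, hi]
  · by_cases h : v < 8 <;> simp [RamState.abs, h, hf]

theorem abs_setI (s : RamState) {v : ℕ} (hv : v < 24) (x : ℕ) :
    (s.setI v x).abs = s.abs.setI v x := by
  refine RamState.ext' (fun u => ?_) rfl (fun u => rfl) rfl
  by_cases h : u = v
  · subst h; simp [RamState.abs, hv]
  · simp [RamState.abs, h]

theorem abs_setF (s : RamState) {v : ℕ} (hv : v < 8) (x : ℝ) :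
    (s.setF v x).abs = s.abs.setF v x := by
  refine RamState.ext' (fun u => rfl) rfl (fun u => ?_) rfl
  by_cases h : u = v
  · subst h; simp [RamState.abs, hv]
  · simp [RamState.abs, h]

theorem NE.eval_abs {e : NE} (he : e.ok = true) (s : RamState) : e.eval s.abs = e.eval s :=
  NE.eval_congr (fun _ hv => abs_ireg s hv) rfl e he

theorem RE.eval_abs {e : RE} (he : e.ok = true) (s : RamState) : e.eval s.abs = e.eval s :=
  RE.eval_congr (fun _ hv => abs_ireg s hv) rfl (fun _ hv => abs_freg s hv) rfl e he

theorem small_abs {N S : ℕ} {s : RamState} : Small N S s.abs ↔ Small N S s :=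
  ⟨fun h => h.congr fun _ hv => (abs_ireg s hv).symm, fun h => h.congr fun _ hv => abs_ireg s hv⟩

/-- From the abstract state `σ`, the command `c` runs within its time bound, preserves smallness
and leads to a state with property `Q`. -/
def Wp (N S : ℕ) (c : Cmd) (σ : RamState) (Q : RamState → Prop) : Prop :=
  Small N S σ → ∀ r, 24 ≤ r → ∀ s : RamState, s.abs = σ →
    ∃ s', Runs (c.comp r) s (c.bd N S) s' ∧ Small N S s'.abs ∧ Q s'.abs ∧
      ∀ x, 24 ≤ x → x < r → s'.ireg x = s.ireg x

section Rules
variable {N S : ℕ} {σ : RamState} {Q : RamState → Prop}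

theorem Wp.mono {c : Cmd} {Q' : RamState → Prop} (h : Wp N S c σ Q')
    (hQ : ∀ σ', Small N S σ' → Q' σ' → Q σ') : Wp N S c σ Q := by
  intro hs r hr s h'
  obtain ⟨s', h₁, h₂, h₃, h₄⟩ := h hs r hr s h'
  exact ⟨s', h₁, h₂, hQ _ h₂ h₃, h₄⟩

theorem Wp.seq {c₁ c₂ : Cmd} (h : Wp N S c₁ σ fun σ' => Wp N S c₂ σ' Q) :
    Wp N S (c₁.seq c₂) σ Q := by
  intro hs r hr s h'
  obtain ⟨s', h₁, h₂, h₃, h₄⟩ := h hs r hr s h'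
  obtain ⟨s'', g₁, g₂, g₃, g₄⟩ := h₃ h₂ r hr s' rfl
  exact ⟨s'', h₁.seq g₁, g₂, g₃, fun x hx hx' => by rw [g₄ x hx hx', h₄ x hx hx']⟩

/-- The two side conditions are exactly what keeps `Small` true; the time bounds of later products
and sums depend on it. -/
theorem Wp.iset {v : ℕ} {e : NE} (hv : v < 24) (he : e.ok = true)
    (hS : Small N S σ → sm v = true → e.eval σ ≤ S) (hN : v = 2 → e.eval σ ≤ N)
    (h : Q (σ.setI v (e.eval σ))) : Wp N S (.iset v e) σ Q := by
  intro hs r hr s h'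
  subst h'
  obtain ⟨s₁, h₁, e₁, k₁, i₁, f₁, m₁⟩ := NE.comp_spec e he r hr s (small_abs.1 hs)
  have key : (List.foldl (fun s i => Instr.run i s) s₁ (.iconst v 0 :: [.iadd v r v])).abs =
      s.abs.setI v (e.eval s.abs) := by
    rw [← abs_setI s hv]
    refine abs_eq (fun u hu => ?_) (by simp [Instr.run, i₁]) (fun u _ => by simp [Instr.run, f₁])
      (by simp [Instr.run, m₁])
    by_cases huv : u = v
    · subst huv
      simp [Instr.run, e₁, NE.eval_abs he, show r ≠ u by omega]
    · simp [Instr.run, Function.update_apply, huv, k₁ u (by omega)]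
  refine ⟨_, h₁.seq (Runs.block _ _ _), ?_, ?_, ?_⟩
  · rw [key]
    refine ⟨fun u hu => ?_, ?_⟩
    · by_cases huv : u = v
      · subst huv; simpa using hS hs hu
      · simpa [huv] using hs.1 u hu
    · by_cases huv : 2 = v
      · subst huv; simpa using hN rfl
      · simpa [huv] using hs.2
  · rw [key]; exact h
  · intro x hx hxr
    simp [Instr.run, Function.update_apply, show x ≠ v by omega, k₁ x hxr]

theorem Wp.fset {v : ℕ} {e : RE} (hv : v < 8) (he : e.ok = true)
    (h : Q (σ.setF v (e.eval σ))) : Wp N S (.fset v e) σ Q := by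
  intro hs r hr s h'
  subst h'
  obtain ⟨s₁, h₁, e₁, k₁, i₁, f₁, m₁⟩ := RE.comp_spec e he r 8 hr le_rfl s (small_abs.1 hs)
  have key : (List.foldl (fun s i => Instr.run i s) s₁ (.fconst v 0 :: [.fadd v 8 v])).abs =
      s.abs.setF v (e.eval s.abs) := by
    rw [← abs_setF s hv]
    refine abs_eq (fun u hu => by simp [Instr.run, k₁ u (by omega)]) (by simp [Instr.run, i₁])
      (fun u hu => ?_) (by simp [Instr.run, m₁])
    by_cases huv : u = v
    · subst huv
      simp [Instr.run, e₁, RE.eval_abs he, show 8 ≠ u by omega]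
    · simp [Instr.run, Function.update_apply, huv, f₁ u hu]
  refine ⟨_, h₁.seq (Runs.block _ _ _), ?_, ?_, ?_⟩
  · rw [key]; exact hs
  · rw [key]; exact h
  · intro x hx hxr
    simp [Instr.run, k₁ x hxr]

theorem Wp.iput {a e : NE} (ha : a.ok = true) (he : e.ok = true)
    (h : Q (σ.setIM (a.eval σ) (e.eval σ))) : Wp N S (.iput a e) σ Q := by
  intro hs r hr s h'
  subst h'
  obtain ⟨s₁, h₁, e₁, k₁, i₁, f₁, m₁⟩ := NE.comp_spec a ha r hr s (small_abs.1 hs)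
  obtain ⟨s₂, h₂, e₂, k₂, i₂, f₂, m₂⟩ := NE.comp_spec (N := N) (S := S) e he (r + 1) (by omega) s₁
    ((small_abs.1 hs).congr fun v hv => k₁ v (by omega))
  have e₃ : e.eval s₁ = e.eval s := NE.eval_congr (fun x hx => k₁ x (by omega)) i₁ e he
  have key : ((Instr.istore r (r + 1)).run s₂).abs =
      s.abs.setIM (a.eval s.abs) (e.eval s.abs) := by
    rw [NE.eval_abs ha, NE.eval_abs he]
    change _ = (s.setIM (a.eval s) (e.eval s)).abs
    refine abs_eq (fun u hu => by simp [Instr.run, k₂ u (by omega), k₁ u (by omega)]) ?_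
      (fun u hu => by simp [Instr.run, f₂, f₁]) (by simp [Instr.run, m₁, m₂])
    simp [Instr.run, RamState.setIM, i₁, i₂, e₂, k₂ r (by omega), e₁, e₃]
  refine ⟨_, (h₁.seq (h₂.seq (Runs.instr _ _))).mono (by simp [Cmd.iput]; omega), ?_, ?_, ?_⟩
  · rw [key]; exact hs
  · rw [key]; exact h
  · intro x hx hxr
    simp [Instr.run, k₂ x (by omega), k₁ x hxr]

theorem Wp.fput {a : NE} {e : RE} (ha : a.ok = true) (he : e.ok = true)
    (h : Q (σ.setFM (a.eval σ) (e.eval σ))) : Wp N S (.fput a e) σ Q := by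
  intro hs r hr s h'
  subst h'
  obtain ⟨s₁, h₁, e₁, k₁, i₁, f₁, m₁⟩ := NE.comp_spec a ha r hr s (small_abs.1 hs)
  obtain ⟨s₂, h₂, e₂, k₂, i₂, f₂, m₂⟩ := RE.comp_spec e he (r + 1) 8 (by omega) le_rfl s₁
    ((small_abs.1 hs).congr fun v hv => k₁ v (by omega))
  have e₃ : e.eval s₁ = e.eval s := RE.eval_congr (fun x hx => k₁ x (by omega)) i₁
    (fun x hx => by rw [f₁]) m₁ e he
  have key : ((Instr.fstore r 8).run s₂).abs =
      s.abs.setFM (a.eval s.abs) (e.eval s.abs) := by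
    rw [NE.eval_abs ha, RE.eval_abs he]
    change _ = (s.setFM (a.eval s) (e.eval s)).abs
    refine abs_eq (fun u hu => by simp [Instr.run, k₂ u (by omega), k₁ u (by omega)])
      (by simp [Instr.run, i₁, i₂]) (fun u hu => by simp [Instr.run, f₂ u hu, f₁]) ?_
    simp [Instr.run, RamState.setFM, m₁, m₂, e₂, k₂ r (by omega), e₁, e₃]
  refine ⟨_, (h₁.seq (h₂.seq (Runs.instr _ _))).mono (by simp [Cmd.fput]; omega), ?_, ?_, ?_⟩
  · rw [key]; exact hs
  · rw [key]; exact h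
  · intro x hx hxr
    simp [Instr.run, k₂ x (by omega), k₁ x hxr]

theorem Wp.ifF {e₁ e₂ : RE} {c : Cmd} (he₁ : e₁.ok = true) (he₂ : e₂.ok = true)
    (h : e₁.eval σ < e₂.eval σ → Wp N S c σ Q) (h' : e₂.eval σ ≤ e₁.eval σ → Q σ) :
    Wp N S (.ifF e₁ e₂ c) σ Q := by
  intro hs r hr s hσ
  subst hσ
  obtain ⟨s₁, h₁, a₁, k₁, i₁, f₁, m₁⟩ := RE.comp_spec e₁ he₁ r 8 hr le_rfl s (small_abs.1 hs)
  obtain ⟨s₂, h₂, a₂, k₂, i₂, f₂, m₂⟩ := RE.comp_spec e₂ he₂ r 9 hr (by omega) s₁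
    ((small_abs.1 hs).congr fun v hv => k₁ v (by omega))
  have b₁ : s₂.freg 8 = e₁.eval s.abs := by rw [f₂ 8 (by omega), a₁, RE.eval_abs he₁]
  have b₂ : s₂.freg 9 = e₂.eval s.abs := by
    rw [a₂, RE.eval_abs he₂]
    exact RE.eval_congr (fun x hx => k₁ x (by omega)) i₁ (fun x hx => f₁ x hx) m₁ e₂ he₂
  have key : s₂.abs = s.abs :=
    abs_eq (fun u hu => by rw [k₂ u (by omega), k₁ u (by omega)]) (by rw [i₂, i₁])
      (fun u hu => by rw [f₂ u (by omega), f₁ u hu]) (by rw [m₂, m₁])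
  by_cases hc : e₁.eval s.abs < e₂.eval s.abs
  · obtain ⟨s₃, ⟨t, ht, h₃⟩, q₁, q₂, q₃⟩ := h hc hs r hr s₂ key
    refine ⟨s₃, (h₁.seq (h₂.seq ⟨t + 1, le_rfl, .iteF_true (by rwa [b₁, b₂]) h₃⟩)).mono
      (by simp [Cmd.ifF]; omega), q₁, q₂, ?_⟩
    intro x hx hxr
    rw [q₃ x hx hxr, k₂ x hxr, k₁ x hxr]
  · have key' : ((Instr.iconst r 0).run s₂).abs = s.abs := by
      rw [← key]
      refine abs_eq (fun u hu => ?_) rfl (fun _ _ => rfl) rfl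
      simp [Instr.run, show u ≠ r by omega]
    refine ⟨_, (h₁.seq (h₂.seq ⟨2, le_rfl, .iteF_false (by rwa [b₁, b₂])
      (.instr (.iconst r 0) s₂)⟩)).mono (by simp [Cmd.ifF]; omega), ?_, ?_, ?_⟩
    · rw [key']; exact hs
    · rw [key']; exact h' (not_lt.1 hc)
    · intro x hx hxr
      simp [Instr.run, hxr.ne, k₂ x hxr, k₁ x hxr]

/-- The bound is evaluated once, and bound and counter live in scratch registers that the body,
compiled at `r + 3`, must preserve by the last clause of `Wp`. So the body may overwrite `v` and the
variables that occur in `b`; the invariant need not mention them. -/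
theorem Wp.forC {big : Bool} {v : ℕ} {b : NE} {c : Cmd} (I : ℕ → RamState → Prop)
    (hv : v < 24) (hv2 : v ≠ 2) (hb : b.ok = true) (hbig : big = true → sm v = false)
    (hB : Small N S σ → b.eval σ ≤ if big then N else S) (h0 : I 0 σ)
    (step : ∀ i < b.eval σ, ∀ σ', I i σ' → Wp N S c (σ'.setI v i) (I (i + 1)))
    (post : ∀ σ', Small N S σ' → I (b.eval σ) σ' → Q σ') : Wp N S (.forC big v b c) σ Q := by
  intro hs r hr s hσ
  subst hσ
  obtain ⟨s₁, h₁, e₁, k₁, i₁, f₁, m₁⟩ := NE.comp_spec b hb r hr s (small_abs.1 hs)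
  have h₂ := Runs.instr (.iconst (r + 1) 0) s₁
  have key : ((Instr.iconst (r + 1) 0).run s₁).abs = s.abs := by
    refine abs_eq (fun u hu => ?_) (by simp [Instr.run, i₁]) (fun _ _ => by simp [Instr.run, f₁])
      (by simp [Instr.run, m₁])
    simp [Instr.run, show u ≠ r + 1 by omega, k₁ u (by omega)]
  obtain ⟨s₃, h₃, l1, l2, l3, l4, l5⟩ := Runs.loop (a := r + 1) (b := r)
    (p := .seq (block (.iconst v 0) [.iadd v (r + 1) v])
      (.seq (c.comp (r + 3)) (block (.iconst (r + 2) 1) [.iadd (r + 1) (r + 1) (r + 2)])))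
    (t := c.bd N S + 4) (B := b.eval s.abs) (s := (Instr.iconst (r + 1) 0).run s₁)
    (fun i s' => s'.ireg (r + 1) = i ∧ s'.ireg r = b.eval s.abs ∧
      (∀ x, 24 ≤ x → x < r → s'.ireg x = s.ireg x) ∧ Small N S s'.abs ∧ I i s'.abs)
    (fun i s' h => ⟨h.1, h.2.1⟩)
    (fun i hi s' h => by
      obtain ⟨l1, l2, l3, l4, l5⟩ := h
      have g₁ := Runs.block (.iconst v 0) [.iadd v (r + 1) v] s'
      set u₁ := List.foldl (fun s i => Instr.run i s) s' (.iconst v 0 :: [.iadd v (r + 1) v])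
        with hu₁
      have a1 : ∀ x, x ≠ v → u₁.ireg x = s'.ireg x := fun x hx => by
        simp [hu₁, Instr.run, Function.update_apply, hx]
      have a2 : u₁.abs = s'.abs.setI v i := by
        rw [← abs_setI _ hv]
        refine abs_eq (fun u hu => ?_) rfl (fun _ _ => rfl) rfl
        by_cases huv : u = v
        · subst huv
          simp [hu₁, Instr.run, l1, show r + 1 ≠ u by omega]
        · simp [a1 u huv, huv]
      have hS : Small N S (s'.abs.setI v i) := by
        refine ⟨fun x hx => ?_, ?_⟩
        · by_cases hxv : x = v
          · subst hxv
            have := hB hs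
            have hbg : big = false := by
              by_contra hbg
              have := hbig (by simpa using hbg)
              simp [this] at hx
            simp [hbg] at this
            simp; omega
          · simpa [hxv] using l4.1 x hx
        · simpa [hv2.symm] using l4.2
      obtain ⟨u₂, g₂, q₁, q₂, q₃⟩ := step i hi _ l5 hS (r + 3) (by omega) u₁ a2
      have key₂ : (List.foldl (fun s i => Instr.run i s) u₂
          (.iconst (r + 2) 1 :: [.iadd (r + 1) (r + 1) (r + 2)])).abs = u₂.abs := by
        refine abs_eq (fun u hu => ?_) rfl (fun _ _ => rfl) rfl
        simp [Instr.run, show u ≠ r + 1 by omega, show u ≠ r + 2 by omega]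
      refine ⟨_, (g₁.seq (g₂.seq (Runs.block _ _ _))).mono (by simp; omega), ?_, ?_, ?_, ?_, ?_⟩
      · simp [Instr.run, q₃ (r + 1) (by omega) (by omega), a1 (r + 1) (by omega), l1]
      · simp [Instr.run, q₃ r (by omega) (by omega), a1 r (by omega), l2]
      · intro x hx hxr
        simp [Instr.run, show x ≠ r + 1 by omega, show x ≠ r + 2 by omega,
          q₃ x hx (by omega), a1 x (by omega), l3 x hx hxr]
      · rw [key₂]; exact q₁
      · rw [key₂]; exact q₂)
    (by
      refine ⟨by simp [Instr.run], by simp [Instr.run, e₁, NE.eval_abs hb], ?_, ?_, ?_⟩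
      · intro x hx hxr
        simp [Instr.run, show x ≠ r + 1 by omega, k₁ x hxr]
      · rw [key]; exact hs
      · rw [key]; exact h0)
  refine ⟨s₃, (h₁.seq (h₂.seq h₃)).mono ?_, l4, post _ l4 l5, l3⟩
  have := Nat.mul_le_mul_right (c.bd N S + 5) (hB hs)
  simp only [Cmd.forC, Nat.add_assoc, Nat.reduceAdd] at this ⊢
  omega

end Rules

/-! ## Polynomial time bounds -/

/-- The time bound of `c` is at most a constant times `N ^ k` times a power of `S`. -/
def PB (c : Cmd) (k : ℕ) : Prop :=
  ∃ κ h : ℕ, ∀ N S, 1 ≤ N → 1 ≤ S → c.bd N S ≤ κ * N ^ k * S ^ h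

theorem bound_add {κ κ' k h h' N S x y : ℕ} (hS : 1 ≤ S)
    (hx : x ≤ κ * N ^ k * S ^ h) (hy : y ≤ κ' * N ^ k * S ^ h') :
    x + y ≤ (κ + κ') * N ^ k * S ^ (h + h') := by
  have h₁ : S ^ h ≤ S ^ (h + h') := Nat.pow_le_pow_right hS (by omega)
  have h₂ : S ^ h' ≤ S ^ (h + h') := Nat.pow_le_pow_right hS (by omega)
  calc x + y ≤ κ * N ^ k * S ^ (h + h') + κ' * N ^ k * S ^ (h + h') :=
        add_le_add (hx.trans (Nat.mul_le_mul_left _ h₁)) (hy.trans (Nat.mul_le_mul_left _ h₂))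
    _ = _ := by ring

theorem bound_const {N S : ℕ} (hN : 1 ≤ N) (c k : ℕ) : c ≤ c * N ^ k * S ^ 0 := by
  have := Nat.one_le_pow k N hN
  simpa using Nat.le_mul_of_pos_right c this

theorem NE.bd_le (e : NE) (k : ℕ) :
    ∃ κ h : ℕ, ∀ N S, 1 ≤ N → 1 ≤ S → e.bd S ≤ κ * N ^ k * S ^ h := by
  induction e with
  | const c => exact ⟨1, 0, fun N S hN _ => bound_const hN _ _⟩
  | var v => exact ⟨2, 0, fun N S hN _ => bound_const hN _ _⟩
  | add a b iha ihb | sub a b iha ihb =>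
    obtain ⟨κ, h, H⟩ := iha
    obtain ⟨κ', h', H'⟩ := ihb
    exact ⟨_, _, fun N S hN hS => bound_add hS (bound_add hS (H N S hN hS) (H' N S hN hS))
      (bound_const hN 1 k)⟩
  | mul a v ih =>
    obtain ⟨κ, h, H⟩ := ih
    refine ⟨_, _, fun N S hN hS => bound_add hS (H N S hN hS) (bound_add (κ := 3) (h := 1) hS ?_
      (bound_const hN 6 k))⟩
    have := Nat.one_le_pow k N hN
    simpa using Nat.mul_le_mul_right S (Nat.le_mul_of_pos_right 3 this)
  | ld a ih =>
    obtain ⟨κ, h, H⟩ := ih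
    exact ⟨_, _, fun N S hN hS => bound_add hS (H N S hN hS) (bound_const hN 1 k)⟩

/-- The nesting depth of sums over big ranges. -/
def RE.nd : RE → ℕ
  | .const _ => 0
  | .var _ => 0
  | .ofNat _ => 0
  | .add a b => max a.nd b.nd
  | .sub a b => max a.nd b.nd
  | .mul a b => max a.nd b.nd
  | .div a b => max a.nd b.nd
  | .sqrt a => a.nd
  | .ld _ => 0
  | .sum _ b e => if sm b then e.nd else e.nd + 1

/-- A sum over a small range only raises the power of `S`; a sum over a big range uses up one power
of `N`, which is what `RE.nd` counts. -/
theorem RE.bd_le (e : RE) (k : ℕ) (hk : e.nd ≤ k) :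
    ∃ κ h : ℕ, ∀ N S, 1 ≤ N → 1 ≤ S → e.bd N S ≤ κ * N ^ k * S ^ h := by
  induction e generalizing k with
  | const c => exact ⟨1, 0, fun N S hN _ => bound_const hN _ _⟩
  | var v => exact ⟨2, 0, fun N S hN _ => bound_const hN _ _⟩
  | ofNat a | ld a =>
    obtain ⟨κ, h, H⟩ := NE.bd_le a k
    exact ⟨_, _, fun N S hN hS => bound_add hS (H N S hN hS) (bound_const hN 1 k)⟩
  | add a b iha ihb | sub a b iha ihb | mul a b iha ihb | div a b iha ihb =>
    simp only [RE.nd, max_le_iff] at hk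
    obtain ⟨κ, h, H⟩ := iha k hk.1
    obtain ⟨κ', h', H'⟩ := ihb k hk.2
    exact ⟨_, _, fun N S hN hS => bound_add hS (bound_add hS (H N S hN hS) (H' N S hN hS))
      (bound_const hN 1 k)⟩
  | sqrt a ih =>
    obtain ⟨κ, h, H⟩ := ih k hk
    exact ⟨_, _, fun N S hN hS => bound_add hS (H N S hN hS) (bound_const hN 1 k)⟩
  | sum v b e ih =>
    by_cases hb : sm b = true
    · simp only [RE.nd, hb, if_true] at hk
      obtain ⟨κ, h, H⟩ := ih k hk
      refine ⟨_, _, fun N S hN hS => bound_add hS (κ := κ + 6) (h := h + 0 + 1) ?_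
        (bound_const hN 9 k)⟩
      have := Nat.mul_le_mul_left S (bound_add hS (H N S hN hS) (bound_const hN 6 k))
      simp only [hb, if_true]
      exact this.trans (by rw [pow_succ]; apply le_of_eq; ring)
    · simp only [RE.nd, hb] at hk
      obtain ⟨k, rfl⟩ : ∃ k', k = k' + 1 := ⟨k - 1, by simp at hk; omega⟩
      obtain ⟨κ, h, H⟩ := ih k (by simpa using hk)
      refine ⟨_, _, fun N S hN hS => bound_add hS (κ := κ + 6) (h := h + 0) ?_
        (bound_const hN 9 _)⟩
      have := Nat.mul_le_mul_left N (bound_add hS (H N S hN hS) (bound_const hN 6 k))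
      simp only [hb]
      exact this.trans (by rw [pow_succ]; apply le_of_eq; ring)

theorem PB.seq {c₁ c₂ : Cmd} {k : ℕ} (h₁ : PB c₁ k) (h₂ : PB c₂ k) : PB (c₁.seq c₂) k := by
  obtain ⟨κ, h, H⟩ := h₁
  obtain ⟨κ', h', H'⟩ := h₂
  exact ⟨_, _, fun N S hN hS => bound_add hS (H N S hN hS) (H' N S hN hS)⟩

theorem PB.iset (v : ℕ) (e : NE) (k : ℕ) : PB (.iset v e) k := by
  obtain ⟨κ, h, H⟩ := NE.bd_le e k
  exact ⟨_, _, fun N S hN hS => bound_add hS (H N S hN hS) (bound_const hN 2 k)⟩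

theorem PB.fset (v : ℕ) (e : RE) {k : ℕ} (hk : e.nd ≤ k) : PB (.fset v e) k := by
  obtain ⟨κ, h, H⟩ := RE.bd_le e k hk
  exact ⟨_, _, fun N S hN hS => bound_add hS (H N S hN hS) (bound_const hN 2 k)⟩

theorem PB.iput (a e : NE) (k : ℕ) : PB (.iput a e) k := by
  obtain ⟨κ, h, H⟩ := NE.bd_le a k
  obtain ⟨κ', h', H'⟩ := NE.bd_le e k
  exact ⟨_, _, fun N S hN hS => bound_add hS (bound_add hS (H N S hN hS) (H' N S hN hS))
    (bound_const hN 1 k)⟩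

theorem PB.fput (a : NE) (e : RE) {k : ℕ} (hk : e.nd ≤ k) : PB (.fput a e) k := by
  obtain ⟨κ, h, H⟩ := NE.bd_le a k
  obtain ⟨κ', h', H'⟩ := RE.bd_le e k hk
  exact ⟨_, _, fun N S hN hS => bound_add hS (bound_add hS (H N S hN hS) (H' N S hN hS))
    (bound_const hN 1 k)⟩

theorem PB.ifF (e₁ e₂ : RE) {c : Cmd} {k : ℕ} (h₁ : e₁.nd ≤ k) (h₂ : e₂.nd ≤ k) (h₃ : PB c k) :
    PB (.ifF e₁ e₂ c) k := by
  obtain ⟨κ, h, H⟩ := RE.bd_le e₁ k h₁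
  obtain ⟨κ', h', H'⟩ := RE.bd_le e₂ k h₂
  obtain ⟨κ'', h'', H''⟩ := h₃
  exact ⟨_, _, fun N S hN hS => bound_add hS (bound_add hS (bound_add hS (H N S hN hS)
    (H' N S hN hS)) (H'' N S hN hS)) (bound_const hN 2 k)⟩

theorem PB.forS (v : ℕ) (b : NE) {c : Cmd} {k : ℕ} (hc : PB c k) : PB (.forC false v b c) k := by
  obtain ⟨κ, h, H⟩ := NE.bd_le b k
  obtain ⟨κ', h', H'⟩ := hc
  refine ⟨_, _, fun N S hN hS => bound_add hS (bound_add hS (H N S hN hS)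
    (bound_const hN 2 k)) (κ' := κ' + 5) (h' := h' + 0 + 1) ?_⟩
  have := Nat.mul_le_mul_left S (bound_add hS (H' N S hN hS) (bound_const hN 5 k))
  exact this.trans (by rw [pow_succ]; apply le_of_eq; ring)

/-- Among the command constructors, the only one that raises the exponent of `N`. -/
theorem PB.forN (v : ℕ) (b : NE) {c : Cmd} {k : ℕ} (hc : PB c k) :
    PB (.forC true v b c) (k + 1) := by
  obtain ⟨κ, h, H⟩ := NE.bd_le b (k + 1)
  obtain ⟨κ', h', H'⟩ := hc
  refine ⟨_, _, fun N S hN hS => bound_add hS (bound_add hS (H N S hN hS)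
    (bound_const hN 2 _)) (κ' := κ' + 5) (h' := h' + 0) ?_⟩
  have := Nat.mul_le_mul_left N (bound_add hS (H' N S hN hS) (bound_const hN 5 k))
  exact this.trans (by rw [pow_succ]; apply le_of_eq; ring)

/-! ## Arrays -/

/-- The entry `idx` of the array number `α < 16`; arrays are interleaved above the address in
register 3. -/
def RamState.arr (σ : RamState) (α idx : ℕ) : ℝ := σ.fmem (σ.ireg 3 + 16 * idx + α)

/-- The address of an array entry; register 7 contains `16`. -/
def adE (α : ℕ) (idx : NE) : NE := .add (.add (.var 3) (.mul idx 7)) (.const α)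

/-- With stride 16 the residue of the offset identifies the array, so all arrays can grow without a
length fixed in advance. The feature tables need this, as their size is known only at run time. -/
theorem adE_eval {σ : RamState} (h7 : σ.ireg 7 = 16) (α : ℕ) (idx : NE) :
    (adE α idx).eval σ = σ.ireg 3 + 16 * idx.eval σ + α := by
  simp [adE, NE.eval, h7, mul_comm]

theorem adE_ok (α : ℕ) (idx : NE) : (adE α idx).ok = idx.ok := by
  simp [adE, NE.ok, sm]

/-- The load of an array entry. -/
def ldA (α : ℕ) (idx : NE) : RE := .ld (adE α idx)

theorem ldA_eval {σ : RamState} (h7 : σ.ireg 7 = 16) (α : ℕ) (idx : NE) :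
    (ldA α idx).eval σ = σ.arr α (idx.eval σ) := by
  simp [ldA, RE.eval, adE_eval h7, RamState.arr]

@[simp] theorem ldA_nd (α : ℕ) (idx : NE) : (ldA α idx).nd = 0 := rfl

theorem setI_arr (σ : RamState) {v : ℕ} (hv : v ≠ 3) (x α idx : ℕ) :
    (σ.setI v x).arr α idx = σ.arr α idx := by
  simp [RamState.arr, hv.symm]

@[simp] theorem setIM_arr (σ : RamState) (v x α idx : ℕ) :
    (σ.setIM v x).arr α idx = σ.arr α idx := rfl

/-! ### Loops that fill a region of the real memory -/

/-- The states agree except on the registers in `I` and the real memory in `R`. -/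
structure Same (R : Set ℕ) (I : List ℕ) (σ σ' : RamState) : Prop where
  ireg : ∀ v, v ∉ I → σ'.ireg v = σ.ireg v
  freg : σ'.freg = σ.freg
  imem : σ'.imem = σ.imem
  fmem : ∀ x, x ∉ R → σ'.fmem x = σ.fmem x

/-- The cells of the array `α` over the base address `b`. -/
def cells (b α : ℕ) : Set ℕ := {x | b ≤ x ∧ (x - b) % 16 = α}

theorem Same.raw {α : ℕ} {I : List ℕ} {σ σ' : RamState} (h : Same (cells (σ.ireg 3) α) I σ σ')
    {x : ℕ} (hx : x < σ.ireg 3) : σ'.fmem x = σ.fmem x :=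
  h.fmem x fun hc => by have := hc.1; omega

section Store
variable {N S : ℕ} {σ : RamState}

/-- The values are given as a function `f` of the address, not of the index: then no injectivity of
`a` is needed, since two passes that hit the same cell write the same value. The last clause records
this and lets consecutive loops be combined. The evaluation hypothesis assumes agreement with `σ`
only outside `R`, so `e` must not depend on cells that are being overwritten. -/
theorem Wp.store {big : Bool} {v b : ℕ} {addr : NE} {e : RE} (R : Set ℕ) (a : ℕ → ℕ) (f : ℕ → ℝ)
    (hv : v < 24) (hb : b < 24) (hv2 : v ≠ 2) (hbig : big = true → sm v = false)
    (hB : Small N S σ → σ.ireg b ≤ if big then N else S)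
    (haddr : addr.ok = true) (he : e.ok = true)
    (H : ∀ i < σ.ireg b, ∀ σ', Same R [v] σ σ' → σ'.ireg v = i →
      addr.eval σ' = a i ∧ a i ∈ R ∧ e.eval σ' = f (a i)) :
    Wp N S (.forC big v (.var b) (.fput addr e)) σ fun σ' =>
      Same R [v] σ σ' ∧ (∀ i < σ.ireg b, σ'.fmem (a i) = f (a i)) ∧
        ∀ x, σ'.fmem x = σ.fmem x ∨ σ'.fmem x = f x := by
  refine Wp.forC (fun i σ' => Same R [v] σ σ' ∧ (∀ j < i, σ'.fmem (a j) = f (a j)) ∧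
      ∀ x, σ'.fmem x = σ.fmem x ∨ σ'.fmem x = f x) hv hv2 (by simpa [NE.ok] using hb) hbig hB
    ⟨⟨fun _ _ => rfl, rfl, rfl, fun _ _ => rfl⟩, by simp, fun _ => .inl rfl⟩ ?_
    (fun _ _ h => h)
  rintro i hi σ' ⟨h₁, h₂, h₃⟩
  have h₁' : Same R [v] σ (σ'.setI v i) := by
    refine ⟨fun u hu => ?_, h₁.freg, h₁.imem, h₁.fmem⟩
    have := h₁.ireg u hu
    simp at hu
    simp [hu, this]
  obtain ⟨q₁, q₂, q₃⟩ := H i hi _ h₁' (by simp)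
  refine Wp.fput haddr he ⟨⟨h₁'.ireg, h₁.freg, h₁.imem, fun x hx => ?_⟩, fun j hj => ?_,
    fun x => ?_⟩
  · have : x ≠ a i := fun h => hx (h ▸ q₂)
    simp [q₁, this, h₁.fmem x hx]
  · by_cases hji : a j = a i
    · simp [q₁, q₃, hji]
    · have : j ≠ i := fun h => hji (h ▸ rfl)
      simp [q₁, hji, h₂ j (by omega)]
  · by_cases hx : x = a i
    · simp [q₁, q₃, hx]
    · simpa [q₁, hx] using h₃ x

theorem Wp.store₂ {big : Bool} {vi bi vj bj : ℕ} {addr : NE} {e : RE} (R : Set ℕ)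
    (a : ℕ → ℕ → ℕ) (f : ℕ → ℝ)
    (hvi : vi < 24) (hbi : bi < 24) (hvi2 : vi ≠ 2) (hbig : big = true → sm vi = false)
    (hBi : Small N S σ → σ.ireg bi ≤ if big then N else S)
    (hvj : vj < 24) (hbj : sm bj = true) (hvj2 : vj ≠ 2) (hij : vi ≠ vj) (hij' : bj ≠ vi)
    (hjj : bj ≠ vj)
    (haddr : addr.ok = true) (he : e.ok = true)
    (H : ∀ i < σ.ireg bi, ∀ j < σ.ireg bj, ∀ σ', Same R [vi, vj] σ σ' → σ'.ireg vi = i →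
      σ'.ireg vj = j → addr.eval σ' = a i j ∧ a i j ∈ R ∧ e.eval σ' = f (a i j)) :
    Wp N S (.forC big vi (.var bi) (.forC false vj (.var bj) (.fput addr e))) σ fun σ' =>
      Same R [vi, vj] σ σ' ∧ (∀ i < σ.ireg bi, ∀ j < σ.ireg bj, σ'.fmem (a i j) = f (a i j)) ∧
        ∀ x, σ'.fmem x = σ.fmem x ∨ σ'.fmem x = f x := by
  refine Wp.forC (fun i σ' => Same R [vi, vj] σ σ' ∧
      (∀ i' < i, ∀ j < σ.ireg bj, σ'.fmem (a i' j) = f (a i' j)) ∧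
      ∀ x, σ'.fmem x = σ.fmem x ∨ σ'.fmem x = f x) hvi hvi2 (by simpa [NE.ok] using hbi) hbig hBi
    ⟨⟨fun _ _ => rfl, rfl, rfl, fun _ _ => rfl⟩, by simp, fun _ => .inl rfl⟩ ?_
    (fun _ _ h => h)
  rintro i hi σ' ⟨h₁, h₂, h₃⟩
  have hb : (σ'.setI vi i).ireg bj = σ.ireg bj := by
    simp [hij', h₁.ireg bj (by simp [hij', hjj])]
  refine (Wp.store R (a i) f hvj (sm_lt hbj) hvj2 (by simp) (fun hs => by simpa using hs.1 bj hbj)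
    haddr he ?_).mono ?_
  · intro j hj σ'' hs hj'
    have hs' : Same R [vi, vj] σ σ'' := by
      refine ⟨fun u hu => ?_, hs.freg.trans h₁.freg, hs.imem.trans h₁.imem,
        fun x hx => (hs.fmem x hx).trans (h₁.fmem x hx)⟩
      rw [← h₁.ireg u hu, hs.ireg u (by simp at hu ⊢; exact hu.2)]
      simp at hu
      simp [hu.1]
    refine H i hi j (by rwa [hb] at hj) σ'' hs' ?_ hj'
    rw [hs.ireg vi (by simpa using hij)]
    simp
  · rintro σ'' _ ⟨g₁, g₂, g₃⟩
    have g₄ : ∀ x, σ''.fmem x = σ'.fmem x ∨ σ''.fmem x = f x := g₃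
    refine ⟨⟨fun u hu => ?_, g₁.freg.trans h₁.freg, g₁.imem.trans h₁.imem,
        fun x hx => (g₁.fmem x hx).trans (h₁.fmem x hx)⟩, fun i' hi' j hj => ?_, fun x => ?_⟩
    · rw [← h₁.ireg u hu, g₁.ireg u (by simp at hu ⊢; exact hu.2)]
      simp at hu
      simp [hu.1]
    -- The current pass may revisit a cell of an earlier row, but it can only write `f` of that
    -- address again.
    · rcases g₄ (a i' j) with h | h
      · by_cases hi'' : i' = i
        · subst hi''; exact g₂ j (by rwa [hb])
        · rw [h, h₂ i' (by omega) j hj]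
      · exact h
    · rcases g₄ x with h | h
      · rw [h]; exact h₃ x
      · exact .inr h

/-- The command that fills the array `α` with the values of `e`, row by row; the row index `vi`
runs up to register `bi` and the column index `vj` up to register `bj`. -/
def fill₂ (big : Bool) (vi bi vj bj α : ℕ) (e : RE) : Cmd :=
  .forC big vi (.var bi) (.forC false vj (.var bj)
    (.fput (adE α (.add (.mul (.var vi) bj) (.var vj))) e))

theorem Wp.fill₂ {big : Bool} {vi bi vj bj α : ℕ} {e : RE} (val : ℕ → ℕ → ℝ) (hα : α < 16)
    (h7 : σ.ireg 7 = 16)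
    (hvi : vi < 24) (hbi : bi < 24) (hvi2 : vi ≠ 2) (hbig : big = true → sm vi = false)
    (hBi : Small N S σ → σ.ireg bi ≤ if big then N else S)
    (hvj : vj < 24) (hbj : sm bj = true) (hvj2 : vj ≠ 2) (hij : vi ≠ vj) (hij' : bj ≠ vi)
    (hjj : bj ≠ vj) (hI : vi ≠ 3 ∧ vj ≠ 3 ∧ vi ≠ 7 ∧ vj ≠ 7) (he : e.ok = true)
    (H : ∀ i < σ.ireg bi, ∀ j < σ.ireg bj, ∀ σ', Same (cells (σ.ireg 3) α) [vi, vj] σ σ' →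
      σ'.ireg vi = i → σ'.ireg vj = j → e.eval σ' = val i j) :
    Wp N S (fill₂ big vi bi vj bj α e) σ fun σ' =>
      Same (cells (σ.ireg 3) α) [vi, vj] σ σ' ∧
      ∀ i < σ.ireg bi, ∀ j < σ.ireg bj, σ'.arr α (i * σ.ireg bj + j) = val i j := by
  -- Row and column are recovered from the address by division with remainder, so the prescribed
  -- values are a function of the address.
  obtain ⟨f, key⟩ : ∃ f : ℕ → ℝ, ∀ i j, j < σ.ireg bj →
      val i j = f (σ.ireg 3 + 16 * (i * σ.ireg bj + j) + α) := by
    refine ⟨fun x => val ((x - σ.ireg 3) / 16 / σ.ireg bj) ((x - σ.ireg 3) / 16 % σ.ireg bj),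
      fun i j hj => ?_⟩
    have h₁ : (σ.ireg 3 + 16 * (i * σ.ireg bj + j) + α - σ.ireg 3) / 16 = j + i * σ.ireg bj := by
      omega
    simp only [h₁]
    rw [Nat.add_mul_mod_self_right, Nat.mod_eq_of_lt hj, Nat.add_mul_div_right _ _ (by omega),
      Nat.div_eq_of_lt hj, zero_add]
  unfold SecondOrderMeanFlow.fill₂
  refine (Wp.store₂ (cells (σ.ireg 3) α)
    (fun i j => σ.ireg 3 + 16 * (i * σ.ireg bj + j) + α) f hvi hbi hvi2 hbig hBi hvj hbj hvj2 hij
    hij' hjj (by simp [adE_ok, NE.ok, hvi, hvj, hbj]) he ?_).mono ?_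
  · intro i hi j hj σ' hs hi' hj'
    have h7' : σ'.ireg 7 = 16 := by rw [hs.ireg 7 (by simp; omega), h7]
    have h3' : σ'.ireg 3 = σ.ireg 3 := hs.ireg 3 (by simp; omega)
    refine ⟨?_, ?_, (H i hi j hj σ' hs hi' hj').trans (key i j hj)⟩
    · rw [adE_eval h7']
      simp [NE.eval, h3', hi', hj', hs.ireg bj (by simp [hij', hjj])]
    · simp only [cells, Set.mem_ofPred_eq]; omega
  · rintro σ' _ ⟨h₁, h₂, _⟩
    refine ⟨h₁, fun i hi j hj => ?_⟩
    rw [RamState.arr, h₁.ireg 3 (by simp; omega), h₂ i hi j hj, ← key i j hj]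

/-- The command that fills a row of an array: the entry `row * N + i` for `i < N`, where `N` is in
register 2 and `row` in the register `vr`. -/
def fillRow (vr α : ℕ) (e : RE) : Cmd :=
  .forC true 4 (.var 2) (.fput (adE α (.add (.mul (.var 2) vr) (.var 4))) e)

/-- Only the cells of the row being written are off limits, not the whole array. So `e` may read
other rows of the same array, which is how the row of a node is computed from that of its
predecessor. -/
theorem Wp.fillRow {vr α : ℕ} {e : RE} (val : ℕ → ℝ) (hα : α < 16) (h7 : σ.ireg 7 = 16)
    (hvr : sm vr = true) (he : e.ok = true)
    (H : ∀ i < σ.ireg 2, ∀ σ',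
      Same {x | ∃ i < σ.ireg 2, x = σ.ireg 3 + 16 * (σ.ireg 2 * σ.ireg vr + i) + α} [4] σ σ' →
      σ'.ireg 4 = i → e.eval σ' = val i) :
    Wp N S (fillRow vr α e) σ fun σ' =>
      Same {x | ∃ i < σ.ireg 2, x = σ.ireg 3 + 16 * (σ.ireg 2 * σ.ireg vr + i) + α} [4] σ σ' ∧
      ∀ i < σ.ireg 2, σ'.arr α (σ.ireg 2 * σ.ireg vr + i) = val i := by
  have hr : vr ≠ 4 := by rintro rfl; simp [sm] at hvr
  set b := σ.ireg 2 * σ.ireg vr with hb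
  obtain ⟨f, key⟩ : ∃ f : ℕ → ℝ, ∀ i, val i = f (σ.ireg 3 + 16 * (b + i) + α) := by
    refine ⟨fun x => val ((x - σ.ireg 3) / 16 - b), fun i => ?_⟩
    dsimp only
    congr 1
    omega
  unfold SecondOrderMeanFlow.fillRow
  refine (Wp.store {x | ∃ i < σ.ireg 2, x = σ.ireg 3 + 16 * (b + i) + α}
    (fun i => σ.ireg 3 + 16 * (b + i) + α) f (by omega) (by omega) (by omega)
    (fun _ => rfl) (fun hs => hs.2) (by simp [adE_ok, NE.ok, hvr]) he ?_).mono ?_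
  · intro i hi σ' hs hi'
    refine ⟨?_, ⟨i, hi, rfl⟩, (H i hi σ' hs hi').trans (key i)⟩
    rw [adE_eval (by rw [hs.ireg 7 (by simp), h7])]
    simp [NE.eval, hi', hs.ireg 3 (by simp), hs.ireg 2 (by simp), hs.ireg vr (by simp [hr]), hb]
  · rintro σ' _ ⟨h₁, h₂, _⟩
    refine ⟨h₁, fun i hi => ?_⟩
    rw [RamState.arr, h₁.ireg 3 (by simp), h₂ i hi, ← key i]

end Store

/-! ## Truncated exponentials and their multinomial expansion -/

/-- The Taylor polynomial of degree `r` of the exponential function. -/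
noncomputable def expT (r : ℕ) (x : ℝ) : ℝ := ∑ p ∈ Finset.range (r + 1), x ^ p / p.factorial

theorem expT_zero (r : ℕ) : expT r 0 = 1 := by
  rw [expT, Finset.sum_range_succ']
  simp

/-- The binomial theorem, with the double sum over exponents regrouped along diagonals. Truncation
is by total degree: a factor `x ^ b` leaves degree `r - b` for `y`. Used once per coordinate, this
is the recursion by which the features are generated. -/
theorem expT_add (r : ℕ) (x y : ℝ) :
    expT r (x + y) = ∑ b ∈ Finset.range (r + 1), x ^ b / b.factorial * expT (r - b) y := by
  have h := Finset.sum_range_diag_flip (r + 1)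
    (fun b c => x ^ b / (b.factorial : ℝ) * (y ^ c / (c.factorial : ℝ)))
  simp only [expT]
  have h' : ∀ b ∈ Finset.range (r + 1), x ^ b / (b.factorial : ℝ) *
      ∑ c ∈ Finset.range (r - b + 1), y ^ c / (c.factorial : ℝ) =
      ∑ c ∈ Finset.range (r + 1 - b), x ^ b / (b.factorial : ℝ) * (y ^ c / (c.factorial : ℝ)) := by
    intro b hb
    rw [Finset.mem_range] at hb
    rw [Finset.mul_sum, show r + 1 - b = r - b + 1 by omega]
  rw [Finset.sum_congr rfl h', ← h]
  refine Finset.sum_congr rfl fun p _ => ?_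
  rw [add_pow, Finset.sum_div]
  refine Finset.sum_congr rfl fun b hb => ?_
  rw [Finset.mem_range] at hb
  have hc := Nat.choose_mul_factorial_mul_factorial (show b ≤ p by omega)
  have h₁ : (p.factorial : ℝ) ≠ 0 := by positivity
  have h₂ : (b.factorial : ℝ) ≠ 0 := by positivity
  have h₃ : ((p - b).factorial : ℝ) ≠ 0 := by positivity
  have hc' : (p.choose b : ℝ) * b.factorial * (p - b).factorial = p.factorial := by
    exact_mod_cast hc
  field_simp
  rw [← hc']
  ring

/-- The recursion of `expT_add` for the number of monomials of degree at most `r` in `k + 1`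
variables: sort them by the exponent `b` of one variable. -/
theorem choose_hockey (k r : ℕ) :
    (k + 1 + r).choose r = ∑ b ∈ Finset.range (r + 1), (k + (r - b)).choose (r - b) := by
  have h := Finset.sum_range_reflect (fun b => (k + b).choose b) (r + 1)
  have h' : ∑ b ∈ Finset.range (r + 1), (k + (r - b)).choose (r - b) =
      ∑ b ∈ Finset.range (r + 1), (k + b).choose b := by
    rw [← h]
    exact Finset.sum_congr rfl fun b _ => by simp
  rw [h']
  clear h h'
  induction r with
  | zero => simp
  | succ r ih =>
    rw [Finset.sum_range_succ, ← ih, show k + 1 + (r + 1) = (k + 1 + r) + 1 by ring,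
      Nat.choose_succ_succ, show k + (r + 1) = k + 1 + r by ring]

/-- The weighted sum over nodes, where the nodes `c` with `P c` are still to be expanded. -/
noncomputable def nodeSum (y : ℕ → ℝ) (dg : ℕ → ℕ) (G M : ℕ) (P : ℕ → Prop) [DecidablePred P]
    (W₀ W₁ : ℕ → ℝ) : ℝ :=
  ∑ c ∈ Finset.range M, y c * if P c then W₀ (G - dg c) else W₁ (G - dg c)

section Nodes
variable {y y' : ℕ → ℝ} {dg dg' : ℕ → ℕ} {G M M₀ m a prev : ℕ} {W₀ W₁ : ℕ → ℝ} {cf : ℕ → ℝ}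
  {Tot : ℝ}

/-- The invariant while node `m` is being expanded. -/
def Expanding (y : ℕ → ℝ) (dg : ℕ → ℕ) (G M M₀ m a prev : ℕ) (W₀ W₁ cf : ℕ → ℝ) (Tot : ℝ) :
    Prop :=
  y prev = y m * cf a ∧
  nodeSum y dg G M (fun c => m < c ∧ c < M₀) W₀ W₁ +
    y m * ∑ b ∈ Finset.Ico (a + 1) (G - dg m + 1), cf b * W₁ (G - dg m - b) = Tot

/-- As `cf 0 = 1`, node `m` is its own child with exponent `0`: its weight changes from `W₀` to
`W₁`, and the terms with `b ≥ 1` of the recursion remain outstanding. -/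
theorem Expanding.start (hW : ∀ r, W₀ r = ∑ b ∈ Finset.range (r + 1), cf b * W₁ (r - b))
    (hcf : cf 0 = 1) (hm : m < M₀) (hM : M₀ ≤ M)
    (h : nodeSum y dg G M (fun c => m ≤ c ∧ c < M₀) W₀ W₁ = Tot) :
    Expanding y dg G M M₀ m 0 m W₀ W₁ cf Tot := by
  refine ⟨by rw [hcf, mul_one], ?_⟩
  rw [← h, nodeSum, nodeSum]
  have hmem : m ∈ Finset.range M := Finset.mem_range.2 (by omega)
  rw [← Finset.add_sum_erase _ _ hmem, ← Finset.add_sum_erase _ _ hmem]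
  have h₁ : ∑ c ∈ (Finset.range M).erase m, y c * (if m < c ∧ c < M₀ then W₀ (G - dg c) else
      W₁ (G - dg c)) = ∑ c ∈ (Finset.range M).erase m, y c * (if m ≤ c ∧ c < M₀ then
      W₀ (G - dg c) else W₁ (G - dg c)) := by
    refine Finset.sum_congr rfl fun c hc => ?_
    have hcm : c ≠ m := Finset.ne_of_mem_erase hc
    have : (m < c ∧ c < M₀) ↔ (m ≤ c ∧ c < M₀) := by omega
    simp [this]
  rw [h₁]
  simp only [lt_irrefl, false_and, if_false, le_refl, hm, true_and, if_true]
  have h₂ : W₀ (G - dg m) = W₁ (G - dg m) +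
      ∑ b ∈ Finset.Ico (0 + 1) (G - dg m + 1), cf b * W₁ (G - dg m - b) := by
    rw [hW, Finset.range_eq_Ico, Finset.sum_eq_sum_Ico_succ_bot (by omega), hcf, one_mul,
      Nat.sub_zero]
  rw [h₂]
  ring

/-- The appended node has number `M ≥ M₀`, so it counts with the weight `W₁`. Its contribution is
the first term of the outstanding sum, and the total is conserved. -/
theorem Expanding.step (h : Expanding y dg G M M₀ m a prev W₀ W₁ cf Tot)
    (hm : m < M) (hM : M₀ ≤ M) (hdg : dg prev = dg m + a) (ha : a < G - dg m)
    {ζ : ℝ} (hcf : cf (a + 1) = cf a * ζ) (hy : ∀ c < M, y' c = y c)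
    (hyM : y' M = y prev * ζ) (hd : ∀ c < M, dg' c = dg c) (hdM : dg' M = dg prev + 1) :
    Expanding y' dg' G (M + 1) M₀ m (a + 1) M W₀ W₁ cf Tot := by
  obtain ⟨h₁, h₂⟩ := h
  refine ⟨by rw [hyM, h₁, hcf, hy m hm, mul_assoc], ?_⟩
  rw [← h₂, nodeSum, Finset.sum_range_succ, hyM, hdM, hy m hm, hd m hm, nodeSum]
  have h₃ : ∑ c ∈ Finset.range M, (y' c * if m < c ∧ c < M₀ then W₀ (G - dg' c) else
      W₁ (G - dg' c)) = ∑ c ∈ Finset.range M, (y c * if m < c ∧ c < M₀ then W₀ (G - dg c) else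
      W₁ (G - dg c)) := by
    refine Finset.sum_congr rfl fun c hc => ?_
    rw [Finset.mem_range] at hc
    rw [hy c hc, hd c hc]
  rw [h₃, Finset.sum_eq_sum_Ico_succ_bot (show a + 1 < G - dg m + 1 by omega), hdg, h₁, hcf]
  have : ¬ (m < M ∧ M < M₀) := by omega
  rw [if_neg this, show G - (dg m + a + 1) = G - dg m - (a + 1) by omega]
  ring

theorem Expanding.finish (h : Expanding y dg G M M₀ m (G - dg m) prev W₀ W₁ cf Tot) :
    nodeSum y dg G M (fun c => m + 1 ≤ c ∧ c < M₀) W₀ W₁ = Tot := by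
  have := h.2
  rw [Finset.Ico_self, Finset.sum_empty, mul_zero, add_zero] at this
  exact this

theorem nodeSum_start :
    nodeSum y dg G M (fun c => c < M) W₀ W₁ =
      ∑ c ∈ Finset.range M, y c * W₀ (G - dg c) := by
  refine Finset.sum_congr rfl fun c hc => ?_
  rw [Finset.mem_range] at hc
  simp [hc]

theorem nodeSum_finish :
    nodeSum y dg G M (fun c => M₀ ≤ c ∧ c < M₀) W₀ W₁ =
      ∑ c ∈ Finset.range M, y c * W₁ (G - dg c) := by
  refine Finset.sum_congr rfl fun c hc => ?_
  have : ¬ (M₀ ≤ c ∧ c < M₀) := by omega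
  simp [this]

/-- When all node values are `1`, each node contributes at least `1` to the conserved total. This
bounds the number of nodes at every moment of the construction, not only at its end. -/
theorem Expanding.card_le (h : Expanding (fun _ => 1) dg G M M₀ m a prev W₀ W₁ cf Tot)
    (h₀ : ∀ r, 1 ≤ W₀ r) (h₁ : ∀ r, 1 ≤ W₁ r) (hcf : ∀ b, 0 ≤ cf b) : (M : ℝ) ≤ Tot := by
  rw [← h.2]
  have : (M : ℝ) = ∑ c ∈ Finset.range M, (1 : ℝ) := by simp
  rw [this, nodeSum]
  refine le_add_of_le_of_nonneg (Finset.sum_le_sum fun c _ => ?_) ?_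
  · split_ifs
    · simpa using h₀ _
    · simpa using h₁ _
  · rw [one_mul]
    exact Finset.sum_nonneg fun b _ => mul_nonneg (hcf b) (zero_le_one.trans (h₁ _))

end Nodes

/-! ## Frames -/

/-- The state changes only the registers in `I`, the real registers in `F`, the arrays in `A` and
the natural-number memory. -/
structure Fr (I F A : List ℕ) (σ σ' : RamState) : Prop where
  ireg : ∀ v, v ∉ I → σ'.ireg v = σ.ireg v
  freg : ∀ v, v ∉ F → σ'.freg v = σ.freg v
  fmem : ∀ x, (x < σ.ireg 3 ∨ (x - σ.ireg 3) % 16 ∉ A) → σ'.fmem x = σ.fmem x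

section Frame
variable {I F A I' F' A' : List ℕ} {σ σ' σ'' : RamState}

theorem Fr.refl (I F A : List ℕ) (σ : RamState) : Fr I F A σ σ :=
  ⟨fun _ _ => rfl, fun _ _ => rfl, fun _ _ => rfl⟩

theorem Fr.trans (h : Fr I F A σ σ') (h3 : 3 ∉ I) (h' : Fr I F A σ' σ'') : Fr I F A σ σ'' :=
  ⟨fun v hv => (h'.ireg v hv).trans (h.ireg v hv), fun v hv => (h'.freg v hv).trans (h.freg v hv),
    fun x hx => (h'.fmem x (by rwa [h.ireg 3 h3])).trans (h.fmem x hx)⟩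

theorem Fr.mono (h : Fr I F A σ σ') (hI : I ⊆ I') (hF : F ⊆ F') (hA : A ⊆ A') :
    Fr I' F' A' σ σ' :=
  ⟨fun v hv => h.ireg v fun h => hv (hI h), fun v hv => h.freg v fun h => hv (hF h),
    fun x hx => h.fmem x (hx.imp_right fun hx h => hx (hA h))⟩

theorem Fr.raw (h : Fr I F A σ σ') {x : ℕ} (hx : x < σ.ireg 3) : σ'.fmem x = σ.fmem x :=
  h.fmem x (.inl hx)

theorem Fr.arr (h : Fr I F A σ σ') (h3 : 3 ∉ I) {β : ℕ} (hβ : β < 16) (hA : β ∉ A) (idx : ℕ) :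
    σ'.arr β idx = σ.arr β idx := by
  rw [RamState.arr, h.ireg 3 h3]
  refine h.fmem _ (.inr ?_)
  rwa [show (σ.ireg 3 + 16 * idx + β - σ.ireg 3) % 16 = β by omega]

theorem Fr.setI (h : Fr I F A σ σ') {v : ℕ} (hv : v ∈ I) (x : ℕ) : Fr I F A σ (σ'.setI v x) := by
  refine ⟨fun u hu => ?_, h.freg, h.fmem⟩
  have : u ≠ v := fun h => hu (h ▸ hv)
  simp [this, h.ireg u hu]

theorem Fr.setF (h : Fr I F A σ σ') {v : ℕ} (hv : v ∈ F) (x : ℝ) : Fr I F A σ (σ'.setF v x) := by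
  refine ⟨h.ireg, fun u hu => ?_, h.fmem⟩
  have : u ≠ v := fun h => hu (h ▸ hv)
  simp [this, h.freg u hu]

theorem Fr.setIM (h : Fr I F A σ σ') (a x : ℕ) : Fr I F A σ (σ'.setIM a x) :=
  ⟨h.ireg, h.freg, h.fmem⟩

theorem Same.toFr {R : Set ℕ} (h : Same R I σ σ') {α : ℕ} (hR : R ⊆ cells (σ.ireg 3) α) :
    Fr I [] [α] σ σ' := by
  refine ⟨h.ireg, fun v _ => by rw [h.freg], fun x hx => h.fmem x fun hc => ?_⟩
  have := hR hc
  simp only [cells, Set.mem_ofPred_eq] at this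
  rcases hx with hx | hx
  · omega
  · simp at hx; omega

end Frame

/-! ## The feature tables -/

/-- Append a node: the child of node `prev` (register 17) in coordinate `l` (register 15), with
exponent `a + 1` (register 16), becomes node `M` (register 12). -/
def childC : Cmd :=
  .seq (fillRow 12 6 (.mul (ldA 6 (.add (.mul (.var 2) 17) (.var 4)))
    -- The scalar `1 / ((a + 1) * D)` goes entirely to the query side. Over the successive children
    -- it builds up the factorials and the powers of `D`; the key side stays a plain monomial.
    (.div (ldA 3 (.add (.mul (.var 4) 6) (.var 15)))
      (.mul (.ofNat (.add (.var 16) (.const 1))) (.ofNat (.var 6)))))) <|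
  .seq (fillRow 12 7 (.mul (ldA 7 (.add (.mul (.var 2) 17) (.var 4)))
    (ldA 4 (.add (.mul (.var 4) 6) (.var 15))))) <|
  .seq (.iput (.var 12) (.add (.ld (.var 17)) (.const 1))) <|
  .seq (.iset 17 (.var 12)) (.iset 12 (.add (.var 12) (.const 1)))

theorem row_cells_subset (b N r α : ℕ) (hα : α < 16) :
    {x | ∃ i < N, x = b + 16 * (N * r + i) + α} ⊆ cells b α := by
  rintro x ⟨i, _, rfl⟩
  simp only [cells, Set.mem_ofPred_eq]
  omega

theorem Same.arr_row {σ σ' : RamState} {N r α : ℕ} {I : List ℕ}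
    (h : Same {x | ∃ i < N, x = σ.ireg 3 + 16 * (N * r + i) + α} I σ σ') (h3 : 3 ∉ I)
    {idx : ℕ} (hidx : idx < N * r) : σ'.arr α idx = σ.arr α idx := by
  rw [RamState.arr, h.ireg 3 h3]
  refine h.fmem _ ?_
  rintro ⟨i, _, hi⟩
  omega

theorem row_lt {N c M i : ℕ} (hc : c < M) (hi : i < N) : N * c + i < N * M := by
  have : N * (c + 1) ≤ N * M := Nat.mul_le_mul_left N hc
  rw [Nat.mul_succ] at this
  omega

theorem childC_spec {N S : ℕ} {σ : RamState} (h7 : σ.ireg 7 = 16) (hp : σ.ireg 17 < σ.ireg 12)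
    (hM : σ.ireg 12 + 1 ≤ S) :
    Wp N S childC σ fun σ' => Fr [4, 12, 17] [] [6, 7] σ σ' ∧
      (∀ idx < σ.ireg 2 * σ.ireg 12, σ'.arr 6 idx = σ.arr 6 idx ∧ σ'.arr 7 idx = σ.arr 7 idx) ∧
      (∀ i < σ.ireg 2, σ'.arr 6 (σ.ireg 2 * σ.ireg 12 + i) =
        σ.arr 6 (σ.ireg 2 * σ.ireg 17 + i) * (σ.arr 3 (i * σ.ireg 6 + σ.ireg 15) /
          (((σ.ireg 16 + 1 : ℕ) : ℝ) * (σ.ireg 6 : ℝ)))) ∧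
      (∀ i < σ.ireg 2, σ'.arr 7 (σ.ireg 2 * σ.ireg 12 + i) =
        σ.arr 7 (σ.ireg 2 * σ.ireg 17 + i) * σ.arr 4 (i * σ.ireg 6 + σ.ireg 15)) ∧
      σ'.imem = Function.update σ.imem (σ.ireg 12) (σ.imem (σ.ireg 17) + 1) ∧
      σ'.ireg 12 = σ.ireg 12 + 1 ∧ σ'.ireg 17 = σ.ireg 12 := by
  refine Wp.seq ((Wp.fillRow (fun i => σ.arr 6 (σ.ireg 2 * σ.ireg 17 + i) *
      (σ.arr 3 (i * σ.ireg 6 + σ.ireg 15) / (((σ.ireg 16 + 1 : ℕ) : ℝ) * (σ.ireg 6 : ℝ))))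
    (by omega) h7 rfl rfl ?_).mono ?_)
  · intro i hi σ' hs hi'
    have h7' : σ'.ireg 7 = 16 := by rw [hs.ireg 7 (by simp), h7]
    have hF := hs.toFr (row_cells_subset _ _ _ _ (by omega))
    have r2 := hs.ireg 2 (by simp)
    have r17 := hs.ireg 17 (by simp)
    have r6 := hs.ireg 6 (by simp)
    have r15 := hs.ireg 15 (by simp)
    have r16 := hs.ireg 16 (by simp)
    simp only [RE.eval, ldA_eval h7', NE.eval, hi', r2, r17, r6, r15, r16]
    rw [hs.arr_row (by simp) (row_lt hp hi), hF.arr (by simp) (by omega) (by simp)]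
  rintro σ₁ _ ⟨s₁, v₁⟩
  have f₁ := s₁.toFr (row_cells_subset _ _ _ _ (by omega))
  have r7 := s₁.ireg 7 (by simp)
  have r2 := s₁.ireg 2 (by simp)
  have r12 := s₁.ireg 12 (by simp)
  have r17 := s₁.ireg 17 (by simp)
  have r6 := s₁.ireg 6 (by simp)
  have r15 := s₁.ireg 15 (by simp)
  refine Wp.seq ((Wp.fillRow (fun i => σ.arr 7 (σ.ireg 2 * σ.ireg 17 + i) *
      σ.arr 4 (i * σ.ireg 6 + σ.ireg 15))
    (by omega) (r7.trans h7) rfl rfl ?_).mono ?_)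
  · intro i hi σ' hs hi'
    have h7' : σ'.ireg 7 = 16 := by rw [hs.ireg 7 (by simp), r7, h7]
    have hF := hs.toFr (row_cells_subset _ _ _ _ (by omega))
    simp only [RE.eval, ldA_eval h7', NE.eval, hi', hs.ireg 2 (by simp), hs.ireg 17 (by simp),
      hs.ireg 6 (by simp), hs.ireg 15 (by simp)]
    rw [hs.arr_row (by simp) (row_lt (by omega) hi), hF.arr (by simp) (by omega) (by simp),
      f₁.arr (by simp) (by omega) (by simp), f₁.arr (by simp) (by omega) (by simp), r2, r17, r6,
      r15]
  rintro σ₂ _ ⟨s₂, v₂⟩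
  rw [r2, r12] at v₂
  have f₂ := s₂.toFr (row_cells_subset _ _ _ _ (by omega))
  have q12 : σ₂.ireg 12 = σ.ireg 12 := by rw [s₂.ireg 12 (by simp), r12]
  have q17 : σ₂.ireg 17 = σ.ireg 17 := by rw [s₂.ireg 17 (by simp), r17]
  have f₃ : Fr [4, 12, 17] [] [6, 7] σ σ₂ :=
    (f₁.mono (by simp) (by simp) (by simp)).trans (by simp) (f₂.mono (by simp) (by simp) (by simp))
  refine Wp.seq (Wp.iput rfl rfl (Wp.seq (Wp.iset (by omega) rfl (fun _ _ => ?_) (by simp)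
    (Wp.iset (by omega) rfl (fun _ _ => ?_) (by simp) ⟨?_, ?_, ?_, ?_, ?_, ?_, ?_⟩))))
  · simp [NE.eval, q12]; omega
  · simp [NE.eval, q12, hM]
  · exact ((f₃.setIM _ _).setI (by simp) _).setI (by simp) _
  · intro idx hidx
    rw [setI_arr _ (by omega), setI_arr _ (by omega), setI_arr _ (by omega), setI_arr _ (by omega)]
    simp only [setIM_arr]
    refine ⟨?_, ?_⟩
    · rw [f₂.arr (by simp) (by omega) (by simp), s₁.arr_row (by simp) hidx]
    · rw [← f₁.arr (by simp) (by omega) (by simp), s₂.arr_row (by simp) (by rwa [r2, r12])]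
  · intro i hi
    rw [setI_arr _ (by omega), setI_arr _ (by omega)]
    simp only [setIM_arr]
    rw [f₂.arr (by simp) (by omega) (by simp), v₁ i hi]
  · intro i hi
    rw [setI_arr _ (by omega), setI_arr _ (by omega)]
    simp only [setIM_arr]
    rw [v₂ i hi]
  · simp [NE.eval, q12, q17, s₁.imem, s₂.imem, RamState.setIM]
  · simp [NE.eval, q12]
  · simp [NE.eval, q12]

/-- Build the tables of features: all monomials of degree at most `G` (register 11) in the
coordinates of the queries (array 3) and of the keys (array 4). -/
def featC : Cmd :=
  .seq (.iput (.const 0) (.const 0)) <|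
  .seq (.iset 17 (.const 0)) <|
  .seq (fillRow 17 6 (.const 1)) <|
  .seq (fillRow 17 7 (.const 1)) <|
  .seq (.iset 12 (.const 1)) <|
  .forC false 15 (.var 6) <|
    .seq (.iset 13 (.var 12)) <|
    .forC false 14 (.var 13) <|
      .seq (.iset 17 (.var 14)) <|
      .forC false 16 (.sub (.var 11) (.ld (.var 14))) childC

/-- The product of the entries for tokens `i` and `j` of the two rows of node `c`. -/
noncomputable def nodeVal (σ : RamState) (i j c : ℕ) : ℝ :=
  σ.arr 6 (σ.ireg 2 * c + i) * σ.arr 7 (σ.ireg 2 * c + j)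

/-- The contribution of coordinate `l` to the scaled inner product of query `i` and key `j`. -/
noncomputable def coordProd (σ : RamState) (i j l : ℕ) : ℝ :=
  σ.arr 3 (i * σ.ireg 6 + l) * σ.arr 4 (j * σ.ireg 6 + l) / (σ.ireg 6 : ℝ)

theorem nodeVal_congr {σ σ' : RamState} (h2 : σ'.ireg 2 = σ.ireg 2)
    (h : ∀ α idx, σ'.arr α idx = σ.arr α idx) : nodeVal σ' = nodeVal σ := by
  funext i j c
  simp [nodeVal, h2, h]

/-- Two instances of `Expanding` run in parallel. One has the products of query and key features as
node values, for each pair of tokens, and yields the kernel. The other has all values `1` and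
binomial coefficients as weights, and bounds the number of nodes. -/
theorem Wp.childLoop {N S : ℕ} {σ₀ σ : RamState} {G D l M₀ m : ℕ} (h7 : σ₀.ireg 7 = 16)
    (hG : σ₀.ireg 11 = G) (hS : (D + G).choose G ≤ S) (hl : l < D)
    (hF : Fr [4, 12, 13, 14, 15, 16, 17] [] [6, 7] σ₀ σ) (h13 : σ.ireg 13 = M₀)
    (h14 : σ.ireg 14 = m) (h15 : σ.ireg 15 = l) (h17 : σ.ireg 17 = m) (hm : m < M₀)
    (hM : M₀ ≤ σ.ireg 12)
    (H : ∀ i < σ₀.ireg 2, ∀ j < σ₀.ireg 2,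
      nodeSum (nodeVal σ i j) σ.imem G (σ.ireg 12) (fun c => m ≤ c ∧ c < M₀)
        (fun r => expT r (∑ l' ∈ Finset.Ico l D, coordProd σ₀ i j l'))
        (fun r => expT r (∑ l' ∈ Finset.Ico (l + 1) D, coordProd σ₀ i j l')) =
      expT G (∑ l' ∈ Finset.range D, coordProd σ₀ i j l'))
    (H' : nodeSum (fun _ => 1) σ.imem G (σ.ireg 12) (fun c => m ≤ c ∧ c < M₀)
        (fun r => ((D - l + r).choose r : ℝ)) (fun r => ((D - (l + 1) + r).choose r : ℝ)) =
      ((D + G).choose G : ℝ)) :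
    Wp N S (.forC false 16 (.sub (.var 11) (.ld (.var 14))) childC) σ fun σ' =>
      Fr [4, 12, 13, 14, 15, 16, 17] [] [6, 7] σ₀ σ' ∧ σ'.ireg 13 = M₀ ∧ σ'.ireg 15 = l ∧
      M₀ ≤ σ'.ireg 12 ∧
      (∀ i < σ₀.ireg 2, ∀ j < σ₀.ireg 2,
        nodeSum (nodeVal σ' i j) σ'.imem G (σ'.ireg 12) (fun c => m + 1 ≤ c ∧ c < M₀)
          (fun r => expT r (∑ l' ∈ Finset.Ico l D, coordProd σ₀ i j l'))
          (fun r => expT r (∑ l' ∈ Finset.Ico (l + 1) D, coordProd σ₀ i j l')) =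
        expT G (∑ l' ∈ Finset.range D, coordProd σ₀ i j l')) ∧
      nodeSum (fun _ => 1) σ'.imem G (σ'.ireg 12) (fun c => m + 1 ≤ c ∧ c < M₀)
        (fun r => ((D - l + r).choose r : ℝ)) (fun r => ((D - (l + 1) + r).choose r : ℝ)) =
      ((D + G).choose G : ℝ) := by
  have r11 : σ.ireg 11 = G := by rw [hF.ireg 11 (by simp), hG]
  have hb : (NE.sub (.var 11) (.ld (.var 14))).eval σ = G - σ.imem m := by
    simp [NE.eval, r11, h14]
  have hW : ∀ i j r, expT r (∑ l' ∈ Finset.Ico l D, coordProd σ₀ i j l') =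
      ∑ b ∈ Finset.range (r + 1), coordProd σ₀ i j l ^ b / (b.factorial : ℝ) *
        expT (r - b) (∑ l' ∈ Finset.Ico (l + 1) D, coordProd σ₀ i j l') := by
    intro i j r
    rw [Finset.sum_eq_sum_Ico_succ_bot hl, expT_add]
  have hW' : ∀ r, ((D - l + r).choose r : ℝ) =
      ∑ b ∈ Finset.range (r + 1), (1 : ℝ) * ((D - (l + 1) + (r - b)).choose (r - b) : ℝ) := by
    intro r
    rw [show D - l + r = D - (l + 1) + 1 + r by omega, choose_hockey]
    simp
  refine Wp.forC (fun a σ' => Fr [4, 12, 13, 14, 15, 16, 17] [] [6, 7] σ₀ σ' ∧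
    σ'.ireg 13 = M₀ ∧ σ'.ireg 15 = l ∧ M₀ ≤ σ'.ireg 12 ∧ σ'.ireg 17 < σ'.ireg 12 ∧
    σ'.imem (σ'.ireg 17) = σ'.imem m + a ∧ σ'.imem m = σ.imem m ∧
    (∀ i < σ₀.ireg 2, ∀ j < σ₀.ireg 2,
      Expanding (nodeVal σ' i j) σ'.imem G (σ'.ireg 12) M₀ m a (σ'.ireg 17)
        (fun r => expT r (∑ l' ∈ Finset.Ico l D, coordProd σ₀ i j l'))
        (fun r => expT r (∑ l' ∈ Finset.Ico (l + 1) D, coordProd σ₀ i j l'))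
        (fun b => coordProd σ₀ i j l ^ b / (b.factorial : ℝ))
        (expT G (∑ l' ∈ Finset.range D, coordProd σ₀ i j l'))) ∧
    Expanding (fun _ => 1) σ'.imem G (σ'.ireg 12) M₀ m a (σ'.ireg 17)
        (fun r => ((D - l + r).choose r : ℝ)) (fun r => ((D - (l + 1) + r).choose r : ℝ))
        (fun _ => 1) ((D + G).choose G : ℝ))
    (by omega) (by omega) rfl (by simp) (fun hs => ?_) ?_ ?_ ?_
  · rw [hb]
    have := hs.1 11 rfl
    simp; omega
  · exact ⟨hF, h13, h15, hM, by omega, by rw [h17]; rfl, rfl,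
      fun i hi j hj => by
        rw [h17]; exact Expanding.start (hW i j) (by simp) hm hM (H i hi j hj),
      by rw [h17]; exact Expanding.start hW' rfl hm hM H'⟩
  · rintro a ha σ' ⟨k₁, k₂, k₃, k₄, k₅, k₆, k₇, k₈, k₉⟩
    rw [hb] at ha
    -- The counting invariant is advanced before the command is run: it shows that the increased
    -- number of nodes still fits into a small register.
    have hstep : Expanding (fun _ => 1) (Function.update σ'.imem (σ'.ireg 12)
        (σ'.imem (σ'.ireg 17) + 1)) G (σ'.ireg 12 + 1) M₀ m (a + 1) (σ'.ireg 12)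
        (fun r => ((D - l + r).choose r : ℝ)) (fun r => ((D - (l + 1) + r).choose r : ℝ))
        (fun _ => 1) ((D + G).choose G : ℝ) := by
      refine k₉.step (ζ := 1) (by omega) k₄ k₆ (by omega) (by simp) (fun _ _ => rfl) (by simp)
        (fun c hc => ?_) (by simp)
      simp [hc.ne]
    have hcard : σ'.ireg 12 + 1 ≤ S := by
      refine le_trans ?_ hS
      have h := hstep.card_le (fun r => ?_) (fun r => ?_) (fun _ => zero_le_one)
      · exact_mod_cast h
      · exact_mod_cast Nat.choose_pos (by omega)
      · exact_mod_cast Nat.choose_pos (by omega)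
    refine (childC_spec ?_ ?_ ?_).mono ?_
    · simp [k₁.ireg 7 (by simp), h7]
    · simpa using k₅
    · simpa using hcard
    rintro σ'' _ ⟨g₁, g₂, g₃, g₄, g₅, g₆, g₇⟩
    simp only [setI_arr _ (show (16 : ℕ) ≠ 3 by omega), setI_imem, setI_ireg] at g₂ g₃ g₄ g₅ g₆ g₇
    norm_num at g₂ g₃ g₄ g₅ g₆ g₇
    have k2 := k₁.ireg 2 (by simp)
    have k6 := k₁.ireg 6 (by simp)
    rw [k2] at g₂ g₃ g₄
    rw [k₃, k6] at g₃ g₄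
    have fr : Fr [4, 12, 13, 14, 15, 16, 17] [] [6, 7] σ₀ σ'' :=
      (k₁.setI (v := 16) (by simp) a).trans (by simp) (g₁.mono (by simp) (by simp) (by simp))
    have hi : ∀ c < σ'.ireg 12, σ''.imem c = σ'.imem c := by
      intro c hc
      simp [g₅, hc.ne]
    have hiM : σ''.imem (σ'.ireg 12) = σ'.imem (σ'.ireg 17) + 1 := by simp [g₅]
    have hv : ∀ i < σ₀.ireg 2, ∀ j < σ₀.ireg 2, ∀ c < σ'.ireg 12,
        nodeVal σ'' i j c = nodeVal σ' i j c := by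
      intro i hi j hj c hc
      rw [nodeVal, nodeVal, fr.ireg 2 (by simp), k2, (g₂ _ (row_lt hc hi)).1,
        (g₂ _ (row_lt hc hj)).2]
    have hvM : ∀ i < σ₀.ireg 2, ∀ j < σ₀.ireg 2, nodeVal σ'' i j (σ'.ireg 12) =
        nodeVal σ' i j (σ'.ireg 17) * (coordProd σ₀ i j l / (a + 1)) := by
      intro i hi j hj
      rw [nodeVal, nodeVal, fr.ireg 2 (by simp), k2, g₃ i hi, g₄ j hj, coordProd,
        k₁.arr (β := 3) (by simp) (by omega) (by simp),
        k₁.arr (β := 4) (by simp) (by omega) (by simp)]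
      simp only [div_eq_mul_inv, mul_inv]
      ring
    refine ⟨fr, ?_, ?_, by omega, by omega, ?_, ?_, ?_, ?_⟩
    · rw [g₁.ireg 13 (by simp)]; simpa using k₂
    · rw [g₁.ireg 15 (by simp)]; simpa using k₃
    · rw [g₇, hiM, k₆, hi m (by omega), add_assoc]
    · rw [hi m (by omega), k₇]
    · intro i hi' j hj
      rw [g₆, g₇]
      refine (k₈ i hi' j hj).step (ζ := coordProd σ₀ i j l / (a + 1)) (by omega) k₄ k₆ (by omega)
        ?_ (hv i hi' j hj) (hvM i hi' j hj) hi hiM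
      rw [Nat.factorial_succ, pow_succ]
      push_cast
      field_simp
    · rw [g₅, g₆, g₇]
      exact hstep
  · rintro σ' _ ⟨k₁, k₂, k₃, k₄, _, _, k₇, k₈, k₉⟩
    rw [hb, ← k₇] at k₈ k₉
    exact ⟨k₁, k₂, k₃, k₄, fun i hi j hj => (k₈ i hi j hj).finish, k₉.finish⟩

/-- Conserved before coordinate `l`: the sum over the nodes of value times `expT (G - degree)` of
the part of the inner product from `l` on. Initially there is one node, of value `1` and degree `0`,
so the total is the full Taylor polynomial; finally the remaining part is empty and every weight is
`expT _ 0 = 1`. -/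
theorem Wp.featC {N S : ℕ} {σ₀ : RamState} {G D : ℕ} (h7 : σ₀.ireg 7 = 16)
    (hD : σ₀.ireg 6 = D) (hG : σ₀.ireg 11 = G) (hS : (D + G).choose G ≤ S) :
    Wp N S featC σ₀ fun σ' => Fr [4, 12, 13, 14, 15, 16, 17] [] [6, 7] σ₀ σ' ∧
      ∀ i < σ₀.ireg 2, ∀ j < σ₀.ireg 2,
        ∑ c ∈ Finset.range (σ'.ireg 12), nodeVal σ' i j c =
          expT G (∑ l ∈ Finset.range D, coordProd σ₀ i j l) := by
  have hS1 : 1 ≤ S := le_trans (Nat.choose_pos (by omega)) hS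
  refine Wp.seq (Wp.iput rfl rfl (Wp.seq (Wp.iset (by omega) rfl (fun _ _ => by simp [NE.eval])
    (by simp) (Wp.seq ?_))))
  have i₁ : Fr [4, 12, 13, 14, 15, 16, 17] [] [6, 7] σ₀
      ((σ₀.setIM (NE.eval σ₀ (.const 0)) (NE.eval σ₀ (.const 0))).setI 17
        (NE.eval (σ₀.setIM (NE.eval σ₀ (.const 0)) (NE.eval σ₀ (.const 0))) (.const 0))) :=
    ((Fr.refl _ _ _ _).setIM _ _).setI (by simp) _
  have e₁ : ((σ₀.setIM (NE.eval σ₀ (.const 0)) (NE.eval σ₀ (.const 0))).setI 17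
        (NE.eval (σ₀.setIM (NE.eval σ₀ (.const 0)) (NE.eval σ₀ (.const 0))) (.const 0))).imem 0
        = 0 := by
    simp [NE.eval]
  have e₁' : ((σ₀.setIM (NE.eval σ₀ (.const 0)) (NE.eval σ₀ (.const 0))).setI 17
        (NE.eval (σ₀.setIM (NE.eval σ₀ (.const 0)) (NE.eval σ₀ (.const 0))) (.const 0))).ireg 17
        = 0 := by
    simp [NE.eval]
  generalize (σ₀.setIM (NE.eval σ₀ (.const 0)) (NE.eval σ₀ (.const 0))).setI 17
        (NE.eval (σ₀.setIM (NE.eval σ₀ (.const 0)) (NE.eval σ₀ (.const 0))) (.const 0)) = σ₁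
    at i₁ e₁ e₁' ⊢
  refine (Wp.fillRow (fun _ => 1) (by omega) (by rw [i₁.ireg 7 (by simp), h7]) rfl rfl
    (fun _ _ _ _ _ => by simp [RE.eval])).mono ?_
  rintro σ₂ _ ⟨s₂, v₂⟩
  have f₂ := s₂.toFr (row_cells_subset _ _ _ _ (by omega))
  have i₂ : Fr [4, 12, 13, 14, 15, 16, 17] [] [6, 7] σ₀ σ₂ :=
    i₁.trans (by simp) (f₂.mono (by simp) (by simp) (by simp))
  refine Wp.seq ((Wp.fillRow (fun _ => 1) (by omega) (by rw [i₂.ireg 7 (by simp), h7]) rfl rfl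
    (fun _ _ _ _ _ => by simp [RE.eval])).mono ?_)
  rintro σ₃ _ ⟨s₃, v₃⟩
  have f₃ := s₃.toFr (row_cells_subset _ _ _ _ (by omega))
  have i₃ : Fr [4, 12, 13, 14, 15, 16, 17] [] [6, 7] σ₀ σ₃ :=
    i₂.trans (by simp) (f₃.mono (by simp) (by simp) (by simp))
  have e₃ : σ₃.imem 0 = 0 := by rw [s₃.imem, s₂.imem, e₁]
  have a₆ : ∀ i < σ₀.ireg 2, σ₃.arr 6 i = 1 := by
    intro i hi
    have := v₂ i (by rwa [i₁.ireg 2 (by simp)])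
    rw [e₁', mul_zero, zero_add] at this
    rw [f₃.arr (by simp) (by omega) (by simp), this]
  have a₇ : ∀ i < σ₀.ireg 2, σ₃.arr 7 i = 1 := by
    intro i hi
    have := v₃ i (by rwa [i₂.ireg 2 (by simp)])
    rwa [s₂.ireg 17 (by simp), e₁', mul_zero, zero_add] at this
  refine Wp.seq (Wp.iset (by omega) rfl (fun _ _ => by simpa [NE.eval]) (by simp) ?_)
  have r6 : (σ₃.setI 12 (NE.eval σ₃ (.const 1))).ireg 6 = D := by
    simp [i₃.ireg 6 (by simp), hD]
  refine Wp.forC (fun l σ' => Fr [4, 12, 13, 14, 15, 16, 17] [] [6, 7] σ₀ σ' ∧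
      (∀ i < σ₀.ireg 2, ∀ j < σ₀.ireg 2,
        ∑ c ∈ Finset.range (σ'.ireg 12), nodeVal σ' i j c *
          expT (G - σ'.imem c) (∑ l' ∈ Finset.Ico l D, coordProd σ₀ i j l') =
        expT G (∑ l' ∈ Finset.range D, coordProd σ₀ i j l')) ∧
      ∑ c ∈ Finset.range (σ'.ireg 12), (1 : ℝ) *
          ((D - l + (G - σ'.imem c)).choose (G - σ'.imem c) : ℝ) = ((D + G).choose G : ℝ))
    (by omega) (by omega) rfl (by simp) (fun hs => by simpa [NE.eval] using hs.1 6 rfl) ?_ ?_ ?_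
  · refine ⟨i₃.setI (by simp) _, fun i hi j hj => ?_, ?_⟩
    · have h6 := a₆ i hi
      have h7 := a₇ j hj
      simp [NE.eval, nodeVal, setI_arr, h6, h7, e₃]
    · simp [NE.eval, e₃]
  · rintro l hl σ' ⟨k₁, k₂, k₃⟩
    simp only [NE.eval] at hl
    rw [show (σ₃.setI 12 1).ireg 6 = D from r6] at hl
    have hn : nodeVal ((σ'.setI 15 l).setI 13 (NE.eval (σ'.setI 15 l) (.var 12))) =
        nodeVal σ' := nodeVal_congr (by simp) (fun α idx => by
      rw [setI_arr _ (by omega), setI_arr _ (by omega)])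
    refine Wp.seq (Wp.iset (by omega) rfl (fun hs _ => by simpa [NE.eval] using hs.1 12 rfl)
      (by simp) ?_)
    refine Wp.forC (fun m σ'' => Fr [4, 12, 13, 14, 15, 16, 17] [] [6, 7] σ₀ σ'' ∧
        σ''.ireg 13 = σ'.ireg 12 ∧ σ''.ireg 15 = l ∧ σ'.ireg 12 ≤ σ''.ireg 12 ∧
        (∀ i < σ₀.ireg 2, ∀ j < σ₀.ireg 2,
          nodeSum (nodeVal σ'' i j) σ''.imem G (σ''.ireg 12) (fun c => m ≤ c ∧ c < σ'.ireg 12)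
            (fun r => expT r (∑ l' ∈ Finset.Ico l D, coordProd σ₀ i j l'))
            (fun r => expT r (∑ l' ∈ Finset.Ico (l + 1) D, coordProd σ₀ i j l')) =
          expT G (∑ l' ∈ Finset.range D, coordProd σ₀ i j l')) ∧
        nodeSum (fun _ => 1) σ''.imem G (σ''.ireg 12) (fun c => m ≤ c ∧ c < σ'.ireg 12)
          (fun r => ((D - l + r).choose r : ℝ)) (fun r => ((D - (l + 1) + r).choose r : ℝ)) =
        ((D + G).choose G : ℝ))
      (by omega) (by omega) rfl (by simp) (fun hs => by simpa [NE.eval] using hs.1 13 rfl)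
      ?_ ?_ ?_
    · refine ⟨(k₁.setI (by simp) _).setI (by simp) _, by simp [NE.eval], by simp, by simp, ?_, ?_⟩
      · intro i hi j hj
        rw [hn]
        simpa [nodeSum_start] using k₂ i hi j hj
      · simpa [nodeSum_start] using k₃
    · rintro m hm σ'' ⟨q₁, q₂, q₃, q₄, q₅, q₆⟩
      have hm' : m < σ'.ireg 12 := by simpa [NE.eval] using hm
      have hn' : nodeVal ((σ''.setI 14 m).setI 17 (NE.eval (σ''.setI 14 m) (.var 14))) =
          nodeVal σ'' := nodeVal_congr (by simp) (fun α idx => by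
        rw [setI_arr _ (by omega), setI_arr _ (by omega)])
      refine Wp.seq (Wp.iset (by omega) rfl (fun hs _ => by simpa [NE.eval] using hs.1 14 rfl)
        (by simp) ?_)
      refine Wp.childLoop h7 hG hS hl ((q₁.setI (by simp) _).setI (by simp) _)
        (by simpa using q₂) (by simp) (by simpa using q₃) (by simp [NE.eval]) hm' (by simpa using q₄)
        ?_ ?_
      · intro i hi j hj
        rw [hn']
        simpa using q₅ i hi j hj
      · simpa using q₆
    · rintro σ'' _ ⟨q₁, _, _, _, q₅, q₆⟩
      have hm : NE.eval ((σ'.setI 15 l).setI 13 (NE.eval (σ'.setI 15 l) (.var 12))) (.var 13) =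
          σ'.ireg 12 := by simp [NE.eval]
      rw [hm] at q₅ q₆
      refine ⟨q₁, fun i hi j hj => ?_, ?_⟩
      · rw [← q₅ i hi j hj, nodeSum_finish]
      · rw [← q₆, nodeSum_finish]
  · rintro σ' _ ⟨k₁, k₂, _⟩
    have hD' : NE.eval (σ₃.setI 12 (NE.eval σ₃ (.const 1))) (.var 6) = D := r6
    rw [hD'] at k₂
    refine ⟨k₁, fun i hi j hj => ?_⟩
    rw [← k₂ i hi j hj]
    simp [expT_zero]

/-! ## Token matrices in memory -/

section Tokens
variable {n w : ℕ}

/-- The row number of a token. -/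
def tk (p : Fin n × Fin n) : ℕ := p.1 * n + p.2

theorem tk_lt (p : Fin n × Fin n) : tk p < n * n := by
  have h₁ : ((p.1 : ℕ) + 1) * n ≤ n * n := Nat.mul_le_mul_right n p.1.2
  have h₂ := p.2.2
  rw [Nat.succ_mul] at h₁
  unfold tk
  omega

theorem exists_tk {i : ℕ} (hi : i < n * n) : ∃ p : Fin n × Fin n, tk p = i := by
  have hn : 0 < n := Nat.pos_of_ne_zero fun h => by simp [h] at hi
  refine ⟨(⟨i / n, Nat.div_lt_of_lt_mul hi⟩, ⟨i % n, Nat.mod_lt _ hn⟩), ?_⟩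
  simpa [tk, mul_comm] using Nat.div_add_mod i n

theorem tk_injective : Function.Injective (tk : Fin n × Fin n → ℕ) := by
  rintro ⟨a, b⟩ ⟨a', b'⟩ h
  have hn : 0 < n := b.pos
  simp only [tk] at h
  have h₁ := congrArg (· / n) h
  have h₂ := congrArg (· % n) h
  simp only [Nat.mul_add_mod_self_right, Nat.mod_eq_of_lt b.2, Nat.mod_eq_of_lt b'.2] at h₂
  simp only [Nat.mul_comm _ n, Nat.mul_add_div hn, Nat.div_eq_of_lt b.2, Nat.div_eq_of_lt b'.2,
    add_zero] at h₁
  exact Prod.ext (Fin.ext h₁) (Fin.ext h₂)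

theorem sum_tk (F : ℕ → ℝ) : ∑ i ∈ Finset.range (n * n), F i = ∑ p : Fin n × Fin n, F (tk p) := by
  symm
  refine Finset.sum_bij (fun p _ => tk p) (fun p _ => Finset.mem_range.2 (tk_lt p))
    (fun p _ q _ h => tk_injective h) (fun i hi => ?_) (fun _ _ => rfl)
  obtain ⟨p, hp⟩ := exists_tk (Finset.mem_range.1 hi)
  exact ⟨p, Finset.mem_univ _, hp⟩

/-- The array `α` holds the matrix `X`, row by row. -/
def Holds (σ : RamState) (α : ℕ) (X : Matrix (Fin n × Fin n) (Fin w) ℝ) : Prop :=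
  ∀ p (j : Fin w), σ.arr α (tk p * w + j) = X p j

theorem Holds.fr {I F A : List ℕ} {σ σ' : RamState} {α : ℕ}
    {X : Matrix (Fin n × Fin n) (Fin w) ℝ} (h : Holds σ α X) (hF : Fr I F A σ σ') (h3 : 3 ∉ I)
    (hα : α < 16) (hA : α ∉ A) : Holds σ' α X :=
  fun p j => (hF.arr h3 hα hA _).trans (h p j)

/-- The command that fills the array `α` with a matrix whose rows are indexed by tokens and whose
number of columns is in the register `bj`. -/
abbrev fillTok (bj α : ℕ) (e : RE) : Cmd := fill₂ true 4 2 8 bj α e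

theorem Wp.fillTok {S : ℕ} {σ : RamState} {bj α : ℕ} {e : RE}
    (X : Matrix (Fin n × Fin n) (Fin w) ℝ) (hα : α < 16) (h7 : σ.ireg 7 = 16)
    (h2 : σ.ireg 2 = n * n) (hw : σ.ireg bj = w) (hbj : bj = 1 ∨ bj = 6) (he : e.ok = true)
    (H : ∀ (p : Fin n × Fin n) (j : Fin w), ∀ σ', Fr [4, 8] [] [α] σ σ' →
      σ'.ireg 4 = tk p → σ'.ireg 8 = j → e.eval σ' = X p j) :
    Wp (n * n) S (fillTok bj α e) σ fun σ' => Fr [4, 8] [] [α] σ σ' ∧ Holds σ' α X := by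
  have hX : ∃ val : ℕ → ℕ → ℝ, ∀ (p : Fin n × Fin n) (j : Fin w), val (tk p) j = X p j := by
    refine ⟨fun i j => if h : j < w then Function.extend tk (fun p => X p ⟨j, h⟩) 0 i else 0,
      fun p j => ?_⟩
    simp [tk_injective.extend_apply]
  obtain ⟨val, hval⟩ := hX
  refine (Wp.fill₂ val hα h7 (by omega) (by omega) (by omega) (fun _ => rfl) (fun _ => h2.le)
    (by omega) (by rcases hbj with rfl | rfl <;> rfl) (by omega) (by omega) (by omega) (by omega)
    (by omega) he ?_).mono ?_
  · intro i hi j hj σ' hs hi' hj'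
    obtain ⟨p, rfl⟩ := exists_tk (h2 ▸ hi)
    rw [H p ⟨j, hw ▸ hj⟩ σ' (hs.toFr subset_rfl) hi' hj', ← hval]
  · rintro σ' _ ⟨h₁, h₂⟩
    refine ⟨h₁.toFr subset_rfl, fun p j => ?_⟩
    rw [← hval, ← h₂ _ (h2 ▸ tk_lt p) _ (hw ▸ j.2), hw]

end Tokens

/-! ## One layer -/

section LayerPrograms

/-- The index `a * w + b` of an entry of a matrix. -/
def ix (a w b : ℕ) : NE := .add (.mul (.var a) w) (.var b)

/-- The mean of the row of the array `α` in register 4. -/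
def meanE (α : ℕ) : RE := .div (.sum 10 6 (ldA α (ix 4 6 10))) (.ofNat (.var 6))

/-- The normalized entry of the array `α`. -/
def lnE (α : ℕ) : RE :=
  .div (.sub (ldA α (ix 4 6 8)) (meanE α)) (.sqrt (.div (.sum 9 6
    (.mul (.sub (ldA α (ix 4 6 9)) (meanE α)) (.sub (ldA α (ix 4 6 9)) (meanE α))))
    (.ofNat (.var 6))))

/-- The address of an entry of the parameter matrix number `q` of the layer in register 20. -/
def parE (q : ℕ) (idx : NE) : NE :=
  .add (.add (.var 20) (.mul (.mul (.const q) 6) 6)) idx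

/-- An entry of the product of the array `α` with the parameter matrix number `q`. -/
def mmE (α q : ℕ) : RE := .sum 9 6 (.mul (ldA α (ix 4 6 9)) (.ld (parE q (ix 9 6 8))))

/-- The maximal absolute value of the entries of the array `α`. -/
def maxC (v α : ℕ) : Cmd :=
  .seq (.fset v (.const 0)) <|
  .forC true 4 (.var 2) <| .forC false 8 (.var 6) <|
    .ifF (.var v) (.sqrt (.mul (ldA α (ix 4 6 8)) (ldA α (ix 4 6 8))))
      (.fset v (.sqrt (.mul (ldA α (ix 4 6 8)) (ldA α (ix 4 6 8)))))

/-- The degree of the Taylor polynomial: the least `g` with `B ^ (g + 1) / (g + 1)!` at most the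
tolerance in the real register 0, where `B` bounds the scaled inner products. -/
def degC : Cmd :=
  .seq (maxC 3 3) <| .seq (maxC 4 4) <|
  .seq (.fset 6 (.mul (.var 3) (.var 4))) <| .seq (.fset 5 (.var 6)) <|
  .seq (.iset 11 (.const 0)) <|
  .forC true 5 (.var 0) <| .ifF (.var 0) (.var 5) <|
    .seq (.fset 5 (.div (.mul (.var 5) (.var 6)) (.ofNat (.add (.var 11) (.const 2)))))
      (.iset 11 (.add (.var 11) (.const 1)))

/-- The entry of row `r` (a register) for the token in register 4 of the array `α`. -/
def rowE (α r : ℕ) : RE := ldA α (.add (.mul (.var 2) r) (.var 4))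

/-- A transformer layer, on the array 1, with the parameters at the address in register 20. -/
def layerC : Cmd :=
  .seq (fillTok 6 2 (lnE 1)) <|
  .seq (fillTok 6 3 (mmE 2 0)) <|
  .seq (fillTok 6 4 (mmE 2 1)) <|
  .seq (fillTok 6 5 (mmE 2 2)) <|
  .seq degC <|
  .seq featC <|
  -- Here the quadratic cost disappears: the sums over all keys are formed once per feature instead
  -- of once per query.
  .seq (fill₂ false 14 12 8 6 8 (.sum 4 2 (.mul (rowE 7 14) (ldA 5 (ix 4 6 8))))) <|
  -- The sums for the denominator do not depend on the column; they are stored in each column so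
  -- that they are indexed like array 8.
  .seq (fill₂ false 14 12 8 6 9 (.sum 4 2 (rowE 7 14))) <|
  .seq (fillTok 6 10 (.add (.div (.sum 9 12 (.mul (rowE 6 9) (ldA 8 (ix 9 6 8))))
    (.sum 9 12 (.mul (rowE 6 9) (ldA 9 (ix 9 6 8))))) (ldA 1 (ix 4 6 8)))) <|
  .seq (fillTok 6 2 (lnE 10)) <|
  .seq (fillTok 6 1 (.add (.add (.sum 9 6 (.mul (.ld (parE 3 (ix 8 6 9))) (ldA 2 (ix 4 6 9))))
    (.ld (parE 4 (.var 8)))) (ldA 10 (ix 4 6 8)))) <|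
  .iset 20 (parE 4 (.var 6))

end LayerPrograms

/-! ### Correctness of the layer program -/

/-- The constant registers: `n`, `n * n`, the width `D`, the factor `16` and the tolerance. -/
structure Ctx (n D : ℕ) (tol : ℝ) (σ : RamState) : Prop where
  r0 : σ.ireg 0 = n
  r1 : σ.ireg 1 + 2 = D
  r2 : σ.ireg 2 = n * n
  r6 : σ.ireg 6 = D
  r7 : σ.ireg 7 = 16
  f0 : σ.freg 0 = tol

theorem Ctx.fr {n D : ℕ} {tol : ℝ} {σ σ' : RamState} {I F A : List ℕ} (h : Ctx n D tol σ)
    (hF : Fr I F A σ σ') (hI : ∀ v ∈ [0, 1, 2, 6, 7], v ∉ I) (h0 : 0 ∉ F) : Ctx n D tol σ' :=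
  ⟨by rw [hF.ireg 0 (hI 0 (by simp)), h.r0], by rw [hF.ireg 1 (hI 1 (by simp)), h.r1],
    by rw [hF.ireg 2 (hI 2 (by simp)), h.r2], by rw [hF.ireg 6 (hI 6 (by simp)), h.r6],
    by rw [hF.ireg 7 (hI 7 (by simp)), h.r7], by rw [hF.freg 0 h0, h.f0]⟩

/-- The parameters of the layer `L` are at the address `off`. -/
structure HasLayer {D : ℕ} (σ : RamState) (off : ℕ) (L : Layer D) : Prop where
  bound : off + 4 * D * D + D ≤ σ.ireg 3
  WQ : ∀ i j : Fin D, σ.fmem (off + 0 * D * D + (i * D + j)) = L.WQ i j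
  WK : ∀ i j : Fin D, σ.fmem (off + 1 * D * D + (i * D + j)) = L.WK i j
  WV : ∀ i j : Fin D, σ.fmem (off + 2 * D * D + (i * D + j)) = L.WV i j
  W : ∀ i j : Fin D, σ.fmem (off + 3 * D * D + (i * D + j)) = L.W i j
  b : ∀ j : Fin D, σ.fmem (off + 4 * D * D + j) = L.b j

theorem HasLayer.fr {D off : ℕ} {L : Layer D} {σ σ' : RamState} {I F A : List ℕ}
    (h : HasLayer σ off L) (hF : Fr I F A σ σ') (h3 : 3 ∉ I) : HasLayer σ' off L := by
  have hb := h.bound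
  have key : ∀ q < 4, ∀ i j : Fin D, off + q * D * D + (i * D + j) < σ.ireg 3 := by
    intro q hq i j
    have h₁ : (i : ℕ) * D + j < D * D := by
      have := row_lt i.2 j.2
      rwa [mul_comm D i] at this
    have h₂ : (q + 1) * D * D ≤ 4 * D * D := by gcongr; omega
    have h₃ : (q + 1) * D * D = q * D * D + D * D := by ring
    omega
  refine ⟨by rw [hF.ireg 3 h3]; exact hb, fun i j => ?_, fun i j => ?_, fun i j => ?_,
    fun i j => ?_, fun j => ?_⟩
  · rw [hF.raw (key 0 (by omega) i j), h.WQ]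
  · rw [hF.raw (key 1 (by omega) i j), h.WK]
  · rw [hF.raw (key 2 (by omega) i j), h.WV]
  · rw [hF.raw (key 3 (by omega) i j), h.W]
  · rw [hF.raw (by omega), h.b]

section Eval
variable {n D : ℕ} {tol : ℝ} {σ : RamState} {X : Matrix (Fin n × Fin n) (Fin D) ℝ}

theorem meanE_eval (hC : Ctx n D tol σ) {α : ℕ} (hX : Holds σ α X) {p : Fin n × Fin n}
    (h4 : σ.ireg 4 = tk p) : (meanE α).eval σ = rowMean (X p) := by
  simp only [meanE, RE.eval, NE.eval, hC.r6, rowMean, Finset.sum_range]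
  congr 1
  refine Finset.sum_congr rfl fun j _ => ?_
  rw [ldA_eval (by simp [hC.r7]), setI_arr _ (by omega), ← hX p j]
  simp [ix, NE.eval, h4, hC.r6]

theorem ldA_ix_eval (hC : Ctx n D tol σ) {α v : ℕ} (hX : Holds σ α X) {p : Fin n × Fin n}
    (h4 : σ.ireg 4 = tk p) {j : Fin D} (h8 : σ.ireg v = j) : (ldA α (ix 4 6 v)).eval σ = X p j := by
  rw [ldA_eval hC.r7, ← hX p j]
  simp [ix, NE.eval, h4, h8, hC.r6]

theorem Ctx.setI (hC : Ctx n D tol σ) {v : ℕ} (hv : v ∉ [0, 1, 2, 6, 7]) (x : ℕ) :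
    Ctx n D tol (σ.setI v x) := by
  simp only [List.mem_cons, List.not_mem_nil, or_false, not_or] at hv
  obtain ⟨h0, h1, h2, h6, h7⟩ := hv
  exact ⟨by simp [Ne.symm h0, hC.r0], by simp [Ne.symm h1, hC.r1], by simp [Ne.symm h2, hC.r2],
    by simp [Ne.symm h6, hC.r6], by simp [Ne.symm h7, hC.r7], hC.f0⟩

theorem Holds.setI {w : ℕ} {X : Matrix (Fin n × Fin n) (Fin w) ℝ} {α : ℕ} (hX : Holds σ α X)
    {v : ℕ} (hv : v ≠ 3) (x : ℕ) :
    Holds (σ.setI v x) α X :=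
  fun p j => by rw [setI_arr _ hv, hX p j]

theorem lnE_eval (hC : Ctx n D tol σ) {α : ℕ} (hX : Holds σ α X) {p : Fin n × Fin n}
    (h4 : σ.ireg 4 = tk p) {j : Fin D} (h8 : σ.ireg 8 = j) :
    (lnE α).eval σ = layerNorm X p j := by
  have hs : ∀ k : Fin D, (RE.mul (.sub (ldA α (ix 4 6 9)) (meanE α))
      (.sub (ldA α (ix 4 6 9)) (meanE α))).eval (σ.setI 9 k) = (X p k - rowMean (X p)) ^ 2 := by
    intro k
    have h4' : (σ.setI 9 k).ireg 4 = tk p := by simpa using h4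
    have hC' := hC.setI (v := 9) (by simp) k
    have hX' := hX.setI (v := 9) (by omega) k
    simp only [RE.eval]
    rw [meanE_eval hC' hX' h4', ldA_ix_eval hC' hX' h4' (j := k) (by simp), sq]
  simp only [lnE, RE.eval] at hs ⊢
  rw [meanE_eval hC hX h4, ldA_ix_eval hC hX h4 h8, layerNorm, rowVar]
  congr 3
  · rw [hC.r6, Finset.sum_range]
    exact Finset.sum_congr rfl fun k _ => hs k
  · simp [NE.eval, hC.r6]

theorem mmE_eval (hC : Ctx n D tol σ) {α q off : ℕ} (hX : Holds σ α X) {p : Fin n × Fin n}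
    (h4 : σ.ireg 4 = tk p) {j : Fin D} (h8 : σ.ireg 8 = j) (h20 : σ.ireg 20 = off)
    {W : Matrix (Fin D) (Fin D) ℝ}
    (hW : ∀ i j : Fin D, σ.fmem (off + q * D * D + (i * D + j)) = W i j) :
    (mmE α q).eval σ = (X * W) p j := by
  simp only [mmE, RE.eval, hC.r6, Finset.sum_range, Matrix.mul_apply]
  refine Finset.sum_congr rfl fun k _ => ?_
  rw [ldA_ix_eval (hC.setI (by simp) _) (hX.setI (by omega) _) (p := p) (j := k) (by simpa using h4)
    (by simp), ← hW k j]
  simp [parE, ix, NE.eval, h20, hC.r6, h8]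

end Eval

section Degree
variable {n D S : ℕ} {tol : ℝ} {σ : RamState}

/-- Both bounds matter: that the result dominates the entries controls the Taylor remainder, and
that it exceeds no other bound allows a comparison with `ρ`, which the program does not know. -/
theorem Wp.maxC {v α : ℕ} {X : Matrix (Fin n × Fin n) (Fin D) ℝ} (hv : v < 8) (hv0 : v ≠ 0)
    (hα : α < 16) (hC : Ctx n D tol σ) (hX : Holds σ α X) :
    Wp (n * n) S (maxC v α) σ fun σ' => Fr [4, 8] [v] [] σ σ' ∧ 0 ≤ σ'.freg v ∧
      EntriesLE X (σ'.freg v) ∧ ∀ ρ, 0 ≤ ρ → EntriesLE X ρ → σ'.freg v ≤ ρ := by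
  have hok : (ldA α (ix 4 6 8)).ok = true := rfl
  have hokv : (RE.var v).ok = true := by simpa [RE.ok] using hv
  have hoks : (RE.sqrt (.mul (ldA α (ix 4 6 8)) (ldA α (ix 4 6 8)))).ok = true := rfl
  have hval : ∀ σ', Fr [4, 8] [v] [] σ σ' → ∀ (p : Fin n × Fin n) (j : Fin D),
      σ'.ireg 4 = tk p → σ'.ireg 8 = j →
      (RE.sqrt (.mul (ldA α (ix 4 6 8)) (ldA α (ix 4 6 8)))).eval σ' = |X p j| := by
    intro σ' hF p j h4 h8
    have hC' : Ctx n D tol σ' := hC.fr hF (by simp) (by simpa using hv0.symm)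
    simp only [RE.eval]
    rw [ldA_ix_eval hC' (hX.fr hF (by simp) hα (by simp)) h4 h8, Real.sqrt_mul_self_eq_abs]
  refine Wp.seq (Wp.fset hv rfl ?_)
  have h2 : NE.eval (σ.setF v (RE.eval (.const 0) σ)) (.var 2) = n * n := hC.r2
  refine Wp.forC (fun i σ' => Fr [4, 8] [v] [] σ σ' ∧ 0 ≤ σ'.freg v ∧
      (∀ (p : Fin n × Fin n) j, tk p < i → |X p j| ≤ σ'.freg v) ∧
      ∀ ρ, 0 ≤ ρ → EntriesLE X ρ → σ'.freg v ≤ ρ) (by omega) (by omega) rfl (fun _ => rfl)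
    (fun _ => by rw [h2]; simp)
    ⟨(Fr.refl _ _ _ _).setF (by simp) _, by simp [RE.eval], by simp, fun ρ hρ _ => by
      simpa [RE.eval] using hρ⟩ ?_ ?_
  · rintro i hi σ₁ ⟨f₁, g₁, a₁, b₁⟩
    rw [h2] at hi
    obtain ⟨p, rfl⟩ := exists_tk hi
    have h6 : NE.eval (σ₁.setI 4 (tk p)) (.var 6) = D := by
      simp [NE.eval, f₁.ireg 6 (by simp), hC.r6]
    refine Wp.forC (fun j σ' => Fr [4, 8] [v] [] σ σ' ∧ σ'.ireg 4 = tk p ∧ 0 ≤ σ'.freg v ∧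
      (∀ (q : Fin n × Fin n) (l : Fin D), tk q < tk p ∨ q = p ∧ l < j → |X q l| ≤ σ'.freg v) ∧
      ∀ ρ, 0 ≤ ρ → EntriesLE X ρ → σ'.freg v ≤ ρ) (by omega) (by omega) rfl (by simp)
      (fun hs => by simpa [NE.eval] using hs.1 6 rfl)
      ⟨f₁.setI (by simp) _, by simp, g₁, fun q l h => a₁ q l (by simpa using h), b₁⟩ ?_ ?_
    · rintro j hj σ₂ ⟨f₂, k₂, g₂, a₂, b₂⟩
      rw [h6] at hj
      have f₃ : Fr [4, 8] [v] [] σ (σ₂.setI 8 j) := f₂.setI (by simp) j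
      have hv₃ := hval _ f₃ p ⟨j, hj⟩ (by simpa using k₂) (by simp)
      have cases : ∀ (q : Fin n × Fin n) (l : Fin D), tk q < tk p ∨ q = p ∧ (l : ℕ) < j + 1 →
          (tk q < tk p ∨ q = p ∧ (l : ℕ) < j) ∨ q = p ∧ l = ⟨j, hj⟩ := by
        rintro q l (h | ⟨h, h'⟩)
        · exact .inl (.inl h)
        · by_cases hl : (l : ℕ) < j
          · exact .inl (.inr ⟨h, hl⟩)
          · exact .inr ⟨h, Fin.ext (by simp; omega)⟩
      refine Wp.ifF hokv hoks (fun hlt => Wp.fset hv hoks ?_) (fun hle => ?_)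
      · rw [hv₃] at hlt ⊢
        simp only [RE.eval] at hlt
        refine ⟨f₃.setF (by simp) _, by simpa using k₂, by simp, fun q l h => ?_,
          fun ρ _ hX => by simpa using hX p ⟨j, hj⟩⟩
        rcases cases q l h with h | ⟨rfl, rfl⟩
        · simpa using (a₂ q l h).trans hlt.le
        · simp
      · rw [hv₃] at hle
        simp only [RE.eval] at hle
        refine ⟨f₃, by simpa using k₂, g₂, fun q l h => ?_, b₂⟩
        rcases cases q l h with h | ⟨rfl, rfl⟩
        · exact a₂ q l h
        · exact hle
    · rintro σ₂ _ ⟨f₂, k₂, g₂, a₂, b₂⟩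
      rw [h6] at a₂
      refine ⟨f₂, g₂, fun q l h => a₂ q l ?_, b₂⟩
      rcases Nat.lt_succ_iff_lt_or_eq.1 h with h | h
      · exact .inl h
      · exact .inr ⟨tk_injective h, l.2⟩
  · rintro σ₁ _ ⟨f₁, g₁, a₁, b₁⟩
    rw [h2] at a₁
    exact ⟨f₁, g₁, fun p j => a₁ p j (tk_lt p), b₁⟩

/-- The search uses only the measured bound `B`. Since `B ≤ ρ * ρ`, it stops at `j₀` at the latest.
The loop has no exit: passes after success change nothing, and `n` passes suffice because `j₀ < n`.
-/
theorem Wp.degC {Q K : Matrix (Fin n × Fin n) (Fin D) ℝ} (hC : Ctx n D tol σ)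
    (hQ : Holds σ 3 Q) (hK : Holds σ 4 K) {ρ : ℝ} (hρ : 0 ≤ ρ) (hQρ : EntriesLE Q ρ)
    (hKρ : EntriesLE K ρ) {j₀ : ℕ} (hn : j₀ < n) (hS : j₀ ≤ S)
    (hj : (ρ * ρ) ^ (j₀ + 1) / ((j₀ + 1).factorial : ℝ) ≤ tol) :
    Wp (n * n) S degC σ fun σ' => Fr [4, 5, 8, 11] [3, 4, 5, 6] [] σ σ' ∧ σ'.ireg 11 ≤ j₀ ∧
      ∃ bQ bK, 0 ≤ bQ ∧ 0 ≤ bK ∧ EntriesLE Q bQ ∧ EntriesLE K bK ∧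
        (bQ * bK) ^ (σ'.ireg 11 + 1) / ((σ'.ireg 11 + 1).factorial : ℝ) ≤ tol := by
  refine Wp.seq ((Wp.maxC (by omega) (by omega) (by omega) hC hQ).mono ?_)
  rintro σ₁ _ ⟨f₁, g₁, a₁, b₁⟩
  have hC₁ := hC.fr f₁ (by simp) (by simp)
  refine Wp.seq ((Wp.maxC (by omega) (by omega) (by omega) hC₁
    (hK.fr f₁ (by simp) (by omega) (by simp))).mono ?_)
  rintro σ₂ _ ⟨f₂, g₂, a₂, b₂⟩
  have hC₂ := hC₁.fr f₂ (by simp) (by simp)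
  have h3 : σ₂.freg 3 = σ₁.freg 3 := f₂.freg 3 (by simp)
  rw [← h3] at g₁ a₁ b₁
  have F₂ : Fr [4, 5, 8, 11] [3, 4, 5, 6] [] σ σ₂ :=
    (f₁.mono (by simp) (by simp) (by simp)).trans (by simp) (f₂.mono (by simp) (by simp) (by simp))
  set B := σ₂.freg 3 * σ₂.freg 4 with hB
  have hB0 : 0 ≤ B := mul_nonneg g₁ g₂
  have hBρ : B ≤ ρ * ρ := mul_le_mul (b₁ ρ hρ hQρ) (b₂ ρ hρ hKρ) g₂ hρ
  refine Wp.seq (Wp.fset (by omega) rfl (Wp.seq (Wp.fset (by omega) rfl (Wp.seq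
    (Wp.iset (by omega) rfl (fun _ _ => by simp [NE.eval]) (by simp) ?_)))))
  refine Wp.forC (fun j σ' => Fr [4, 5, 8, 11] [3, 4, 5, 6] [] σ₂ σ' ∧ σ'.freg 6 = B ∧
      σ'.ireg 11 ≤ j₀ ∧
      σ'.freg 5 = B ^ (σ'.ireg 11 + 1) / ((σ'.ireg 11 + 1).factorial : ℝ) ∧
      (σ'.freg 5 ≤ tol ∨ σ'.ireg 11 = j)) (by omega) (by omega) rfl (fun _ => rfl)
      (fun _ => ?_) ⟨?_, ?_, ?_, ?_, ?_⟩ ?_ ?_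
  · simpa [NE.eval, hC₂.r0] using Nat.le_mul_self n
  · exact (((Fr.refl _ _ _ _).setF (by simp) _).setF (by simp) _).setI (by simp) _
  · simp [RE.eval, hB]
  · simp [NE.eval]
  · simp [RE.eval, NE.eval, hB]
  · simp [NE.eval]
  · rintro j hj' σ₃ ⟨f₃, e₆, l₃, e₅, o₃⟩
    have f₄ : Fr [4, 5, 8, 11] [3, 4, 5, 6] [] σ₂ (σ₃.setI 5 j) := f₃.setI (by simp) j
    have h0 : RE.eval (.var 0) (σ₃.setI 5 j) = tol := by
      simp [RE.eval, f₃.freg 0 (by simp), hC₂.f0]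
    have h5 : RE.eval (.var 5) (σ₃.setI 5 j) = σ₃.freg 5 := rfl
    refine Wp.ifF rfl rfl (fun hlt => ?_) (fun hle => ?_)
    · rw [h0, h5] at hlt
      have hgj : σ₃.ireg 11 = j := o₃.resolve_left (not_le.2 hlt)
      -- At degree `j₀` the term is already within the tolerance, by `B ≤ ρ * ρ`; a pass that still
      -- advances must start below `j₀`.
      have hg : σ₃.ireg 11 < j₀ := by
        refine lt_of_le_of_ne l₃ fun h => ?_
        rw [e₅, h] at hlt
        refine absurd (hj.trans_lt hlt) (not_lt.2 ?_)
        gcongr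
      refine Wp.seq (Wp.fset (by omega) rfl (Wp.iset (by omega) rfl (fun _ _ => ?_) (by simp)
        ⟨(f₄.setF (by simp) _).setI (by simp) _, by simpa using e₆, ?_, ?_, ?_⟩))
      · simp [NE.eval]; omega
      · simp [NE.eval]; omega
      · simp [NE.eval, RE.eval, e₅, e₆, Nat.factorial_succ (σ₃.ireg 11 + 1)]
        rw [pow_succ _ (σ₃.ireg 11 + 1)]
        field_simp
        ring
      · right; simp [NE.eval, hgj]
    · rw [h0, h5] at hle
      exact ⟨f₄, e₆, l₃, e₅, .inl hle⟩
  · rintro σ₃ _ ⟨f₃, e₆, l₃, e₅, o₃⟩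
    refine ⟨F₂.trans (by simp) f₃, l₃, σ₂.freg 3, σ₂.freg 4, g₁, g₂, a₁, a₂, ?_⟩
    rw [← hB, ← e₅]
    -- Advancing in each of the `n` passes would make the degree equal to `n > j₀`.
    refine o₃.resolve_right fun h => ?_
    simp [NE.eval, hC₂.r0] at h
    omega

end Degree

/-! ## The approximate layer -/

section Approx
variable {N : Type} [Fintype N] [DecidableEq N] {D : ℕ}

/-- Attention with the exponential function replaced by its Taylor polynomial of degree `G`. -/
noncomputable def apxAttn (G : ℕ) (L : Layer D) (X : Matrix N (Fin D) ℝ) : Matrix N (Fin D) ℝ :=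
  fun p e => (∑ q, expT G (((X * L.WQ) * (X * L.WK).transpose) p q / (D : ℝ)) * (X * L.WV) q e) /
    ∑ q, expT G (((X * L.WQ) * (X * L.WK).transpose) p q / (D : ℝ))

/-- The attention block with approximate attention. -/
noncomputable def apxMid (G : ℕ) (L : Layer D) (X : Matrix N (Fin D) ℝ) : Matrix N (Fin D) ℝ :=
  apxAttn G L (layerNorm X) + X

/-- The transformer layer with approximate attention. -/
noncomputable def apxOut (G : ℕ) (L : Layer D) (X : Matrix N (Fin D) ℝ) : Matrix N (Fin D) ℝ :=
  mlp L (layerNorm (apxMid G L X)) + apxMid G L X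

/-- The degree `G` is large enough for the tolerance `tol` at the normalized input `U`. -/
def DegOK (G : ℕ) (tol : ℝ) (L : Layer D) (U : Matrix N (Fin D) ℝ) : Prop :=
  ∃ bQ bK, 0 ≤ bQ ∧ 0 ≤ bK ∧ EntriesLE (U * L.WQ) bQ ∧ EntriesLE (U * L.WK) bK ∧
    (bQ * bK) ^ (G + 1) / ((G + 1).factorial : ℝ) ≤ tol

end Approx

/-- No approximation enters here: the program computes the layer with Taylor attention exactly, in
real arithmetic. The degree is existential because it is found at run time, and `ρ` and `j₀` serve
only to bound it and the number of features. -/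
theorem Wp.layerC {n D S : ℕ} {tol : ℝ} {σ : RamState} {L : Layer D}
    {X : Matrix (Fin n × Fin n) (Fin D) ℝ} (hC : Ctx n D tol σ) (hX : Holds σ 1 X)
    (hL : HasLayer σ (σ.ireg 20) L) {ρ : ℝ} (hρ : 0 ≤ ρ)
    (hQρ : EntriesLE (layerNorm X * L.WQ) ρ) (hKρ : EntriesLE (layerNorm X * L.WK) ρ)
    {j₀ : ℕ} (hn : j₀ < n) (hS : j₀ ≤ S)
    (hj : (ρ * ρ) ^ (j₀ + 1) / ((j₀ + 1).factorial : ℝ) ≤ tol) (hch : (D + j₀).choose j₀ ≤ S) :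
    Wp (n * n) S layerC σ fun σ' =>
      Fr [4, 5, 8, 11, 12, 13, 14, 15, 16, 17, 20] [3, 4, 5, 6] [1, 2, 3, 4, 5, 6, 7, 8, 9, 10]
        σ σ' ∧
      σ'.ireg 20 = σ.ireg 20 + 4 * D * D + D ∧
      ∃ G, DegOK G tol L (layerNorm X) ∧ Holds σ' 1 (apxOut G L X) := by
  refine Wp.seq ((Wp.fillTok (layerNorm X) (by omega) hC.r7 hC.r2 hC.r6 (by omega) rfl
    fun p j σ' hF h4 h8 => lnE_eval (hC.fr hF (by simp) (by simp))
      (hX.fr hF (by simp) (by omega) (by simp)) h4 h8).mono ?_)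
  rintro σ₁ _ ⟨f₁, U₁⟩
  have hC₁ := hC.fr f₁ (by simp) (by simp)
  have hX₁ := hX.fr f₁ (by simp) (by omega) (by simp)
  have hL₁ := hL.fr f₁ (by simp)
  refine Wp.seq ((Wp.fillTok (layerNorm X * L.WQ) (by omega) hC₁.r7 hC₁.r2 hC₁.r6 (by omega) rfl
    fun p j σ' hF h4 h8 => mmE_eval (hC₁.fr hF (by simp) (by simp))
      (U₁.fr hF (by simp) (by omega) (by simp)) h4 h8
      ((hF.ireg 20 (by simp)).trans (f₁.ireg 20 (by simp))) (hL₁.fr hF (by simp)).WQ).mono ?_)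
  rintro σ₂ _ ⟨f₂, Q₂⟩
  have hC₂ := hC₁.fr f₂ (by simp) (by simp)
  have hX₂ := hX₁.fr f₂ (by simp) (by omega) (by simp)
  have hL₂ := hL₁.fr f₂ (by simp)
  have U₂ := U₁.fr f₂ (by simp) (by omega) (by simp)
  refine Wp.seq ((Wp.fillTok (layerNorm X * L.WK) (by omega) hC₂.r7 hC₂.r2 hC₂.r6 (by omega) rfl
    fun p j σ' hF h4 h8 => mmE_eval (hC₂.fr hF (by simp) (by simp))
      (U₂.fr hF (by simp) (by omega) (by simp)) h4 h8
      ((hF.ireg 20 (by simp)).trans ((f₂.ireg 20 (by simp)).trans (f₁.ireg 20 (by simp))))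
      (hL₂.fr hF (by simp)).WK).mono ?_)
  rintro σ₃ _ ⟨f₃, K₃⟩
  have hC₃ := hC₂.fr f₃ (by simp) (by simp)
  have hX₃ := hX₂.fr f₃ (by simp) (by omega) (by simp)
  have hL₃ := hL₂.fr f₃ (by simp)
  have U₃ := U₂.fr f₃ (by simp) (by omega) (by simp)
  have Q₃ := Q₂.fr f₃ (by simp) (by omega) (by simp)
  refine Wp.seq ((Wp.fillTok (layerNorm X * L.WV) (by omega) hC₃.r7 hC₃.r2 hC₃.r6 (by omega) rfl
    fun p j σ' hF h4 h8 => mmE_eval (hC₃.fr hF (by simp) (by simp))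
      (U₃.fr hF (by simp) (by omega) (by simp)) h4 h8
      ((hF.ireg 20 (by simp)).trans ((f₃.ireg 20 (by simp)).trans ((f₂.ireg 20 (by simp)).trans
        (f₁.ireg 20 (by simp))))) (hL₃.fr hF (by simp)).WV).mono ?_)
  rintro σ₄ _ ⟨f₄, V₄⟩
  have hC₄ := hC₃.fr f₄ (by simp) (by simp)
  have hX₄ := hX₃.fr f₄ (by simp) (by omega) (by simp)
  have hL₄ := hL₃.fr f₄ (by simp)
  have Q₄ := Q₃.fr f₄ (by simp) (by omega) (by simp)
  have K₄ := K₃.fr f₄ (by simp) (by omega) (by simp)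
  have F₄ : Fr [4, 5, 8, 11, 12, 13, 14, 15, 16, 17, 20] [3, 4, 5, 6]
      [1, 2, 3, 4, 5, 6, 7, 8, 9, 10] σ σ₄ :=
    (((f₁.mono (by simp) (by simp) (by simp)).trans (by simp)
      (f₂.mono (by simp) (by simp) (by simp))).trans (by simp)
      (f₃.mono (by simp) (by simp) (by simp))).trans (by simp)
      (f₄.mono (by simp) (by simp) (by simp))
  refine Wp.seq ((Wp.degC hC₄ Q₄ K₄ hρ hQρ hKρ hn hS hj).mono ?_)
  rintro σ₅ _ ⟨f₅, hG, hdeg⟩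
  have hC₅ := hC₄.fr f₅ (by simp) (by simp)
  have hX₅ := hX₄.fr f₅ (by simp) (by omega) (by simp)
  have hL₅ := hL₄.fr f₅ (by simp)
  have Q₅ := Q₄.fr f₅ (by simp) (by omega) (by simp)
  have K₅ := K₄.fr f₅ (by simp) (by omega) (by simp)
  have V₅ := V₄.fr f₅ (by simp) (by omega) (by simp)
  have F₅ := F₄.trans (by simp) (f₅.mono (by simp) (by simp) (by simp))
  obtain ⟨G, hGe⟩ : ∃ G, σ₅.ireg 11 = G := ⟨_, rfl⟩
  rw [hGe] at hG hdeg
  have hchG : (D + G).choose G ≤ S := by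
    refine le_trans ?_ hch
    rw [← Nat.choose_symm_add, ← Nat.choose_symm_add]
    exact Nat.choose_le_choose D (by omega)
  refine Wp.seq ((Wp.featC hC₅.r7 hC₅.r6 hGe hchG).mono ?_)
  rintro σ₆ _ ⟨f₆, hfeat⟩
  have hC₆ := hC₅.fr f₆ (by simp) (by simp)
  have hX₆ := hX₅.fr f₆ (by simp) (by omega) (by simp)
  have hL₆ := hL₅.fr f₆ (by simp)
  have V₆ := V₅.fr f₆ (by simp) (by omega) (by simp)
  have F₆ := F₅.trans (by simp) (f₆.mono (by simp) (by simp) (by simp))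
  obtain ⟨M, hM⟩ : ∃ M, σ₆.ireg 12 = M := ⟨_, rfl⟩
  -- The factorization of the Taylor kernel through `M` features.
  have hker : ∀ p q : Fin n × Fin n, ∑ c ∈ Finset.range M,
      σ₆.arr 6 (n * n * c + tk p) * σ₆.arr 7 (n * n * c + tk q) =
      expT G (((layerNorm X * L.WQ) * (layerNorm X * L.WK).transpose) p q / (D : ℝ)) := by
    intro p q
    have h := hfeat (tk p) (by rw [hC₅.r2]; exact tk_lt p) (tk q) (by rw [hC₅.r2]; exact tk_lt q)
    simp only [nodeVal, coordProd, hC₆.r2, hC₅.r6, hM] at h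
    rw [h, Finset.sum_range, Matrix.mul_apply, Finset.sum_div]
    congr 1
    refine Finset.sum_congr rfl fun l _ => ?_
    rw [Q₅ p l, K₅ q l, Matrix.transpose_apply]
  clear hfeat
  refine Wp.seq ((Wp.fill₂ (fun c j => ∑ q : Fin n × Fin n, σ₆.arr 7 (n * n * c + tk q) *
    σ₆.arr 5 (tk q * D + j)) (by omega) hC₆.r7 (by omega) (by omega) (by omega) (by simp)
    (fun hs => hs.1 12 rfl) (by omega) rfl (by omega) (by omega) (by omega) (by omega) (by omega)
    rfl ?_).mono ?_)
  · intro c hc j hj' σ' hs h14 h8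
    have hF := hs.toFr subset_rfl
    have hC' : Ctx n D tol σ' := hC₆.fr hF (by simp) (by simp)
    simp only [RE.eval, hC'.r2, sum_tk]
    refine Finset.sum_congr rfl fun q _ => ?_
    rw [rowE, ldA_eval (by simp [hC'.r7]), ldA_eval (by simp [hC'.r7]), setI_arr _ (by omega),
      setI_arr _ (by omega), hF.arr (β := 7) (by simp) (by omega) (by simp),
      hF.arr (β := 5) (by simp) (by omega) (by simp)]
    simp [ix, NE.eval, hC'.r2, hC'.r6, h14, h8]
  rintro σ₇ _ ⟨s₇, S₇⟩
  have f₇ := s₇.toFr subset_rfl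
  have hC₇ := hC₆.fr f₇ (by simp) (by simp)
  have hX₇ := hX₆.fr f₇ (by simp) (by omega) (by simp)
  have hL₇ := hL₆.fr f₇ (by simp)
  have F₇ := F₆.trans (by simp) (f₇.mono (by simp) (by simp) (by simp))
  have hM₇ : σ₇.ireg 12 = M := by rw [f₇.ireg 12 (by simp), hM]
  refine Wp.seq ((Wp.fill₂ (fun c _ => ∑ q : Fin n × Fin n, σ₆.arr 7 (n * n * c + tk q))
    (by omega) hC₇.r7 (by omega) (by omega) (by omega) (by simp)
    (fun hs => hs.1 12 rfl) (by omega) rfl (by omega) (by omega) (by omega) (by omega) (by omega)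
    rfl ?_).mono ?_)
  · intro c hc j hj' σ' hs h14 h8
    have hF := hs.toFr subset_rfl
    have hC' : Ctx n D tol σ' := hC₇.fr hF (by simp) (by simp)
    simp only [RE.eval, hC'.r2, sum_tk]
    refine Finset.sum_congr rfl fun q _ => ?_
    rw [rowE, ldA_eval (by simp [hC'.r7]), setI_arr _ (by omega),
      hF.arr (β := 7) (by simp) (by omega) (by simp),
      f₇.arr (β := 7) (by simp) (by omega) (by simp)]
    simp [NE.eval, hC'.r2, h14]
  rintro σ₈ _ ⟨s₈, S₈⟩
  have f₈ := s₈.toFr subset_rfl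
  have hC₈ := hC₇.fr f₈ (by simp) (by simp)
  have hX₈ := hX₇.fr f₈ (by simp) (by omega) (by simp)
  have hL₈ := hL₇.fr f₈ (by simp)
  have F₈ := F₇.trans (by simp) (f₈.mono (by simp) (by simp) (by simp))
  have hM₈ : σ₈.ireg 12 = M := by rw [f₈.ireg 12 (by simp), hM₇]
  rw [hM, hC₆.r6] at S₇
  rw [hM₇, hC₇.r6] at S₈
  refine Wp.seq ((Wp.fillTok (apxMid G L X) (by omega) hC₈.r7 hC₈.r2 hC₈.r6 (by omega) rfl
    ?_).mono ?_)
  · intro p j σ' hF h4 h8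
    have hC' : Ctx n D tol σ' := hC₈.fr hF (by simp) (by simp)
    simp only [RE.eval]
    rw [ldA_ix_eval hC' (hX₈.fr hF (by simp) (by omega) (by simp)) h4 h8, hF.ireg 12 (by simp),
      hM₈, apxMid, Matrix.add_apply, apxAttn]
    have e₆ : ∀ c < M, (rowE 6 9).eval (σ'.setI 9 c) = σ₆.arr 6 (n * n * c + tk p) := by
      intro c _
      rw [rowE, ldA_eval (by simp [hC'.r7]), setI_arr _ (by omega),
        hF.arr (β := 6) (by simp) (by omega) (by simp),
        f₈.arr (β := 6) (by simp) (by omega) (by simp),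
        f₇.arr (β := 6) (by simp) (by omega) (by simp)]
      simp [NE.eval, hC'.r2, h4]
    have e₈ : ∀ c < M, (ldA 8 (ix 9 6 8)).eval (σ'.setI 9 c) =
        ∑ q : Fin n × Fin n, σ₆.arr 7 (n * n * c + tk q) * (layerNorm X * L.WV) q j := by
      intro c hc
      rw [ldA_eval (by simp [hC'.r7]), setI_arr _ (by omega),
        hF.arr (β := 8) (by simp) (by omega) (by simp),
        f₈.arr (β := 8) (by simp) (by omega) (by simp),
        show (ix 9 6 8).eval (σ'.setI 9 c) = c * D + j by simp [ix, NE.eval, hC'.r6, h8],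
        S₇ c hc j j.2]
      exact Finset.sum_congr rfl fun q _ => by rw [V₆ q j]
    have e₉ : ∀ c < M, (ldA 9 (ix 9 6 8)).eval (σ'.setI 9 c) =
        ∑ q : Fin n × Fin n, σ₆.arr 7 (n * n * c + tk q) := by
      intro c hc
      rw [ldA_eval (by simp [hC'.r7]), setI_arr _ (by omega),
        hF.arr (β := 9) (by simp) (by omega) (by simp),
        show (ix 9 6 8).eval (σ'.setI 9 c) = c * D + j by simp [ix, NE.eval, hC'.r6, h8],
        S₈ c hc j j.2]
    congr 2
    -- Exchanging the sums over features and tokens turns the factored numerator back into the one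
    -- in `apxAttn`; the denominator is treated in the same way.
    · rw [Finset.sum_congr rfl fun c hc => by
        rw [e₆ c (Finset.mem_range.1 hc), e₈ c (Finset.mem_range.1 hc), Finset.mul_sum],
        Finset.sum_comm]
      refine Finset.sum_congr rfl fun q _ => ?_
      rw [← hker p q, Finset.sum_mul]
      exact Finset.sum_congr rfl fun c _ => (mul_assoc _ _ _).symm
    · rw [Finset.sum_congr rfl fun c hc => by
        rw [e₆ c (Finset.mem_range.1 hc), e₉ c (Finset.mem_range.1 hc), Finset.mul_sum],
        Finset.sum_comm]
      exact Finset.sum_congr rfl fun q _ => hker p q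
  rintro σ₉ _ ⟨f₉, Y₉⟩
  have hC₉ := hC₈.fr f₉ (by simp) (by simp)
  have hL₉ := hL₈.fr f₉ (by simp)
  have F₉ := F₈.trans (by simp) (f₉.mono (by simp) (by simp) (by simp))
  refine Wp.seq ((Wp.fillTok (layerNorm (apxMid G L X)) (by omega) hC₉.r7 hC₉.r2 hC₉.r6 (by omega)
    rfl fun p j σ' hF h4 h8 => lnE_eval (hC₉.fr hF (by simp) (by simp))
      (Y₉.fr hF (by simp) (by omega) (by simp)) h4 h8).mono ?_)
  rintro σ₁₀ _ ⟨f₁₀, U₁₀⟩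
  have hC₁₀ := hC₉.fr f₁₀ (by simp) (by simp)
  have hL₁₀ := hL₉.fr f₁₀ (by simp)
  have Y₁₀ := Y₉.fr f₁₀ (by simp) (by omega) (by simp)
  have F₁₀ := F₉.trans (by simp) (f₁₀.mono (by simp) (by simp) (by simp))
  have h20 : σ₁₀.ireg 20 = σ.ireg 20 := by
    rw [f₁₀.ireg 20 (by simp), f₉.ireg 20 (by simp), f₈.ireg 20 (by simp), f₇.ireg 20 (by simp),
      f₆.ireg 20 (by simp), f₅.ireg 20 (by simp), f₄.ireg 20 (by simp), f₃.ireg 20 (by simp),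
      f₂.ireg 20 (by simp), f₁.ireg 20 (by simp)]
  refine Wp.seq ((Wp.fillTok (apxOut G L X) (by omega) hC₁₀.r7 hC₁₀.r2 hC₁₀.r6 (by omega) rfl
    ?_).mono ?_)
  · intro p j σ' hF h4 h8
    have hC' : Ctx n D tol σ' := hC₁₀.fr hF (by simp) (by simp)
    have hL' := hL₁₀.fr hF (by simp)
    have h20' : σ'.ireg 20 = σ.ireg 20 := by rw [hF.ireg 20 (by simp), h20]
    have U' := U₁₀.fr hF (by simp) (by omega) (by simp)
    simp only [RE.eval]
    rw [ldA_ix_eval hC' (Y₁₀.fr hF (by simp) (by omega) (by simp)) h4 h8, hC'.r6, Finset.sum_range,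
      apxOut, Matrix.add_apply, mlp, Pi.add_apply, Matrix.mulVec, dotProduct]
    congr 2
    · refine Finset.sum_congr rfl fun k _ => ?_
      rw [ldA_ix_eval (hC'.setI (by simp) _) (U'.setI (by omega) _) (p := p) (j := k)
        (by simpa using h4) (by simp), ← hL'.W j k]
      simp [parE, ix, NE.eval, h20', hC'.r6, h8]
    · rw [← hL'.b j]
      simp [parE, NE.eval, h20', hC'.r6, h8]
  rintro σ₁₁ _ ⟨f₁₁, X₁₁⟩
  have F₁₁ := F₁₀.trans (by simp) (f₁₁.mono (by simp) (by simp) (by simp))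
  have h6 : σ₁₁.ireg 6 = D := by rw [f₁₁.ireg 6 (by simp), hC₁₀.r6]
  have h20' : σ₁₁.ireg 20 = σ.ireg 20 := by rw [f₁₁.ireg 20 (by simp), h20]
  refine Wp.iset (by omega) rfl (fun _ h => by simp [sm] at h) (by simp)
    ⟨F₁₁.setI (by simp) _, ?_, G, hdeg, X₁₁.setI (by omega) _⟩
  simp [parE, NE.eval, h6, h20']

/-! ## Error analysis of a layer -/

/-- Since `(r + 1)! * k!` divides `(r + 1 + k)!`, the tail is dominated termwise by `|x| ^ (r + 1) /
(r + 1)!` times the exponential series of `|x|`. -/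
theorem abs_expT_sub_exp_le (r : ℕ) (x : ℝ) :
    |expT r x - Real.exp x| ≤ |x| ^ (r + 1) / ((r + 1).factorial : ℝ) * Real.exp |x| := by
  have hs := Real.summable_pow_div_factorial x
  have hexp : ∀ y : ℝ, Real.exp y = ∑' k : ℕ, y ^ k / (k.factorial : ℝ) := fun y => by
    rw [Real.exp_eq_exp_ℝ, NormedSpace.exp_eq_tsum_div]
  have h₁ : Real.exp x - expT r x =
      ∑' k : ℕ, x ^ (k + (r + 1)) / ((k + (r + 1)).factorial : ℝ) := by
    rw [hexp, ← hs.sum_add_tsum_nat_add (r + 1), expT]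
    ring
  have hle : ∀ k : ℕ, |x ^ (k + (r + 1)) / ((k + (r + 1)).factorial : ℝ)| ≤
      |x| ^ (r + 1) / ((r + 1).factorial : ℝ) * (|x| ^ k / (k.factorial : ℝ)) := by
    intro k
    rw [abs_div, abs_pow, Nat.abs_cast, div_mul_div_comm, ← pow_add, add_comm k]
    refine div_le_div_of_nonneg_left (by positivity) (by positivity) ?_
    exact_mod_cast Nat.le_of_dvd (Nat.factorial_pos _) (Nat.factorial_mul_factorial_dvd_factorial_add
      (r + 1) k)
  have hs' : Summable fun k : ℕ =>
      |x| ^ (r + 1) / ((r + 1).factorial : ℝ) * (|x| ^ k / (k.factorial : ℝ)) :=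
    (Real.summable_pow_div_factorial |x|).mul_left _
  rw [abs_sub_comm, h₁, hexp, ← tsum_mul_left]
  have hn : Summable fun k : ℕ => ‖x ^ (k + (r + 1)) / ((k + (r + 1)).factorial : ℝ)‖ :=
    Summable.of_nonneg_of_le (fun _ => norm_nonneg _) hle hs'
  exact (norm_tsum_le_tsum_norm hn).trans (hn.tsum_le_tsum hle hs')

/-- Let `m` be the exact mean. As `∑ a (v - m) = 0`, the difference of the means is `∑ (a' (v' - v)
+ (a' - a) (v - m)) / ∑ a'`. The first part is at most `ν`. In the second, `|v - m| ≤ 2 r` and `∑ a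
≤ 2 ∑ a'`, which gives `4 κ r`. Because the weight errors are relative, the number of terms plays no
role. -/
theorem weighted_mean_error {ι : Type} [Fintype ι] [Nonempty ι] {a a' v v' : ι → ℝ} {κ ν r : ℝ}
    (ha : ∀ j, 0 < a j) (ha' : ∀ j, |a' j - a j| ≤ κ * a j) (hκ : κ ≤ 1 / 2)
    (hv : ∀ j, |v j| ≤ r) (hv' : ∀ j, |v' j - v j| ≤ ν) :
    |(∑ j, a' j * v' j) / (∑ j, a' j) - (∑ j, a j * v j) / ∑ j, a j| ≤ ν + 4 * κ * r := by
  have hpos : ∀ j, a j / 2 ≤ a' j := by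
    intro j
    have h₁ := (abs_le.1 (ha' j)).1
    have h₂ : κ * a j ≤ 1 / 2 * a j := mul_le_mul_of_nonneg_right hκ (ha j).le
    linarith
  have hA : 0 < ∑ j, a j := Finset.sum_pos (fun j _ => ha j) Finset.univ_nonempty
  have hA' : (∑ j, a j) / 2 ≤ ∑ j, a' j := by
    rw [Finset.sum_div]
    exact Finset.sum_le_sum fun j _ => hpos j
  have hA'0 : 0 < ∑ j, a' j := by linarith
  obtain ⟨j₀⟩ := ‹Nonempty ι›
  have hr : 0 ≤ r := (abs_nonneg _).trans (hv j₀)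
  have hκ0 : 0 ≤ κ := by
    by_contra h
    have := (abs_nonneg _).trans (ha' j₀)
    nlinarith [ha j₀]
  set m := (∑ j, a j * v j) / ∑ j, a j with hm
  have hmr : |m| ≤ r := by
    rw [hm, abs_div, abs_of_pos hA, div_le_iff₀ hA]
    calc |∑ j, a j * v j| ≤ ∑ j, |a j * v j| := Finset.abs_sum_le_sum_abs _ _
      _ ≤ ∑ j, r * a j := Finset.sum_le_sum fun j _ => by
          rw [abs_mul, abs_of_pos (ha j), mul_comm]
          exact mul_le_mul_of_nonneg_right (hv j) (ha j).le
      _ = r * ∑ j, a j := by rw [Finset.mul_sum]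
  have h0 : ∑ j, a j * (v j - m) = 0 := by
    simp only [mul_sub, Finset.sum_sub_distrib, ← Finset.sum_mul, hm]
    field_simp
    ring
  have hid : (∑ j, a' j * v' j) / (∑ j, a' j) - m =
      (∑ j, (a' j * (v' j - v j) + (a' j - a j) * (v j - m))) / ∑ j, a' j := by
    have : ∑ j, (a' j * (v' j - v j) + (a' j - a j) * (v j - m)) =
        (∑ j, a' j * v' j) - m * ∑ j, a' j - ∑ j, a j * (v j - m) := by
      rw [Finset.mul_sum, ← Finset.sum_sub_distrib, ← Finset.sum_sub_distrib]
      exact Finset.sum_congr rfl fun j _ => by ring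
    rw [this, h0]
    field_simp
    ring
  rw [hid, abs_div, abs_of_pos hA'0, div_le_iff₀ hA'0]
  calc |∑ j, (a' j * (v' j - v j) + (a' j - a j) * (v j - m))|
      ≤ ∑ j, |a' j * (v' j - v j) + (a' j - a j) * (v j - m)| := Finset.abs_sum_le_sum_abs _ _
    _ ≤ ∑ j, (ν * a' j + 2 * κ * r * a j) := Finset.sum_le_sum fun j _ => by
        have h₁ : |v j - m| ≤ 2 * r := by
          have := abs_sub (v j) m
          linarith [hv j]
        have h₂ : 0 < a' j := by linarith [hpos j, ha j]
        refine (abs_add_le _ _).trans ?_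
        rw [abs_mul, abs_mul, abs_of_pos h₂]
        have h₃ := mul_le_mul_of_nonneg_left (hv' j) h₂.le
        have h₄ := mul_le_mul (ha' j) h₁ (abs_nonneg _) (mul_nonneg hκ0 (ha j).le)
        nlinarith
    _ = ν * ∑ j, a' j + 4 * κ * r * ((∑ j, a j) / 2) := by
        rw [Finset.sum_add_distrib, ← Finset.mul_sum, ← Finset.mul_sum]
        ring
    _ ≤ ν * ∑ j, a' j + 4 * κ * r * ∑ j, a' j := by gcongr
    _ = (ν + 4 * κ * r) * ∑ j, a' j := by ring

/-- The relations between the size parameters under which a layer amplifies errors by at most a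
factor `n`. -/
structure Sizes (n D : ℕ) (R ρ A tol η : ℝ) : Prop where
  D_pos : 0 < D
  D_le : (D : ℝ) ≤ A
  R_le : R + 1 ≤ ρ
  ρ_le : ρ ≤ A
  A_le : 44 * A ^ 6 ≤ n
  tol_le : tol * Real.exp (2 * (ρ * ρ)) ≤ η

theorem mul_error {N : Type} {D : ℕ} {R A e : ℝ} {U U' : Matrix N (Fin D) ℝ} {W : Matrix (Fin D) (Fin D) ℝ}
    (hU : EntriesLE (U' - U) e) (hW : EntriesLE W R) (hD : (D : ℝ) ≤ A) (hR : R ≤ A) (he : 0 ≤ e)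
    (hR0 : 0 ≤ R) : EntriesLE (U' * W - U * W) (A ^ 2 * e) := by
  intro p j
  rw [← Matrix.sub_mul, Matrix.mul_apply]
  calc |∑ k, (U' - U) p k * W k j| ≤ ∑ k, |(U' - U) p k * W k j| := Finset.abs_sum_le_sum_abs _ _
    _ ≤ ∑ _k : Fin D, e * R := Finset.sum_le_sum fun k _ => by
        rw [abs_mul]; exact mul_le_mul (hU p k) (hW k j) (abs_nonneg _) he
    _ = D * (e * R) := by simp
    _ ≤ A * (e * A) := by gcongr; exact hD.trans' (Nat.cast_nonneg D)
    _ = A ^ 2 * e := by ring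

section LayerError
variable {N : Type} [Fintype N] [DecidableEq N] {n D : ℕ} {R ρ A tol η ε₀ e : ℝ} {L : Layer D}
  {X X' : Matrix N (Fin D) ℝ}

/-- Division by `D` cancels the number of terms. So the argument of the exponential, and with it the
Taylor degree, is governed by `R ^ 2` alone and not by the dimension. -/
theorem scaled_inner_le {x y : Fin D → ℝ} {a b : ℝ} (hD : 0 < D) (hx : ∀ l, |x l| ≤ a)
    (hy : ∀ l, |y l| ≤ b) : |(∑ l, x l * y l) / (D : ℝ)| ≤ a * b := by
  have hD' : (0 : ℝ) < D := by exact_mod_cast hD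
  have ha : 0 ≤ a := (abs_nonneg _).trans (hx ⟨0, hD⟩)
  rw [abs_div, Nat.abs_cast, div_le_iff₀ hD']
  calc |∑ l, x l * y l| ≤ ∑ l, |x l * y l| := Finset.abs_sum_le_sum_abs _ _
    _ ≤ ∑ _l : Fin D, a * b := Finset.sum_le_sum fun l _ => by
        rw [abs_mul]; exact mul_le_mul (hx l) (hy l) (abs_nonneg _) ha
    _ = a * b * D := by simp; ring

theorem attn_apply (U : Matrix N (Fin D) ℝ) (p : N) (j : Fin D) :
    attn L U p j = (∑ q, attnMatrix L U p q * (U * L.WV) q j) / ∑ q, attnMatrix L U p q := by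
  rw [attn, Matrix.mul_assoc, Matrix.diagonal_mul, Matrix.mul_apply, mul_comm, div_eq_mul_inv]

/-- Queries, keys and values move by at most `A ^ 2 * e ≤ 1`, so the perturbed queries and keys stay
within `ρ`. The exponents move by at most `2 A ^ 3 e`, which changes the exponentials by a relative
error `4 A ^ 3 e`. Taylor truncation adds `e ≤ A ^ 3 e`, for a relative error `κ = 5 A ^ 3 e` of the
weights. The mean then errs by `A ^ 2 e + 4 κ R ≤ 21 A ^ 4 e`. -/
theorem apxAttn_error {U U' : Matrix N (Fin D) ℝ} (hs : Sizes n D R ρ A tol η) (hη : η ≤ e)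
    (he : n * e ≤ 1) (he0 : 0 ≤ e) (hR0 : 0 ≤ R) (hU : EntriesLE (U' - U) e)
    (hWQ : EntriesLE L.WQ R) (hWK : EntriesLE L.WK R) (hWV : EntriesLE L.WV R)
    (hQ : EntriesLE (U * L.WQ) R) (hK : EntriesLE (U * L.WK) R) (hV : EntriesLE (U * L.WV) R) :
    EntriesLE (U' * L.WQ) ρ ∧ EntriesLE (U' * L.WK) ρ ∧ ∀ G, DegOK G tol L U' →
      EntriesLE (apxAttn G L U' - attn L U) (21 * A ^ 4 * e) := by
  have hρ1 : 1 ≤ ρ := by linarith [hs.R_le]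
  have hA1 : 1 ≤ A := hρ1.trans hs.ρ_le
  have hRA : R ≤ A := by linarith [hs.R_le, hs.ρ_le]
  have hpow : ∀ {i j : ℕ}, i ≤ j → A ^ i ≤ A ^ j := fun h => pow_le_pow_right₀ hA1 h
  have hAe : 44 * (A ^ 6 * e) ≤ 1 := by
    have := mul_le_mul_of_nonneg_right hs.A_le he0
    linarith
  have h2 : A ^ 2 * e ≤ A ^ 6 * e := mul_le_mul_of_nonneg_right (hpow (by norm_num)) he0
  have h3 : A ^ 3 * e ≤ A ^ 6 * e := mul_le_mul_of_nonneg_right (hpow (by norm_num)) he0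
  have hAe0 : 0 ≤ A ^ 6 * e := by positivity
  have eQ := mul_error hU hWQ hs.D_le hRA he0 hR0
  have eK := mul_error hU hWK hs.D_le hRA he0 hR0
  have eV := mul_error hU hWV hs.D_le hRA he0 hR0
  have bound : ∀ {W : Matrix (Fin D) (Fin D) ℝ}, EntriesLE (U' * W - U * W) (A ^ 2 * e) →
      EntriesLE (U * W) R → EntriesLE (U' * W) ρ := by
    intro W h h' p j
    have h₁ := h p j
    have h₂ := h' p j
    rw [Matrix.sub_apply] at h₁
    have h₃ := abs_add_le ((U' * W) p j - (U * W) p j) ((U * W) p j)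
    rw [sub_add_cancel] at h₃
    linarith [hs.R_le]
  have bQ := bound eQ hQ
  have bK := bound eK hK
  refine ⟨bQ, bK, fun G hG p j => ?_⟩
  have : Nonempty N := ⟨p⟩
  obtain ⟨cQ, cK, hcQ, hcK, dQ, dK, hdeg⟩ := hG
  rw [Matrix.sub_apply, apxAttn, attn_apply]
  have key : ∀ q, |expT G (((U' * L.WQ) * (U' * L.WK).transpose) p q / (D : ℝ)) -
      attnMatrix L U p q| ≤ (5 * A ^ 3 * e) * attnMatrix L U p q := by
    intro q
    rw [attnMatrix]
    set x := ((U * L.WQ) * (U * L.WK).transpose) p q / (D : ℝ) with hx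
    set x' := ((U' * L.WQ) * (U' * L.WK).transpose) p q / (D : ℝ) with hx'
    rw [Matrix.mul_apply] at hx hx'
    simp only [Matrix.transpose_apply] at hx hx'
    have hxρ : |x| ≤ ρ * ρ := by
      rw [hx]
      refine (scaled_inner_le hs.D_pos (fun l => hQ p l) (fun l => hK q l)).trans ?_
      nlinarith [hs.R_le]
    have hx'ρ : |x'| ≤ ρ * ρ := by
      rw [hx']
      exact scaled_inner_le hs.D_pos (fun l => bQ p l) (fun l => bK q l)
    -- The measured bounds control the Taylor remainder; `ρ` is needed only for the exponential
    -- factor that multiplies it.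
    have hx'c : |x'| ≤ cQ * cK := by
      rw [hx']
      exact scaled_inner_le hs.D_pos (fun l => dQ p l) (fun l => dK q l)
    have hxx : |x' - x| ≤ 2 * A ^ 3 * e := by
      have : x' - x = (∑ l, ((U' * L.WQ) p l - (U * L.WQ) p l) * (U' * L.WK) q l) / (D : ℝ) +
          (∑ l, (U * L.WQ) p l * ((U' * L.WK) q l - (U * L.WK) q l)) / (D : ℝ) := by
        rw [hx, hx', ← sub_div, ← add_div, ← Finset.sum_sub_distrib, ← Finset.sum_add_distrib]
        congr 1
        exact Finset.sum_congr rfl fun l _ => by ring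
      rw [this]
      refine (abs_add_le _ _).trans ?_
      have h₁ := scaled_inner_le hs.D_pos (fun l => eQ p l) (fun l => bK q l)
      have h₂ := scaled_inner_le hs.D_pos (fun l => hQ p l) (fun l => eK q l)
      simp only [Matrix.sub_apply] at h₁ h₂
      have h₄ : 0 ≤ A ^ 2 * e := by positivity
      have h₅ : A ^ 2 * e * ρ ≤ A ^ 2 * e * A := mul_le_mul_of_nonneg_left hs.ρ_le h₄
      have h₆ : R * (A ^ 2 * e) ≤ A * (A ^ 2 * e) := mul_le_mul_of_nonneg_right hRA h₄
      linarith
    have hT := abs_expT_sub_exp_le G x'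
    have ht0 : 0 ≤ tol := hdeg.trans' (by positivity)
    have hT' : |x'| ^ (G + 1) / ((G + 1).factorial : ℝ) ≤ tol := hdeg.trans' (by gcongr)
    have h₁ : |expT G x' - Real.exp x'| ≤ e * Real.exp x := by
      calc |expT G x' - Real.exp x'| ≤ tol * Real.exp (ρ * ρ) := by
            refine hT.trans ?_
            gcongr
        -- The absolute error becomes a relative one: `exp x` is at least `exp (-(ρ * ρ))`, and the
        -- tolerance was chosen to absorb a second factor `exp (ρ * ρ)`.
        _ = tol * Real.exp (2 * (ρ * ρ)) * Real.exp (-(ρ * ρ)) := by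
            rw [mul_assoc, ← Real.exp_add]; ring_nf
        _ ≤ e * Real.exp x := by
            gcongr
            · exact hs.tol_le.trans hη
            · exact (abs_le.1 hxρ).1
    have h₂ : |Real.exp x' - Real.exp x| ≤ 4 * A ^ 3 * e * Real.exp x := by
      have : Real.exp x' - Real.exp x = (Real.exp (x' - x) - 1) * Real.exp x := by
        rw [sub_mul, ← Real.exp_add]; ring_nf
      rw [this, abs_mul, Real.abs_exp]
      gcongr
      have := Real.abs_exp_sub_one_le (x := x' - x) (by linarith)
      linarith
    have h₃ : e ≤ A ^ 3 * e := le_mul_of_one_le_left he0 (one_le_pow₀ hA1)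
    have h₄ := mul_le_mul_of_nonneg_right h₃ (Real.exp_pos x).le
    have h₅ := abs_sub_le (expT G x') (Real.exp x') (Real.exp x)
    calc _ ≤ _ := h₅
      _ ≤ e * Real.exp x + 4 * A ^ 3 * e * Real.exp x := add_le_add h₁ h₂
      _ ≤ 5 * A ^ 3 * e * Real.exp x := by linarith
  refine (weighted_mean_error (fun q => Real.exp_pos _) key (by linarith) (fun q => hV q j)
    (fun q => eV q j)).trans ?_
  have h₁ : A ^ 2 * e ≤ A ^ 4 * e := mul_le_mul_of_nonneg_right (hpow (by norm_num)) he0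
  have h₂ : A ^ 3 * e * R ≤ A ^ 3 * e * A := mul_le_mul_of_nonneg_left hRA (by positivity)
  have h₃ : A ^ 3 * e * A = A ^ 4 * e := by ring
  linarith

/-- The residual connection raises the attention error to `22 A ^ 4 e`. Layer normalization does not
increase it, the MLP multiplies it by at most `D * R ≤ A ^ 2`, and the second residual connection
adds `22 A ^ 4 e ≤ 22 A ^ 6 e` again. This is the origin of `44 * A ^ 6 ≤ n`. Stability is used only
at the exact inputs, where it is assumed. -/
theorem apxOut_error (hs : Sizes n D R ρ A tol η) (hη : η ≤ e) (he : n * e ≤ 1)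
    (he' : n * e ≤ ε₀) (he0 : 0 ≤ e) (hL : LayerAdmissible R ε₀ L X)
    (hX : EntriesLE (X' - X) e) :
    EntriesLE (layerNorm X' * L.WQ) ρ ∧ EntriesLE (layerNorm X' * L.WK) ρ ∧
      ∀ G, DegOK G tol L (layerNorm X') → EntriesLE (apxOut G L X' - layerOut L X) (n * e) := by
  obtain ⟨hWQ, hWK, hWV, hW, hQ, hK, hV, hN, hN'⟩ := hL
  have hR0 : 0 ≤ R := (abs_nonneg _).trans (hW ⟨0, hs.D_pos⟩ ⟨0, hs.D_pos⟩)
  have hρ1 : 1 ≤ ρ := by linarith [hs.R_le]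
  have hA1 : 1 ≤ A := hρ1.trans hs.ρ_le
  have hRA : R ≤ A := by linarith [hs.R_le, hs.ρ_le]
  have hpow : ∀ {i j : ℕ}, i ≤ j → A ^ i * e ≤ A ^ j * e :=
    fun h => mul_le_mul_of_nonneg_right (pow_le_pow_right₀ hA1 h) he0
  have hAn : 44 * (A ^ 6 * e) ≤ n * e := by
    have := mul_le_mul_of_nonneg_right hs.A_le he0
    linarith
  have h06 := hpow (show 0 ≤ 6 by norm_num)
  have h46 := hpow (show 4 ≤ 6 by norm_num)
  have h04 := hpow (show 0 ≤ 4 by norm_num)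
  rw [pow_zero, one_mul] at h06 h04
  have hU := hN e (by linarith) X' hX
  obtain ⟨bQ, bK, hatt⟩ := apxAttn_error hs hη he he0 hR0 hU hWQ hWK hWV hQ hK hV
  refine ⟨bQ, bK, fun G hG => ?_⟩
  have hmid : EntriesLE (apxMid G L X' - layerMid L X) (22 * A ^ 4 * e) := by
    intro p j
    have h₁ := hatt G hG p j
    have h₂ := hX p j
    rw [apxMid, layerMid, add_sub_add_comm, Matrix.add_apply]
    refine (abs_add_le _ _).trans ?_
    linarith
  have hln := hN' (22 * A ^ 4 * e) (by linarith) _ hmid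
  have h44 : 0 ≤ A ^ 4 * e := by positivity
  intro p j
  have h₁ := hmid p j
  have h₂ : |(mlp L (layerNorm (apxMid G L X')) - mlp L (layerNorm (layerMid L X))) p j| ≤
      A ^ 2 * (22 * A ^ 4 * e) := by
    rw [Matrix.sub_apply, mlp, mlp, Pi.add_apply, Pi.add_apply, add_sub_add_right_eq_sub,
      Matrix.mulVec, Matrix.mulVec, dotProduct, dotProduct, ← Finset.sum_sub_distrib]
    calc _ ≤ ∑ k, |L.W j k * layerNorm (apxMid G L X') p k -
          L.W j k * layerNorm (layerMid L X) p k| := Finset.abs_sum_le_sum_abs _ _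
      _ ≤ ∑ _k : Fin D, R * (22 * A ^ 4 * e) := Finset.sum_le_sum fun k _ => by
          rw [← mul_sub, abs_mul]
          exact mul_le_mul (hW j k) (hln p k) (abs_nonneg _) hR0
      _ = D * (R * (22 * A ^ 4 * e)) := by simp
      _ ≤ A * (A * (22 * A ^ 4 * e)) := by
          have hD := hs.D_le
          have : 0 ≤ 22 * A ^ 4 * e := by positivity
          gcongr
      _ = _ := by ring
  rw [apxOut, layerOut, add_sub_add_comm, Matrix.add_apply]
  refine (abs_add_le _ _).trans ?_
  have h₅ : A ^ 2 * (22 * A ^ 4 * e) = 22 * (A ^ 6 * e) := by ring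
  linarith

end LayerError

/-! ## The input in memory -/

/-- The list `l` is stored from the address `off` on. -/
def MemList (fm : ℕ → ℝ) (off : ℕ) (l : List ℝ) : Prop := ∀ i x, l[i]? = some x → fm (off + i) = x

section MemList
variable {fm : ℕ → ℝ} {off : ℕ}

theorem MemList.left {l₁ l₂ : List ℝ} (h : MemList fm off (l₁ ++ l₂)) : MemList fm off l₁ := by
  intro i x hx
  have hi : i < l₁.length := (List.getElem?_eq_some_iff.1 hx).1
  exact h i x (by rw [List.getElem?_append_left hi, hx])

theorem MemList.right {l₁ l₂ : List ℝ} (h : MemList fm off (l₁ ++ l₂)) :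
    MemList fm (off + l₁.length) l₂ := by
  intro i x hx
  rw [add_assoc]
  exact h _ x (by rw [List.getElem?_append_right (by omega), Nat.add_sub_cancel_left, hx])

theorem length_flatten_ofFn {a w : ℕ} (f : Fin a → List ℝ) (hf : ∀ i, (f i).length = w) :
    (List.ofFn f).flatten.length = a * w := by
  induction a with
  | zero => simp
  | succ a ih =>
    rw [List.ofFn_succ, List.flatten_cons, List.length_append, ih _ fun i => hf _, hf]
    ring

theorem getElem?_flatten_ofFn {a w : ℕ} (f : Fin a → List ℝ) (hf : ∀ i, (f i).length = w)
    (i : Fin a) {r : ℕ} (hr : r < w) : (List.ofFn f).flatten[(i : ℕ) * w + r]? = (f i)[r]? := by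
  induction a with
  | zero => exact i.elim0
  | succ a ih =>
    rw [List.ofFn_succ, List.flatten_cons]
    refine Fin.cases ?_ (fun i => ?_) i
    · rw [List.getElem?_append_left (by simpa [hf] using hr)]
      simp
    · have h : ((i.succ : Fin (a + 1)) : ℕ) * w + r = (f 0).length + ((i : ℕ) * w + r) := by
        rw [hf, Fin.val_succ]; ring
      rw [h, List.getElem?_append_right (by omega), Nat.add_sub_cancel_left,
        ih (fun i => f i.succ) (fun i => hf _) i]

theorem length_encodeMatrix {a b : ℕ} (A : Matrix (Fin a) (Fin b) ℝ) :
    (encodeMatrix A).length = a * b :=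
  length_flatten_ofFn _ fun _ => by simp

theorem MemList.matrix {a b : ℕ} {A : Matrix (Fin a) (Fin b) ℝ}
    (h : MemList fm off (encodeMatrix A)) (i : Fin a) (j : Fin b) :
    fm (off + (i * b + j)) = A i j := by
  refine h _ _ ?_
  rw [encodeMatrix, getElem?_flatten_ofFn _ (fun _ => by simp) i j.2]
  simp

theorem length_encodeTensor {n d : ℕ} (Z : Matrix (Fin n × Fin n) (Fin d) ℝ) :
    (encodeTensor Z).length = n * n * d := by
  rw [encodeTensor, length_flatten_ofFn (w := n * d) _ fun _ =>
    length_flatten_ofFn _ fun _ => by simp]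
  ring

theorem MemList.tensor {n d : ℕ} {Z : Matrix (Fin n × Fin n) (Fin d) ℝ}
    (h : MemList fm off (encodeTensor Z)) (p : Fin n × Fin n) (j : Fin d) :
    fm (off + (tk p * d + j)) = Z p j := by
  refine h _ _ ?_
  have h₁ : tk p * d + j = (p.1 : ℕ) * (n * d) + ((p.2 : ℕ) * d + j) := by unfold tk; ring
  have h₂ : (p.2 : ℕ) * d + j < n * d := by
    have := row_lt p.2.2 j.2
    rw [mul_comm d, mul_comm d] at this
    exact this
  rw [encodeTensor, h₁, getElem?_flatten_ofFn (w := n * d) _ (fun _ =>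
    length_flatten_ofFn _ fun _ => by simp) p.1 h₂,
    getElem?_flatten_ofFn _ (fun _ => by simp) p.2 j.2]
  simp

theorem length_encode {D : ℕ} (L : Layer D) : L.encode.length = 4 * D * D + D := by
  simp only [Layer.encode, List.length_append, length_encodeMatrix, List.length_ofFn]
  ring

theorem length_flatten_encode {D : ℕ} (Ls : List (Layer D)) :
    (Ls.map Layer.encode).flatten.length = Ls.length * (4 * D * D + D) := by
  induction Ls with
  | nil => simp
  | cons L Ls ih => simp [length_encode, ih]; ring

theorem HasLayer.of_memList {D : ℕ} {L : Layer D} {σ : RamState}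
    (h : MemList σ.fmem off L.encode) (hb : off + 4 * D * D + D ≤ σ.ireg 3) :
    HasLayer σ off L := by
  rw [Layer.encode] at h
  refine ⟨hb, fun i j => ?_, fun i j => ?_, fun i j => ?_, fun i j => ?_, fun j => ?_⟩
  · rw [← h.left.left.left.left.matrix i j]
    congr 1; ring
  · rw [← h.left.left.left.right.matrix i j]
    congr 1; simp only [length_encodeMatrix]; ring
  · rw [← h.left.left.right.matrix i j]
    congr 1; simp only [List.length_append, length_encodeMatrix]; ring
  · rw [← h.left.right.matrix i j]
    congr 1; simp only [List.length_append, length_encodeMatrix]; ring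
  · have := h.right j (L.b j) (by simp)
    rw [← this]
    congr 1; simp only [List.length_append, length_encodeMatrix]; ring

end MemList

/-- The parameters of the listed layers are stored from the address `off` on. -/
def HasLayers {D : ℕ} (σ : RamState) : ℕ → List (Layer D) → Prop
  | _, [] => True
  | off, L :: Ls => HasLayer σ off L ∧ HasLayers σ (off + 4 * D * D + D) Ls

theorem HasLayers.fr {D off : ℕ} {Ls : List (Layer D)} {σ σ' : RamState} {I F A : List ℕ}
    (h : HasLayers σ off Ls) (hF : Fr I F A σ σ') (h3 : 3 ∉ I) : HasLayers σ' off Ls := by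
  induction Ls generalizing off with
  | nil => trivial
  | cons L Ls ih => exact ⟨h.1.fr hF h3, ih h.2⟩

theorem HasLayers.of_memList {D off : ℕ} {Ls : List (Layer D)} {σ : RamState}
    (h : MemList σ.fmem off (Ls.map Layer.encode).flatten)
    (hb : off + Ls.length * (4 * D * D + D) ≤ σ.ireg 3) : HasLayers σ off Ls := by
  induction Ls generalizing off with
  | nil => trivial
  | cons L Ls ih =>
    rw [List.map_cons, List.flatten_cons] at h
    rw [List.length_cons, Nat.succ_mul] at hb
    refine ⟨.of_memList h.left (by omega), ih ?_ (by omega)⟩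
    have := h.right
    rwa [length_encode, ← add_assoc] at this

/-! ## Vision transformers -/

/-- The command that does nothing of interest. -/
def skipC : Cmd := .iset 8 (.const 0)

/-- A vision transformer with `m` layers, on the array 1, with the parameters at the address in
register 20. -/
def vitC : ℕ → Cmd
  | 0 => skipC
  | m + 1 => .seq layerC (vitC m)

/-- The side conditions on the degree bound `j₀` of the Taylor polynomials. -/
structure DegBound (n D S : ℕ) (ρ tol : ℝ) (j₀ : ℕ) : Prop where
  lt : j₀ < n
  le : j₀ ≤ S
  tail : (ρ * ρ) ^ (j₀ + 1) / ((j₀ + 1).factorial : ℝ) ≤ tol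
  card : (D + j₀).choose j₀ ≤ S

theorem Sizes.n_ge {n D : ℕ} {R ρ A tol η : ℝ} (hs : Sizes n D R ρ A tol η) (hR : 0 ≤ R) :
    (44 : ℝ) ≤ n := by
  have hA : 1 ≤ A := by linarith [hs.R_le, hs.ρ_le]
  have := one_le_pow₀ hA (n := 6)
  linarith [hs.A_le]

/-- Induction on the layers, with the allowance `e` multiplied by `n` each time. It never falls
below `η`, the part reserved for truncation, and the final allowance being at most `1` and `ε₀`
covers all earlier ones. -/
theorem Wp.vitC {n D S j₀ : ℕ} {R ρ A tol η ε₀ : ℝ} (hs : Sizes n D R ρ A tol η)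
    (hj : DegBound n D S ρ tol j₀) {Ls : List (Layer D)} {σ : RamState} {e : ℝ}
    {X X' : Matrix (Fin n × Fin n) (Fin D) ℝ} (hC : Ctx n D tol σ) (hX' : Holds σ 1 X')
    (hL : HasLayers σ (σ.ireg 20) Ls) (hA : VitAdmissible R ε₀ Ls X) (hX : EntriesLE (X' - X) e)
    (hη : η ≤ e) (he0 : 0 ≤ e) (he : (n : ℝ) ^ Ls.length * e ≤ 1)
    (he' : (n : ℝ) ^ Ls.length * e ≤ ε₀) :
    Wp (n * n) S (vitC Ls.length) σ fun σ' =>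
      Fr [4, 5, 8, 11, 12, 13, 14, 15, 16, 17, 20] [3, 4, 5, 6] [1, 2, 3, 4, 5, 6, 7, 8, 9, 10]
        σ σ' ∧
      σ'.ireg 20 = σ.ireg 20 + Ls.length * (4 * D * D + D) ∧
      ∃ X'', Holds σ' 1 X'' ∧ EntriesLE (X'' - vit Ls X) ((n : ℝ) ^ Ls.length * e) := by
  induction Ls generalizing σ e X X' with
  | nil =>
    refine Wp.iset (by omega) rfl (fun _ _ => by simp [NE.eval]) (by simp)
      ⟨(Fr.refl _ _ _ _).setI (by simp) _, by simp, X', hX'.setI (by omega) _, ?_⟩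
    simpa [vit] using hX
  | cons L Ls ih =>
    obtain ⟨hA₁, hA₂⟩ := hA
    have hR : 0 ≤ R := (abs_nonneg _).trans (hA₁.1 ⟨0, hs.D_pos⟩ ⟨0, hs.D_pos⟩)
    have hn := hs.n_ge hR
    have hpow : (n : ℝ) ^ (Ls.length + 1) * e = (n : ℝ) ^ Ls.length * (n * e) := by ring
    have hne : 0 ≤ (n : ℝ) * e := by positivity
    have h1 : (n : ℝ) * e ≤ (n : ℝ) ^ Ls.length * (n * e) :=
      le_mul_of_one_le_left hne (one_le_pow₀ (by linarith))
    rw [List.length_cons, hpow] at he he'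
    obtain ⟨q, k, err⟩ := apxOut_error hs hη (h1.trans he) (h1.trans he') he0 hA₁ hX
    refine Wp.seq ((Wp.layerC hC hX' hL.1 (by linarith [hs.R_le]) q k hj.lt hj.le hj.tail
      hj.card).mono ?_)
    rintro σ₁ _ ⟨f₁, h20, G, hG, X₁⟩
    have hL₁ : HasLayers σ₁ (σ₁.ireg 20) Ls := by
      rw [h20]; exact HasLayers.fr hL.2 f₁ (by simp)
    refine (ih (hC.fr f₁ (by simp) (by simp)) X₁ hL₁ hA₂ (err G hG)
      (hη.trans (le_mul_of_one_le_left he0 (by linarith))) hne he he').mono ?_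
    rintro σ₂ _ ⟨f₂, h20', X'', hX'', err'⟩
    refine ⟨f₁.trans (by simp) f₂, ?_, X'', hX'', ?_⟩
    · rw [h20', h20, List.length_cons]; ring
    · rw [List.length_cons, hpow]; exact err'

/-! ## One sampling step -/

/-- Fill the array 1 with the tensor at address `0` and the times in the real registers 1 and 2. -/
def loadC : Cmd :=
  .seq (.forC true 4 (.var 2) (.forC false 8 (.var 1) (.fput (adE 1 (ix 4 6 8))
    (.ld (ix 4 1 8))))) <|
  .seq (.forC true 4 (.var 2) (.fput (adE 1 (ix 4 6 1)) (.var 1)))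
    (.forC true 4 (.var 2) (.fput (adE 1 (.add (ix 4 6 1) (.const 1))) (.var 2)))

/-- The tensor is stored from the address `0` on. -/
def HoldsZ {n d : ℕ} (σ : RamState) (Z : Matrix (Fin n × Fin n) (Fin d) ℝ) : Prop :=
  ∀ p (j : Fin d), σ.fmem (tk p * d + j) = Z p j

theorem tk_mul_add_lt {n d : ℕ} (p : Fin n × Fin n) (j : Fin d) : tk p * d + j < n * n * d := by
  have := row_lt (tk_lt p) j.2
  rwa [mul_comm d, mul_comm d] at this

/-- One function of the address describes the whole matrix, so the three loops of `loadC` write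
values of the same function and cannot spoil each other's work. -/
theorem exists_mem_fun {n w : ℕ} (b α : ℕ) (X : Matrix (Fin n × Fin n) (Fin w) ℝ) :
    ∃ f : ℕ → ℝ, ∀ p (j : Fin w), f (b + 16 * (tk p * w + j) + α) = X p j := by
  have hinj : Function.Injective fun x : (Fin n × Fin n) × Fin w =>
      b + 16 * (tk x.1 * w + x.2) + α := by
    rintro ⟨p, j⟩ ⟨q, l⟩ h
    have h' : tk p * w + j = tk q * w + l := by simp only at h; omega
    have hw : 0 < w := j.pos
    have h₁ := congrArg (· / w) h'
    have h₂ := congrArg (· % w) h'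
    simp only [Nat.mul_add_mod_self_right, Nat.mod_eq_of_lt j.2, Nat.mod_eq_of_lt l.2] at h₂
    simp only [Nat.mul_comm _ w, Nat.mul_add_div hw, Nat.div_eq_of_lt j.2, Nat.div_eq_of_lt l.2,
      add_zero] at h₁
    exact Prod.ext (tk_injective h₁) (Fin.ext h₂)
  exact ⟨Function.extend _ (fun x : (Fin n × Fin n) × Fin w => X x.1 x.2) 0,
    fun p j => hinj.extend_apply _ _ (p, j)⟩

theorem Wp.loadC {n d S : ℕ} {tol : ℝ} {σ : RamState} {Z : Matrix (Fin n × Fin n) (Fin d) ℝ}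
    (hC : Ctx n (d + 2) tol σ) (hZ : HoldsZ σ Z) (hb : n * n * d ≤ σ.ireg 3) :
    Wp (n * n) S loadC σ fun σ' => Fr [4, 8] [] [1] σ σ' ∧
      Holds σ' 1 (withTimes Z (σ.freg 1) (σ.freg 2)) := by
  obtain ⟨f, hf⟩ := exists_mem_fun (σ.ireg 3) 1 (withTimes Z (σ.freg 1) (σ.freg 2))
  have h1 : σ.ireg 1 = d := by have := hC.r1; omega
  have hmem : ∀ idx, σ.ireg 3 + 16 * idx + 1 ∈ cells (σ.ireg 3) 1 := by
    intro idx
    simp only [cells, Set.mem_ofPred_eq]; omega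
  refine Wp.seq ((Wp.store₂ (cells (σ.ireg 3) 1)
    (fun i j => σ.ireg 3 + 16 * (i * (d + 2) + j) + 1) f (by omega) (by omega) (by omega)
    (fun _ => rfl) (fun hs => hs.2) (by omega) rfl (by omega) (by omega) (by omega) (by omega)
    rfl rfl ?_).mono ?_)
  · intro i hi j hj σ' hs h4 h8
    rw [hC.r2] at hi
    rw [h1] at hj
    obtain ⟨p, rfl⟩ := exists_tk hi
    have hC' := hC.fr (hs.toFr subset_rfl) (by simp) (by simp)
    have h1' : σ'.ireg 1 = d := by rw [hs.ireg 1 (by simp), h1]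
    refine ⟨?_, hmem _, ?_⟩
    · rw [adE_eval hC'.r7]
      simp [ix, NE.eval, h4, h8, hC'.r6, hs.ireg 3 (by simp)]
    · have := hf p (Fin.castAdd 2 ⟨j, hj⟩)
      simp only [Fin.val_castAdd] at this
      rw [this, withTimes, Fin.append_left, ← hZ p ⟨j, hj⟩]
      simp only [RE.eval, ix, NE.eval, h4, h8, h1']
      exact hs.raw (lt_of_lt_of_le (tk_mul_add_lt p ⟨j, hj⟩) hb)
  rintro σ₁ _ ⟨s₁, v₁, -⟩
  rw [hC.r2, h1] at v₁
  have f₁ := s₁.toFr subset_rfl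
  have hC₁ := hC.fr f₁ (by simp) (by simp)
  have h3₁ : σ₁.ireg 3 = σ.ireg 3 := f₁.ireg 3 (by simp)
  have h1₁ : σ₁.ireg 1 = d := by rw [f₁.ireg 1 (by simp), h1]
  refine Wp.seq ((Wp.store (cells (σ₁.ireg 3) 1)
    (fun i => σ.ireg 3 + 16 * (i * (d + 2) + d) + 1) f (by omega) (by omega) (by omega)
    (fun _ => rfl) (fun hs => hs.2) rfl rfl ?_).mono ?_)
  · intro i hi σ' hs h4
    rw [hC₁.r2] at hi
    obtain ⟨p, rfl⟩ := exists_tk hi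
    have hC' := hC₁.fr (hs.toFr subset_rfl) (by simp) (by simp)
    refine ⟨?_, by rw [h3₁]; exact hmem _, ?_⟩
    · rw [adE_eval hC'.r7]
      simp [ix, NE.eval, h4, hC'.r6, hs.ireg 3 (by simp), hs.ireg 1 (by simp), h1₁, h3₁]
    · have := hf p (Fin.natAdd d 0)
      simp only [Fin.val_natAdd, Fin.val_zero, add_zero] at this
      rw [this, withTimes, Fin.append_right]
      simp [RE.eval, hs.freg, s₁.freg]
  rintro σ₂ _ ⟨s₂, v₂, o₂⟩
  rw [hC₁.r2] at v₂
  have f₂ := s₂.toFr subset_rfl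
  have hC₂ := hC₁.fr f₂ (by simp) (by simp)
  have h3₂ : σ₂.ireg 3 = σ.ireg 3 := by rw [f₂.ireg 3 (by simp), h3₁]
  have h1₂ : σ₂.ireg 1 = d := by rw [f₂.ireg 1 (by simp), h1₁]
  refine ((Wp.store (cells (σ₂.ireg 3) 1)
    (fun i => σ.ireg 3 + 16 * (i * (d + 2) + (d + 1)) + 1) f (by omega) (by omega) (by omega)
    (fun _ => rfl) (fun hs => hs.2) rfl rfl ?_).mono ?_)
  · intro i hi σ' hs h4
    rw [hC₂.r2] at hi
    obtain ⟨p, rfl⟩ := exists_tk hi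
    have hC' := hC₂.fr (hs.toFr subset_rfl) (by simp) (by simp)
    refine ⟨?_, by rw [h3₂]; exact hmem _, ?_⟩
    · rw [adE_eval hC'.r7]
      simp [ix, NE.eval, h4, hC'.r6, hs.ireg 3 (by simp), hs.ireg 1 (by simp), h1₂, h3₂, add_assoc]
    · have := hf p (Fin.natAdd d 1)
      simp only [Fin.val_natAdd, Fin.val_one] at this
      rw [this, withTimes, Fin.append_right]
      simp [RE.eval, hs.freg, s₁.freg, s₂.freg]
  rintro σ₃ _ ⟨s₃, v₃, o₃⟩
  rw [hC₂.r2] at v₃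
  have f₃ := s₃.toFr subset_rfl
  refine ⟨(f₁.trans (by simp) (f₂.mono (by simp) (by simp) (by simp))).trans (by simp)
    (f₃.mono (by simp) (by simp) (by simp)), fun p j => ?_⟩
  have hkeep : ∀ x, σ₁.fmem x = f x → σ₃.fmem x = f x := by
    intro x hx
    rcases o₃ x with h | h
    · rcases o₂ x with h' | h'
      · rw [h, h', hx]
      · rw [h, h']
    · exact h
  rw [← hf p j, RamState.arr, f₃.ireg 3 (by simp), h3₂]
  rcases lt_trichotomy (j : ℕ) d with h | h | h
  · exact hkeep _ (v₁ _ (tk_lt p) _ h)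
  · rw [h]
    rcases o₃ (σ.ireg 3 + 16 * (tk p * (d + 2) + d) + 1) with h' | h'
    · rw [h']; exact v₂ _ (tk_lt p)
    · exact h'
  · have : (j : ℕ) = d + 1 := by have := j.2; omega
    rw [this]
    exact v₃ _ (tk_lt p)

/-- One sampling step, from the time at the address in register 21 to the next one; the parameters
start `T + 1` cells after the tensor. -/
def stepC (m₁ m₂ T : ℕ) : Cmd :=
  .seq (.fset 1 (.ld (.add (.var 21) (.const 1)))) <|
  .seq (.fset 2 (.ld (.var 21))) <|
  .seq (.iset 20 (.add (.mul (.var 2) 1) (.const (T + 1)))) <|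
  .seq loadC <| .seq (vitC m₁) <| .seq (fillTok 1 12 (ldA 1 (ix 4 6 8))) <|
  .seq loadC <| .seq (vitC m₂) <|
  -- The new tensor is first built in array 13, because its entries depend on the old ones and the
  -- rules for stores do not allow an expression to rely on cells that are being overwritten.
  .seq (fillTok 1 13 (.add (.add (.ld (ix 4 1 8))
    (.mul (.sub (.var 1) (.var 2)) (ldA 12 (ix 4 1 8))))
    (.mul (.mul (.const (1 / 2)) (.mul (.sub (.var 1) (.var 2)) (.sub (.var 1) (.var 2))))
      (ldA 1 (ix 4 6 8))))) <|
  .seq (.forC true 4 (.var 2) (.forC false 8 (.var 1) (.fput (ix 4 1 8) (ldA 13 (ix 4 1 8))))) <|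
  .iset 21 (.add (.var 21) (.const 1))

/-- The times and the parameters, in the order of the input. -/
def auxList {d : ℕ} (ts : List ℝ) (V₁ V₂ : List (Layer (d + 2))) : List ℝ :=
  ts ++ (V₁.map Layer.encode).flatten ++ (V₂.map Layer.encode).flatten

/-- The part of the state that all sampling steps preserve. -/
structure Aux (n d : ℕ) (tol : ℝ) (l : List ℝ) (σ : RamState) : Prop where
  ctx : Ctx n (d + 2) tol σ
  mem : MemList σ.fmem (n * n * d) l
  bound : n * n * d + l.length ≤ σ.ireg 3

section Step
variable {n d m₁ m₂ S : ℕ} {tol : ℝ} {l ts : List ℝ} {σ σ' : RamState}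
  {V₁ V₂ : List (Layer (d + 2))} {Z Z' : Matrix (Fin n × Fin n) (Fin d) ℝ}

theorem Aux.fr (h : Aux n d tol l σ) {I F A : List ℕ} (hF : Fr I F A σ σ')
    (hI : ∀ v ∈ [0, 1, 2, 3, 6, 7], v ∉ I) (h0 : 0 ∉ F) : Aux n d tol l σ' := by
  have hb := h.bound
  refine ⟨h.ctx.fr hF (fun v hv => hI v (by simp at hv ⊢; omega)) h0, fun i x hx => ?_,
    by rwa [hF.ireg 3 (hI 3 (by simp))]⟩
  have hi : i < l.length := (List.getElem?_eq_some_iff.1 hx).1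
  rw [hF.raw (by omega), h.mem i x hx]

theorem HoldsZ.fr (h : HoldsZ σ Z) (hb : n * n * d ≤ σ.ireg 3) {I F A : List ℕ}
    (hF : Fr I F A σ σ') : HoldsZ σ' Z :=
  fun p j => (hF.raw (lt_of_lt_of_le (tk_mul_add_lt p j) hb)).trans (h p j)

theorem Aux.layers (h : Aux n d tol (auxList ts V₁ V₂) σ) :
    HasLayers σ (n * n * d + ts.length) V₁ ∧
      HasLayers σ (n * n * d + ts.length + V₁.length * (4 * (d + 2) * (d + 2) + (d + 2))) V₂ := by
  have hb := h.bound
  have hm := h.mem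
  simp only [auxList, List.length_append, length_flatten_encode] at hb
  constructor
  · exact .of_memList hm.left.right (by omega)
  · refine .of_memList ?_ (by omega)
    have := hm.right
    rwa [List.length_append, length_flatten_encode, ← add_assoc] at this

theorem withTimes_error {e s t : ℝ} (he : 0 ≤ e) (hZ : EntriesLE (Z' - Z) e) :
    EntriesLE (withTimes Z' t s - withTimes Z t s) e := by
  intro p j
  simp only [Matrix.sub_apply, withTimes]
  refine Fin.addCases (fun j => ?_) (fun j => ?_) j
  · simpa using hZ p j
  · simpa using he

/-- Times lie in the unit interval, so both coefficients are at most `1` in absolute value and three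
errors of size `e` add up. -/
theorem step_error {e s t ζ : ℝ} {X₁ X₁' X₂ X₂' : Matrix (Fin n × Fin n) (Fin (d + 2)) ℝ}
    (hs : s ∈ Set.Icc (0 : ℝ) 1) (ht : t ∈ Set.Icc (0 : ℝ) 1)
    (hZ : EntriesLE (Z' - Z) e) (h₁ : EntriesLE (X₁' - X₁) e) (h₂ : EntriesLE (X₂' - X₂) e)
    (hζ : 3 * e ≤ ζ) :
    EntriesLE ((Z' + (t - s) • firstCols X₁' + ((1 / 2 : ℝ) * (t - s) ^ 2) • firstCols X₂') -
      (Z + (t - s) • firstCols X₁ + ((1 / 2 : ℝ) * (t - s) ^ 2) • firstCols X₂)) ζ := by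
  intro p j
  have a₀ := hZ p j
  have a₁ := h₁ p (Fin.castAdd 2 j)
  have a₂ := h₂ p (Fin.castAdd 2 j)
  have he : 0 ≤ e := (abs_nonneg _).trans a₀
  have hd : |t - s| ≤ 1 := by
    rw [abs_le]; constructor <;> linarith [hs.1, hs.2, ht.1, ht.2]
  have hd2 : |(1 / 2 : ℝ) * (t - s) ^ 2| ≤ 1 := by
    rw [abs_mul, abs_pow, abs_of_pos (by norm_num : (0 : ℝ) < 1 / 2)]
    have := pow_le_one₀ (n := 2) (abs_nonneg (t - s)) hd
    linarith
  simp only [Matrix.sub_apply, Matrix.add_apply, Matrix.smul_apply, smul_eq_mul, firstCols] at *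
  have e₁ : |(t - s) * (X₁' p (Fin.castAdd 2 j) - X₁ p (Fin.castAdd 2 j))| ≤ 1 * e := by
    rw [abs_mul]; exact mul_le_mul hd a₁ (abs_nonneg _) zero_le_one
  have e₂ : |(1 / 2 : ℝ) * (t - s) ^ 2 *
      (X₂' p (Fin.castAdd 2 j) - X₂ p (Fin.castAdd 2 j))| ≤ 1 * e := by
    rw [abs_mul]; exact mul_le_mul hd2 a₂ (abs_nonneg _) zero_le_one
  refine le_trans ?_ hζ
  rw [abs_le] at *
  constructor <;> linarith [a₀.1, a₀.2, e₁.1, e₁.2, e₂.1, e₂.2]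

variable {R ρ A η ε₀ e s t : ℝ} {j₀ q : ℕ}

/-- Reloading the tensor and running one of the two transformers. -/
theorem Wp.loadC_vitC (hs : Sizes n (d + 2) R ρ A tol η)
    (hj : DegBound n (d + 2) S ρ tol j₀) (hn : 1 ≤ n) {V : List (Layer (d + 2))}
    (hI : Aux n d tol l σ) (h1 : σ.freg 1 = t) (h2 : σ.freg 2 = s)
    (hZ' : HoldsZ σ Z') (hL : HasLayers σ (σ.ireg 20) V)
    (hA : VitAdmissible R ε₀ V (withTimes Z t s)) (hZ : EntriesLE (Z' - Z) e)
    (hη : η ≤ e) (he0 : 0 ≤ e) {m : ℕ} (hm : V.length ≤ m) (he : (n : ℝ) ^ m * e ≤ 1)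
    (he' : (n : ℝ) ^ m * e ≤ ε₀) {c : Cmd} {Q : RamState → Prop}
    (hc : ∀ σ', Fr [4, 5, 8, 11, 12, 13, 14, 15, 16, 17, 20] [3, 4, 5, 6]
        [1, 2, 3, 4, 5, 6, 7, 8, 9, 10] σ σ' →
      σ'.ireg 20 = σ.ireg 20 + V.length * (4 * (d + 2) * (d + 2) + (d + 2)) →
      ∀ X, Holds σ' 1 X → EntriesLE (X - vit V (withTimes Z t s)) ((n : ℝ) ^ m * e) →
      Wp (n * n) S c σ' Q) :
    Wp (n * n) S (.seq SecondOrderMeanFlow.loadC (.seq (SecondOrderMeanFlow.vitC V.length) c)) σ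
      Q := by
  have hb := hI.bound
  have hpow : (n : ℝ) ^ V.length * e ≤ (n : ℝ) ^ m * e :=
    mul_le_mul_of_nonneg_right (pow_le_pow_right₀ (by exact_mod_cast hn) hm) he0
  refine Wp.seq ((Wp.loadC hI.ctx hZ' (by omega)).mono ?_)
  rintro σ₁ _ ⟨f₁, X₁⟩
  rw [h1, h2] at X₁
  have h20 : σ₁.ireg 20 = σ.ireg 20 := f₁.ireg 20 (by simp)
  refine Wp.seq ((Wp.vitC hs hj (hI.ctx.fr f₁ (by simp) (by simp)) X₁
    (by rw [h20]; exact hL.fr f₁ (by simp)) hA (withTimes_error he0 hZ) hη he0 (hpow.trans he)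
    (hpow.trans he')).mono ?_)
  rintro σ₂ _ ⟨f₂, h20', X, hX, err⟩
  exact hc σ₂ ((f₁.mono (by simp) (by simp) (by simp)).trans (by simp) f₂) (by rw [h20', h20]) X hX
    fun p j => (err p j).trans hpow

/-- Each transformer starts from the same tensor and costs at most `n ^ (m₁ + m₂)`, a crude common
bound; combining the three terms costs a factor `3 ≤ n`, which is the `+ 1` in the exponent. -/
theorem Wp.stepC (hs : Sizes n (d + 2) R ρ A tol η)
    (hj : DegBound n (d + 2) S ρ tol j₀) (hn : 3 ≤ n) {T : ℕ}
    (hts : ts.length = T + 1) (hm₁ : V₁.length = m₁) (hm₂ : V₂.length = m₂)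
    (hI : Aux n d tol (auxList ts V₁ V₂) σ) (h21 : σ.ireg 21 = n * n * d + q)
    (hsq : ts[q]? = some s) (htq : ts[q + 1]? = some t)
    (hs01 : s ∈ Set.Icc (0 : ℝ) 1) (ht01 : t ∈ Set.Icc (0 : ℝ) 1)
    (hZ' : HoldsZ σ Z') (hA₁ : VitAdmissible R ε₀ V₁ (withTimes Z t s))
    (hA₂ : VitAdmissible R ε₀ V₂ (withTimes Z t s)) (hZ : EntriesLE (Z' - Z) e)
    (hη : η ≤ e) (he0 : 0 ≤ e) (he : (n : ℝ) ^ (m₁ + m₂ + 1) * e ≤ 1)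
    (he' : (n : ℝ) ^ (m₁ + m₂ + 1) * e ≤ ε₀) :
    Wp (n * n) S (stepC m₁ m₂ T) σ fun σ' =>
      Aux n d tol (auxList ts V₁ V₂) σ' ∧ σ'.ireg 21 = n * n * d + (q + 1) ∧
      ∃ Z'', HoldsZ σ' Z'' ∧
        EntriesLE (Z'' - smfStep V₁ V₂ s t Z) ((n : ℝ) ^ (m₁ + m₂ + 1) * e) := by
  have hn3 : (3 : ℝ) ≤ n := by exact_mod_cast hn
  have hb := hI.bound
  have hd : n * n * d ≤ σ.ireg 3 := by omega
  have hmid : 3 * ((n : ℝ) ^ (m₁ + m₂) * e) ≤ (n : ℝ) ^ (m₁ + m₂ + 1) * e := by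
    rw [pow_succ', mul_assoc]
    exact mul_le_mul_of_nonneg_right hn3 (by positivity)
  have hmid0 : 0 ≤ (n : ℝ) ^ (m₁ + m₂) * e := by positivity
  have hqt : q + 1 < ts.length := (List.getElem?_eq_some_iff.1 htq).1
  have mem : ∀ i x, ts[i]? = some x → σ.fmem (n * n * d + i) = x := fun i x hx =>
    hI.mem.left.left i x hx
  refine Wp.seq (Wp.fset (by omega) rfl ?_)
  refine Wp.seq (Wp.fset (by omega) rfl ?_)
  refine Wp.seq (Wp.iset (by omega) rfl (fun _ h => by simp [sm] at h) (by simp) ?_)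
  set σ₀ := ((σ.setF 1 _).setF 2 _).setI 20 _ with hσ₀
  have f₀ : Fr [20] [1, 2] [] σ σ₀ :=
    (((Fr.refl _ _ _ _).setF (by simp) _).setF (by simp) _).setI (by simp) _
  have hI₀ := hI.fr f₀ (by simp) (by simp)
  have a1 : σ₀.freg 1 = t := by
    simp only [hσ₀, setI_freg, setF_freg, RE.eval, NE.eval, h21]
    simpa [add_assoc] using mem _ _ htq
  have a2 : σ₀.freg 2 = s := by
    simp only [hσ₀, setI_freg, setF_freg, RE.eval, NE.eval, h21]
    simpa [h21] using mem _ _ hsq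
  have h1 : σ.ireg 1 = d := by have := hI.ctx.r1; omega
  have a20 : σ₀.ireg 20 = n * n * d + ts.length := by
    simp [hσ₀, NE.eval, hI.ctx.r2, h1, hts]
  have Z₀ := hZ'.fr hd f₀
  have b₀ : n * n * d ≤ σ₀.ireg 3 := by rw [f₀.ireg 3 (by simp)]; exact hd
  subst hm₁ hm₂
  have heM : (n : ℝ) ^ (V₁.length + V₂.length) * e ≤
      (n : ℝ) ^ (V₁.length + V₂.length + 1) * e := by linarith
  refine Wp.loadC_vitC hs hj (by omega) hI₀ a1 a2 Z₀ (by rw [a20]; exact hI₀.layers.1) hA₁ hZ hη he0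
    (Nat.le_add_right _ V₂.length) (heM.trans he) (heM.trans he') ?_
  intro σ₁ f₁ h20 X₁ hX₁ err₁
  have hI₁ := hI₀.fr f₁ (by simp) (by simp)
  have r1 : ∀ {σ}, Aux n d tol (auxList ts V₁ V₂) σ → σ.ireg 1 = d := fun h => by
    have := h.ctx.r1; omega
  have b₁ : n * n * d ≤ σ₁.ireg 3 := by rw [f₁.ireg 3 (by simp)]; exact b₀
  have Z₁ := Z₀.fr b₀ f₁
  refine Wp.seq ((Wp.fillTok (firstCols X₁) (by omega) hI₁.ctx.r7 hI₁.ctx.r2 (r1 hI₁) (.inl rfl) rfl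
    ?_).mono ?_)
  · intro p j σ' hF h4 h8
    exact ldA_ix_eval (hI₁.fr hF (by simp) (by simp)).ctx (hX₁.fr hF (by simp) (by omega) (by simp))
      h4 (j := Fin.castAdd 2 j) h8
  rintro σ₂ _ ⟨f₂, Y₂⟩
  have hI₂ := hI₁.fr f₂ (by simp) (by simp)
  have b₂ : n * n * d ≤ σ₂.ireg 3 := by rw [f₂.ireg 3 (by simp)]; exact b₁
  have Z₂ := Z₁.fr b₁ f₂
  have c1 : σ₂.freg 1 = t := by rw [f₂.freg 1 (by simp), f₁.freg 1 (by simp), a1]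
  have c2 : σ₂.freg 2 = s := by rw [f₂.freg 2 (by simp), f₁.freg 2 (by simp), a2]
  refine Wp.loadC_vitC hs hj (by omega) hI₂ c1 c2 Z₂
    (by rw [f₂.ireg 20 (by simp), h20, a20]; exact hI₂.layers.2) hA₂ hZ hη he0
    (Nat.le_add_left _ V₁.length) (heM.trans he) (heM.trans he') ?_
  intro σ₃ f₃ _ X₂ hX₂ err₂
  have hI₃ := hI₂.fr f₃ (by simp) (by simp)
  have b₃ : n * n * d ≤ σ₃.ireg 3 := by rw [f₃.ireg 3 (by simp)]; exact b₂
  have Z₃ := Z₂.fr b₂ f₃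
  have Y₃ := Y₂.fr f₃ (by simp) (by omega) (by simp)
  set Z'' : Matrix (Fin n × Fin n) (Fin d) ℝ :=
    Z' + (t - s) • firstCols X₁ + ((1 / 2 : ℝ) * (t - s) ^ 2) • firstCols X₂ with hZ''
  refine Wp.seq ((Wp.fillTok Z'' (by omega) hI₃.ctx.r7 hI₃.ctx.r2 (r1 hI₃) (.inl rfl) rfl
    ?_).mono ?_)
  · intro p j σ' hF h4 h8
    have hI' := hI₃.fr hF (by simp) (by simp)
    have e₁ : σ'.freg 1 = t := by rw [hF.freg 1 (by simp), f₃.freg 1 (by simp), c1]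
    have e₂ : σ'.freg 2 = s := by rw [hF.freg 2 (by simp), f₃.freg 2 (by simp), c2]
    have e₃ : (ldA 12 (ix 4 1 8)).eval σ' = firstCols X₁ p j := by
      rw [ldA_eval hI'.ctx.r7, ← Y₃.fr hF (by simp) (by omega) (by simp) p j]
      simp [ix, NE.eval, h4, h8, r1 hI']
    have e₄ : (ldA 1 (ix 4 6 8)).eval σ' = firstCols X₂ p j :=
      ldA_ix_eval hI'.ctx (hX₂.fr hF (by simp) (by omega) (by simp)) h4
        (j := Fin.castAdd 2 j) h8
    have e₅ : σ'.fmem ((ix 4 1 8).eval σ') = Z' p j := by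
      rw [← Z₃.fr b₃ hF p j]
      simp [ix, NE.eval, h4, h8, r1 hI']
    simp only [RE.eval, e₁, e₂, e₃, e₄, e₅, hZ'', Matrix.add_apply, Matrix.smul_apply, smul_eq_mul]
    push_cast
    ring
  rintro σ₄ _ ⟨f₄, Y₄⟩
  have hI₄ := hI₃.fr f₄ (by simp) (by simp)
  have b₄ : n * n * d ≤ σ₄.ireg 3 := by rw [f₄.ireg 3 (by simp)]; exact b₃
  refine Wp.seq ((Wp.store₂ {x | x < n * n * d} (fun i j => i * d + j) (σ₄.arr 13)
    (by omega) (by omega) (by omega)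
    (fun _ => rfl) (fun hs => hs.2) (by omega) rfl (by omega) (by omega) (by omega) (by omega)
    rfl rfl ?_).mono ?_)
  · intro i hi j hj σ' hs h4 h8
    rw [hI₄.ctx.r2] at hi
    rw [r1 hI₄] at hj
    obtain ⟨p, rfl⟩ := exists_tk hi
    have h1' : σ'.ireg 1 = d := by rw [hs.ireg 1 (by simp), r1 hI₄]
    refine ⟨by simp [ix, NE.eval, h4, h8, h1'], tk_mul_add_lt p ⟨j, hj⟩, ?_⟩
    rw [ldA_eval (by rw [hs.ireg 7 (by simp), hI₄.ctx.r7]), RamState.arr, RamState.arr,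
      hs.ireg 3 (by simp), hs.fmem]
    · simp [ix, NE.eval, h4, h8, h1']
    · simp only [Set.mem_ofPred_eq]; omega
  rintro σ₅ _ ⟨s₅, v₅, -⟩
  rw [hI₄.ctx.r2, r1 hI₄] at v₅
  have ctx₅ : Ctx n (d + 2) tol σ₅ := by
    have := hI₄.ctx
    exact ⟨by rw [s₅.ireg 0 (by simp), this.r0], by rw [s₅.ireg 1 (by simp), this.r1],
      by rw [s₅.ireg 2 (by simp), this.r2], by rw [s₅.ireg 6 (by simp), this.r6],
      by rw [s₅.ireg 7 (by simp), this.r7], by rw [s₅.freg, this.f0]⟩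
  refine Wp.iset (by omega) rfl (fun _ h => by simp [sm] at h) (by simp) ⟨⟨ctx₅.setI (by simp) _,
    fun i x hx => ?_, ?_⟩, ?_, Z'', fun p j => ?_, ?_⟩
  · rw [setI_fmem, s₅.fmem _ (by simp), hI₄.mem i x hx]
  · simpa [s₅.ireg 3 (by simp)] using hI₄.bound
  · simp [NE.eval, s₅.ireg 21 (by simp), f₄.ireg 21 (by simp), f₃.ireg 21 (by simp),
      f₂.ireg 21 (by simp), f₁.ireg 21 (by simp), f₀.ireg 21 (by simp), h21, add_assoc]
  · rw [setI_fmem, v₅ _ (tk_lt p) _ j.2, Y₄ p j]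
  · refine step_error hs01 ht01 (fun p j => (hZ p j).trans ?_) err₁ err₂ hmid
    exact le_mul_of_one_le_left he0 (one_le_pow₀ (by linarith))

/-- A number of sampling steps. -/
def smfC (m₁ m₂ T : ℕ) : ℕ → Cmd
  | 0 => skipC
  | k + 1 => .seq (SecondOrderMeanFlow.stepC m₁ m₂ T) (smfC m₁ m₂ T k)

theorem Wp.smfC (hs : Sizes n (d + 2) R ρ A tol η)
    (hj : DegBound n (d + 2) S ρ tol j₀) (hn : 3 ≤ n) {T : ℕ}
    (hts : ts.length = T + 1) (h01 : ∀ t ∈ ts, t ∈ Set.Icc (0 : ℝ) 1)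
    (hm₁ : V₁.length = m₁) (hm₂ : V₂.length = m₂) {rest : List ℝ}
    (hI : Aux n d tol (auxList ts V₁ V₂) σ) (h21 : σ.ireg 21 = n * n * d + q)
    (hq : ts.drop q = s :: rest) (hZ' : HoldsZ σ Z') (hA : SmfAdmissible R ε₀ V₁ V₂ s rest Z)
    (hZ : EntriesLE (Z' - Z) e) (hη : η ≤ e) (he0 : 0 ≤ e)
    (he : (n : ℝ) ^ ((m₁ + m₂ + 1) * rest.length) * e ≤ 1)
    (he' : (n : ℝ) ^ ((m₁ + m₂ + 1) * rest.length) * e ≤ ε₀) :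
    Wp (n * n) S (smfC m₁ m₂ T rest.length) σ fun σ' =>
      ∃ Z'', HoldsZ σ' Z'' ∧
        EntriesLE (Z'' - smf V₁ V₂ s rest Z) ((n : ℝ) ^ ((m₁ + m₂ + 1) * rest.length) * e) := by
  induction rest generalizing σ e Z Z' q s with
  | nil =>
    refine Wp.iset (by omega) rfl (fun _ _ => by simp [NE.eval]) (by simp) ⟨Z', hZ', ?_⟩
    simpa [smf] using hZ
  | cons t rest ih =>
    obtain ⟨hA₁, hA₂, hA₃⟩ := hA
    have hn3 : (3 : ℝ) ≤ n := by exact_mod_cast hn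
    have hpow : (n : ℝ) ^ ((m₁ + m₂ + 1) * (rest.length + 1)) * e =
        (n : ℝ) ^ ((m₁ + m₂ + 1) * rest.length) * ((n : ℝ) ^ (m₁ + m₂ + 1) * e) := by ring
    rw [List.length_cons, hpow] at he he'
    have hne : 0 ≤ (n : ℝ) ^ (m₁ + m₂ + 1) * e := by positivity
    have hle : (n : ℝ) ^ (m₁ + m₂ + 1) * e ≤
        (n : ℝ) ^ ((m₁ + m₂ + 1) * rest.length) * ((n : ℝ) ^ (m₁ + m₂ + 1) * e) :=
      le_mul_of_one_le_left hne (one_le_pow₀ (by linarith))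
    have hsq : ts[q]? = some s := by
      have := congrArg (·[0]?) hq
      simpa using this
    have htq : ts[q + 1]? = some t := by
      have := congrArg (·[1]?) hq
      simpa using this
    have hq' : ts.drop (q + 1) = t :: rest := by
      rw [← List.tail_drop, hq, List.tail_cons]
    refine Wp.seq ((Wp.stepC hs hj hn hts hm₁ hm₂ hI h21 hsq htq
      (h01 _ (List.mem_of_getElem? hsq)) (h01 _ (List.mem_of_getElem? htq)) hZ' hA₁ hA₂ hZ hη he0
      (hle.trans he) (hle.trans he')).mono ?_)
    rintro σ₁ _ ⟨hI₁, h21₁, Z₁, hZ₁, err⟩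
    rw [List.length_cons, hpow]
    exact ih hI₁ h21₁ hq' hZ₁ hA₃ err
      (hη.trans (le_mul_of_one_le_left he0 (one_le_pow₀ (by linarith)))) hne he he'

end Step

/-! ## The whole program -/

/-- The power `n ^ K`. -/
def powE : ℕ → RE
  | 0 => .const 1
  | K + 1 => .mul (powE K) (.ofNat (.var 0))

theorem powE_ok (K : ℕ) : (powE K).ok = true := by
  induction K with
  | zero => rfl
  | succ K ih => simp [powE, RE.ok, NE.ok, ih]

theorem powE_nd (K : ℕ) : (powE K).nd = 0 := by
  induction K with
  | zero => rfl
  | succ K ih => simp [powE, RE.nd, ih]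

theorem powE_eval (K : ℕ) (σ : RamState) : (powE K).eval σ = (σ.ireg 0 : ℝ) ^ K := by
  induction K with
  | zero => simp [powE, RE.eval]
  | succ K ih => simp [powE, RE.eval, NE.eval, ih, pow_succ]

/-- Set up the constant registers; the tolerance is `n ^ (-K)`. -/
def initC (m T K : ℕ) : Cmd :=
  .seq (.forC true 5 (.var 0) (.iset 2 (.add (.var 2) (.var 0)))) <|
  .seq (.iset 6 (.add (.var 1) (.const 2))) <|
  .seq (.iset 7 (.const 16)) <|
  .seq (.iset 21 (.mul (.var 2) 1)) <|
  .seq (.iset 3 (.add (.var 21) (.add (.const (T + 1))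
    (.add (.mul (.mul (.const (m * 4)) 6) 6) (.mul (.const m) 6))))) <|
  .fset 0 (.div (.const 1) (powE K))

/-- The approximation algorithm. -/
def mainC (m₁ m₂ T K : ℕ) : Cmd := .seq (initC (m₁ + m₂) T K) (smfC m₁ m₂ T T)

theorem Wp.initC {n d m T K S : ℕ} {σ : RamState} (h0 : σ.ireg 0 = n) (h1 : σ.ireg 1 = d)
    (h2 : σ.ireg 2 = 0) (hd : d + 2 ≤ S) (hS : 16 ≤ S) :
    Wp (n * n) S (initC m T K) σ fun σ' => Ctx n (d + 2) (1 / (n : ℝ) ^ K) σ' ∧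
      σ'.fmem = σ.fmem ∧ σ'.ireg 21 = n * n * d ∧
      σ'.ireg 3 = n * n * d + (T + 1 + m * (4 * (d + 2) * (d + 2) + (d + 2))) := by
  refine Wp.seq (Wp.forC (fun i σ' => σ'.ireg 0 = n ∧ σ'.ireg 1 = d ∧ σ'.ireg 2 = i * n ∧
    σ'.fmem = σ.fmem) (by omega) (by omega) rfl (fun _ => rfl) (fun _ => ?_) ?_ ?_ ?_)
  · simpa [NE.eval, h0] using Nat.le_mul_self n
  · simp [h0, h1, h2]
  · rintro i hi σ' ⟨a0, a1, a2, am⟩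
    simp only [NE.eval, h0] at hi
    have hle : i * n + n ≤ n * n := by
      rw [← Nat.succ_mul]; exact Nat.mul_le_mul_right n hi
    refine Wp.iset (by omega) rfl (fun _ h => by simp [sm] at h)
      (fun _ => by simpa [NE.eval, a0, a2] using hle) ?_
    simp [NE.eval, a0, a1, a2, am, Nat.succ_mul]
  rintro σ₁ _ ⟨a0, a1, a2, am⟩
  simp only [NE.eval, h0] at a2
  refine Wp.seq (Wp.iset (by omega) rfl (fun _ _ => by simpa [NE.eval, a1] using hd) (by simp) ?_)
  refine Wp.seq (Wp.iset (by omega) rfl (fun _ _ => by simpa [NE.eval] using hS) (by simp) ?_)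
  refine Wp.seq (Wp.iset (by omega) rfl (fun _ h => by simp [sm] at h) (by simp) ?_)
  refine Wp.seq (Wp.iset (by omega) rfl (fun _ h => by simp [sm] at h) (by simp) ?_)
  refine Wp.fset (by omega) (by simp [RE.ok, powE_ok]) ⟨⟨?_, ?_, ?_, ?_, ?_, ?_⟩, ?_, ?_, ?_⟩
  · simp [a0]
  · simp [a1]
  · simp [a2]
  · simp [NE.eval, a1]
  · simp [NE.eval]
  · simp [RE.eval, powE_eval, a0]
  · simp [am]
  · simp [NE.eval, a1, a2]
  · simp [NE.eval, a1, a2]; ring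

theorem encode_eq {n d m₁ m₂ T : ℕ} (I : Inst n d m₁ m₂ T) :
    I.encode = encodeTensor I.Z ++ auxList (I.t₀ :: I.ts) I.V₁ I.V₂ := by
  simp [Inst.encode, auxList]

/-- The stored tensor is exact, but the induction starts with the allowance `η`, which has to cover
the truncation error of the layers. -/
theorem mainC_spec {n d m₁ m₂ T K S j₀ : ℕ} {R ρ A η ε₀ : ℝ} (I : Inst n d m₁ m₂ T)
    (hA : I.Admissible R ε₀) (hs : Sizes n (d + 2) R ρ A (1 / (n : ℝ) ^ K) η)
    (hj : DegBound n (d + 2) S ρ (1 / (n : ℝ) ^ K) j₀) (hn : 3 ≤ n) (hd : d + 2 ≤ S) (hS : 16 ≤ S)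
    (hη : 0 ≤ η) (h₁ : (n : ℝ) ^ ((m₁ + m₂ + 1) * T) * η ≤ 1)
    (h₂ : (n : ℝ) ^ ((m₁ + m₂ + 1) * T) * η ≤ ε₀) :
    ∃ (t : ℕ) (s : RamState), Exec ((mainC m₁ m₂ T K).comp 24) I.initState t s ∧
      t ≤ (mainC m₁ m₂ T K).bd (n * n) S ∧
      EntriesLE (s.tensor n d - I.output) ((n : ℝ) ^ ((m₁ + m₂ + 1) * T) * η) := by
  have hmem : MemList I.initState.fmem 0 I.encode := by
    intro i x hx
    simp [Inst.initState, hx]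
  rw [encode_eq] at hmem
  have key : Wp (n * n) S (mainC m₁ m₂ T K) I.initState.abs fun σ =>
      ∃ Z, HoldsZ σ Z ∧ EntriesLE (Z - I.output) ((n : ℝ) ^ ((m₁ + m₂ + 1) * T) * η) := by
    refine Wp.seq ((Wp.initC (n := n) (d := d) (by simp [RamState.abs, Inst.initState])
      (by simp [RamState.abs, Inst.initState]) (by simp [RamState.abs, Inst.initState]) hd
      hS).mono ?_)
    rintro σ _ ⟨hC, hm, h21, h3⟩
    rw [abs_fmem] at hm
    have := Wp.smfC hs hj hn (ts := I.t₀ :: I.ts) (by simp [I.length_ts]) I.times_mem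
      I.length_V₁ I.length_V₂ (T := T) (q := 0) (s := I.t₀) (rest := I.ts) (σ := σ) (Z := I.Z)
      (Z' := I.Z) ⟨hC, ?_, ?_⟩ h21 rfl ?_ hA (e := η) ?_ le_rfl hη (by rwa [I.length_ts]) (by rwa [I.length_ts])
    · rwa [I.length_ts] at this
    · have := hmem.right
      rwa [length_encodeTensor, zero_add, ← hm] at this
    · rw [h3]
      simp only [auxList, List.length_append, length_flatten_encode, I.length_V₁, I.length_V₂,
        List.length_cons, I.length_ts]
      exact le_of_eq (by ring)
    · intro p j
      rw [hm]
      simpa using hmem.left.tensor p j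
    · intro p j
      simpa using hη
  have small : Small (n * n) S I.initState.abs := by
    refine ⟨fun v _ => ?_, by simp [RamState.abs, Inst.initState]⟩
    simp only [RamState.abs, Inst.initState]
    split_ifs <;> first | omega | simp_all [sm]
  obtain ⟨s, ⟨t, ht, hx⟩, -, ⟨Z, hZ, err⟩, -⟩ := key small 24 le_rfl _ rfl
  have : s.tensor n d = Z := funext fun p => funext fun j => hZ p j
  exact ⟨t, s, hx, ht, by rwa [this]⟩

/-! ## The running time -/

section Time
variable {k : ℕ}

theorem PB.fillTok (bj α : ℕ) (e : RE) (he : e.nd ≤ 0) : PB (fillTok bj α e) 1 :=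
  .forN _ _ (.forS _ _ (.fput _ _ he))

theorem PB.fill₂ (vi bi vj bj α : ℕ) (e : RE) (he : e.nd ≤ k) :
    PB (fill₂ false vi bi vj bj α e) k :=
  .forS _ _ (.forS _ _ (.fput _ _ he))

theorem PB.fillRow (vr α : ℕ) (e : RE) (he : e.nd ≤ 0) : PB (fillRow vr α e) 1 :=
  .forN _ _ (.fput _ _ he)

theorem PB.maxC (v α : ℕ) : PB (maxC v α) 1 :=
  .seq (.fset _ _ (by decide)) (.forN _ _ (.forS _ _ (.ifF _ _ (by simp [RE.nd])
    (by simp [RE.nd]) (.fset _ _ (by simp [RE.nd])))))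

theorem PB.degC : PB degC 1 :=
  .seq (.maxC _ _) <| .seq (.maxC _ _) <| .seq (.fset _ _ (by decide)) <|
  .seq (.fset _ _ (by decide)) <| .seq (.iset _ _ _) <|
  .forN _ _ (.ifF _ _ (by decide) (by decide) (.seq (.fset _ _ (by decide)) (.iset _ _ _)))

theorem PB.featC : PB featC 1 :=
  .seq (.iput _ _ _) <| .seq (.iset _ _ _) <| .seq (.fillRow _ _ _ (by decide)) <|
  .seq (.fillRow _ _ _ (by decide)) <| .seq (.iset _ _ _) <|
  .forS _ _ <| .seq (.iset _ _ _) <| .forS _ _ <| .seq (.iset _ _ _) <| .forS _ _ <|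
  .seq (.fillRow _ _ _ (by decide)) <| .seq (.fillRow _ _ _ (by decide)) <|
  .seq (.iput _ _ _) <| .seq (.iset _ _ _) (.iset _ _ _)

theorem PB.layerC : PB layerC 1 :=
  .seq (.fillTok _ _ _ (by decide)) <| .seq (.fillTok _ _ _ (by decide)) <|
  .seq (.fillTok _ _ _ (by decide)) <| .seq (.fillTok _ _ _ (by decide)) <|
  .seq .degC <| .seq .featC <|
  .seq (.fill₂ _ _ _ _ _ _ (by decide)) <| .seq (.fill₂ _ _ _ _ _ _ (by decide)) <|
  .seq (.fillTok _ _ _ (by decide)) <| .seq (.fillTok _ _ _ (by decide)) <|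
  .seq (.fillTok _ _ _ (by decide)) (.iset _ _ _)

theorem PB.vitC (m : ℕ) : PB (vitC m) 1 := by
  induction m with
  | zero => exact .iset _ _ _
  | succ m ih => exact .seq .layerC ih

theorem PB.loadC : PB loadC 1 :=
  .seq (.forN _ _ (.forS _ _ (.fput _ _ (by decide)))) <|
  .seq (.forN _ _ (.fput _ _ (by decide))) (.forN _ _ (.fput _ _ (by decide)))

theorem PB.stepC (m₁ m₂ T : ℕ) : PB (stepC m₁ m₂ T) 1 :=
  .seq (.fset _ _ (by simp [RE.nd])) <| .seq (.fset _ _ (by simp [RE.nd])) <| .seq (.iset _ _ _) <|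
  .seq .loadC <| .seq (.vitC _) <| .seq (.fillTok _ _ _ (by decide)) <|
  .seq .loadC <| .seq (.vitC _) <| .seq (.fillTok _ _ _ (by decide)) <|
  .seq (.forN _ _ (.forS _ _ (.fput _ _ (by decide)))) (.iset _ _ _)

theorem PB.smfC (m₁ m₂ T k : ℕ) : PB (smfC m₁ m₂ T k) 1 := by
  induction k with
  | zero => exact .iset _ _ _
  | succ k ih => exact .seq (.stepC _ _ _) ih

/-- Exponent `1`: no big loop or sum is nested in another. With `N = n * n` this is quadratic time
up to a power of `S`. -/
theorem PB.mainC (m₁ m₂ T K : ℕ) : PB (mainC m₁ m₂ T K) 1 :=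
  .seq (.seq (.forN _ _ (.iset _ _ _)) <| .seq (.iset _ _ _) <| .seq (.iset _ _ _) <|
    .seq (.iset _ _ _) <| .seq (.iset _ _ _) (.fset _ _ (by simp [RE.nd, powE_nd]))) (.smfC _ _ _ _)

end Time

/-! ## Asymptotics -/

/-- A single term of the exponential series at `y * B`. The parameter `y` is free; a large one makes
the denominator `y ^ m` a prescribed power of `n` even when `m` is a small multiple of `log n`. -/
theorem pow_div_factorial_le {B y : ℝ} (hB : 0 ≤ B) (hy : 0 < y) (m : ℕ) :
    B ^ m / (m.factorial : ℝ) ≤ Real.exp (y * B) / y ^ m := by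
  have := Real.pow_div_factorial_le_exp (y * B) (by positivity) m
  rw [le_div_iff₀ (by positivity)]
  calc B ^ m / (m.factorial : ℝ) * y ^ m = (y * B) ^ m / (m.factorial : ℝ) := by
        rw [mul_pow]; ring
    _ ≤ _ := this

/-- One term of the binomial expansion of `(x + 1) ^ (D + j)`, which is at most `exp (x * (D + j))`.
For small `x` the dimension `D` contributes little, at the price of the factor `(1 / x) ^ j`. -/
theorem choose_le_exp {x : ℝ} (hx : 0 < x) (D j : ℕ) :
    (((D + j).choose j : ℕ) : ℝ) ≤ Real.exp (x * (D + j)) * (1 / x) ^ j := by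
  have h₁ : x ^ j * ((D + j).choose j : ℝ) ≤ (x + 1) ^ (D + j) := by
    rw [add_pow]
    refine le_trans (le_of_eq ?_) (Finset.single_le_sum (f := fun m => x ^ m * 1 ^ (D + j - m) *
      ((D + j).choose m : ℝ)) (fun i _ => by positivity)
      (Finset.mem_range.2 (by omega : j < D + j + 1)))
    simp
  have h₂ : (x + 1) ^ (D + j) ≤ Real.exp (x * (D + j)) := by
    calc (x + 1) ^ (D + j) ≤ Real.exp x ^ (D + j) :=
          pow_le_pow_left₀ (by positivity) (Real.add_one_le_exp x) _
      _ = _ := by rw [← Real.exp_nat_mul]; push_cast; ring_nf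
  rw [one_div, inv_pow, ← div_eq_mul_inv, le_div_iff₀ (by positivity)]
  linarith

theorem tendsto_log_nat : Tendsto (fun n : ℕ => Real.log n) atTop atTop :=
  Real.tendsto_log_atTop.comp tendsto_natCast_atTop_atTop

theorem eventually_log_le (c : ℝ) {δ : ℝ} (hδ : 0 < δ) :
    ∀ᶠ n : ℕ in atTop, c * Real.log n ≤ (n : ℝ) ^ δ := by
  have h := ((isLittleO_log_rpow_atTop hδ).comp_tendsto tendsto_natCast_atTop_atTop).def
    (c := 1 / (|c| + 1)) (by positivity)
  filter_upwards [h, eventually_ge_atTop 1] with n hn h1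
  have h0 : 0 ≤ Real.log n := Real.log_natCast_nonneg n
  simp only [Function.comp_apply, Real.norm_eq_abs, abs_of_nonneg h0,
    abs_of_nonneg (Real.rpow_nonneg (Nat.cast_nonneg n) δ)] at hn
  rw [div_mul_eq_mul_div, one_mul, le_div_iff₀ (by positivity)] at hn
  nlinarith [le_abs_self c]

theorem eventually_pow_log_le (c : ℝ) (m : ℕ) :
    ∀ᶠ n : ℕ in atTop, c * Real.log n ^ m ≤ n := by
  have h := ((Real.isLittleO_pow_log_id_atTop (n := m)).comp_tendsto
    tendsto_natCast_atTop_atTop).def (c := 1 / (|c| + 1)) (by positivity)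
  filter_upwards [h] with n hn
  have h0 : 0 ≤ Real.log n ^ m := pow_nonneg (Real.log_natCast_nonneg n) m
  simp only [Function.comp_apply, Real.norm_eq_abs, abs_of_nonneg h0, id, Nat.abs_cast] at hn
  rw [div_mul_eq_mul_div, one_mul, le_div_iff₀ (by positivity)] at hn
  nlinarith [le_abs_self c]

/-- Diagonal argument: let `φ j` be strictly increasing thresholds from which on `P n (1 / (j + 1))`
holds, and let `γ n = 1 / (j + 1)` for the largest `j ≤ n` with `φ j ≤ n`. -/
theorem exists_tendsto_zero_of_eventually {P : ℕ → ℝ → Prop}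
    (h : ∀ x > 0, ∀ᶠ n in atTop, P n x) :
    ∃ γ : ℕ → ℝ, Tendsto γ atTop (𝓝 0) ∧ ∀ᶠ n in atTop, P n (γ n) := by
  obtain ⟨φ, hφ, hP⟩ := extraction_forall_of_eventually'
    (P := fun j N => ∀ n ≥ N, P n (1 / ((j : ℝ) + 1))) fun j =>
    eventually_atTop.1 (eventually_forall_ge_atTop.2 (h _ Nat.one_div_pos_of_nat))
  refine ⟨fun n => 1 / ((Nat.findGreatest (fun j => φ j ≤ n) n : ℝ) + 1),
    tendsto_one_div_add_atTop_nhds_zero_nat.comp (tendsto_atTop.2 fun b => ?_), ?_⟩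
  · filter_upwards [eventually_ge_atTop (φ b)] with n hn
    exact Nat.le_findGreatest ((hφ.id_le b).trans hn) hn
  · filter_upwards [eventually_ge_atTop (φ 0)] with n hn
    exact hP _ _ (Nat.findGreatest_spec (P := fun j => φ j ≤ n) (Nat.zero_le n) hn)

section Sizes
variable {d : ℕ → ℕ} {R : ℕ → ℝ}

/-- This is the only way in which the growth of `R` is used. The constant `c` must be allowed to be
arbitrarily small, so a bound `R = O(sqrt (log n))` would not do here. -/
theorem eventually_radius (hR : R =o[atTop] fun n : ℕ => Real.sqrt (Real.log (n : ℝ))) {c : ℝ}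
    (hc : 0 < c) : ∀ᶠ n : ℕ in atTop, (|R n| + 1) * (|R n| + 1) ≤ c * Real.log n := by
  filter_upwards [hR.def (c := Real.sqrt c / 2) (by positivity),
    tendsto_log_nat.eventually_ge_atTop (4 / c)] with n h₁ h₂
  have hL : 0 < Real.log n := lt_of_lt_of_le (by positivity) h₂
  rw [Real.norm_eq_abs, Real.norm_eq_abs, abs_of_nonneg (Real.sqrt_nonneg _)] at h₁
  have h₃ : 1 ≤ Real.sqrt c / 2 * Real.sqrt (Real.log n) := by
    rw [div_mul_eq_mul_div, ← Real.sqrt_mul hc.le, le_div_iff₀ (by norm_num), one_mul]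
    refine Real.le_sqrt_of_sq_le ?_
    rw [div_le_iff₀ hc] at h₂
    linarith
  have h₄ : |R n| + 1 ≤ Real.sqrt c * Real.sqrt (Real.log n) := by linarith
  calc _ ≤ Real.sqrt c * Real.sqrt (Real.log n) * (Real.sqrt c * Real.sqrt (Real.log n)) :=
        mul_self_le_mul_self (by positivity) h₄
    _ = Real.sqrt c * Real.sqrt c * (Real.sqrt (Real.log n) * Real.sqrt (Real.log n)) := by ring
    _ = _ := by rw [Real.mul_self_sqrt hc.le, Real.mul_self_sqrt hL.le]

theorem eventually_dim (hd : (fun n : ℕ => (d n : ℝ)) =O[atTop] fun n : ℕ => Real.log (n : ℝ)) :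
    ∃ c : ℝ, 0 < c ∧ ∀ᶠ n : ℕ in atTop, ((d n + 2 : ℕ) : ℝ) ≤ c * Real.log n := by
  obtain ⟨c, hc, h⟩ := hd.exists_pos
  refine ⟨c + 2, by positivity, ?_⟩
  filter_upwards [h.bound, tendsto_log_nat.eventually_ge_atTop 1] with n h₁ h₂
  rw [Real.norm_eq_abs, Real.norm_eq_abs, abs_of_nonneg (by positivity),
    abs_of_nonneg (by positivity)] at h₁
  push_cast
  linarith

/-- Since `ρ * ρ ≤ log n / 2`, the factor `exp (2 * (ρ * ρ))` is at most `n`; it accounts for the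
difference between the exponents `M + 1` and `M`. The bound `A` is `O(log n)`, so `44 * A ^ 6 ≤ n`
eventually. -/
theorem eventually_sizes
    (hd : (fun n : ℕ => (d n : ℝ)) =O[atTop] fun n : ℕ => Real.log (n : ℝ))
    (hR : R =o[atTop] fun n : ℕ => Real.sqrt (Real.log (n : ℝ))) (M : ℕ) :
    ∀ᶠ n : ℕ in atTop, Sizes n (d n + 2) (R n) (|R n| + 1) (max ((d n + 2 : ℕ) : ℝ) (|R n| + 1))
      (1 / (n : ℝ) ^ (M + 1)) (1 / (n : ℝ) ^ M) := by
  obtain ⟨c, hc, hdim⟩ := eventually_dim hd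
  filter_upwards [hdim, eventually_radius hR (c := 1 / 2) (by norm_num),
    eventually_pow_log_le (44 * (c + 1) ^ 6) 6, eventually_ge_atTop 1] with n h₁ h₂ h₃ h₄
  have hn : (0 : ℝ) < n := by exact_mod_cast h₄
  have hL : 0 ≤ Real.log n := Real.log_natCast_nonneg n
  have hR1 : 1 ≤ |R n| + 1 := by linarith [abs_nonneg (R n)]
  have hA : max ((d n + 2 : ℕ) : ℝ) (|R n| + 1) ≤ (c + 1) * Real.log n := by
    refine max_le (by linarith) ?_
    have := le_mul_of_one_le_left (zero_le_one.trans hR1) hR1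
    nlinarith
  refine ⟨by omega, le_max_left _ _, by linarith [le_abs_self (R n)], le_max_right _ _, ?_, ?_⟩
  · refine le_trans ?_ h₃
    rw [mul_assoc, ← mul_pow]
    gcongr
  · calc 1 / (n : ℝ) ^ (M + 1) * Real.exp (2 * ((|R n| + 1) * (|R n| + 1)))
        ≤ 1 / (n : ℝ) ^ (M + 1) * n := by
          gcongr
          rw [← Real.le_log_iff_exp_le hn]
          linarith
      _ = 1 / (n : ℝ) ^ M := by
          rw [pow_succ]; field_simp

/-- The constants are chosen in the order `x`, `α`, `y`. The degree is `j = ⌊α log n⌋`. The number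
of features is at most `exp (x (D + j) + j log (1 / x))`, where `x` makes the first summand and `α`
the second at most `δ / 2 * log n`. The remainder is at most `exp (y ρ²) / y ^ (j + 1)`, where `y`
makes the denominator at least `n ^ (K + 1)` and `ρ² ≤ log n / y` makes the numerator at most `n`.
-/
theorem eventually_degBound
    (hd : (fun n : ℕ => (d n : ℝ)) =O[atTop] fun n : ℕ => Real.log (n : ℝ))
    (hR : R =o[atTop] fun n : ℕ => Real.sqrt (Real.log (n : ℝ))) (K : ℕ) {δ : ℝ} (hδ : 0 < δ) :
    ∀ᶠ n : ℕ in atTop, ∃ j₀, DegBound n (d n + 2) ⌊(n : ℝ) ^ δ⌋₊ (|R n| + 1)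
      (1 / (n : ℝ) ^ K) j₀ := by
  obtain ⟨c, hc, hdim⟩ := eventually_dim hd
  set x : ℝ := min (1 / 2) (δ / (2 * (c + 1))) with hx
  have hx0 : 0 < x := by positivity
  have hx1 : x < 1 := lt_of_le_of_lt (min_le_left _ _) (by norm_num)
  have hxδ : x * (c + 1) ≤ δ / 2 := by
    have : x ≤ δ / (2 * (c + 1)) := min_le_right _ _
    rw [le_div_iff₀ (by positivity)] at this
    linarith
  have hlx : 0 < Real.log (1 / x) := Real.log_pos (by rw [lt_div_iff₀ hx0]; linarith)
  set α : ℝ := min 1 (δ / (2 * Real.log (1 / x))) with hα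
  have hα0 : 0 < α := by positivity
  have hα1 : α ≤ 1 := min_le_left _ _
  have hαδ : α * Real.log (1 / x) ≤ δ / 2 := by
    have : α ≤ δ / (2 * Real.log (1 / x)) := min_le_right _ _
    rw [le_div_iff₀ (by positivity)] at this
    linarith
  -- Chosen such that `y ^ (α * log n) = n ^ (K + 1)`; the inequality `α * log n ≤ j + 1` below is
  -- where rounding down is harmless.
  set y : ℝ := Real.exp ((K + 1) / α) with hy
  have hy0 : 0 < y := Real.exp_pos _
  filter_upwards [hdim, eventually_radius hR (c := 1 / y) (by positivity),
    eventually_log_le 1 hδ, eventually_pow_log_le 2 1, eventually_ge_atTop 1] with n h₁ h₂ h₃ h₄ h₅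
  have hn : (0 : ℝ) < n := by exact_mod_cast h₅
  have hL : 0 ≤ Real.log n := Real.log_natCast_nonneg n
  have hj : (⌊α * Real.log n⌋₊ : ℝ) ≤ α * Real.log n := Nat.floor_le (by positivity)
  have hjL : (⌊α * Real.log n⌋₊ : ℝ) ≤ Real.log n :=
    hj.trans (mul_le_of_le_one_left hL hα1)
  have hj' : α * Real.log n ≤ (⌊α * Real.log n⌋₊ + 1 : ℕ) := by
    push_cast; exact (Nat.lt_floor_add_one _).le
  set j := ⌊α * Real.log n⌋₊
  refine ⟨j, ?_, ?_, ?_, ?_⟩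
  · rw [← Nat.cast_lt (α := ℝ)]
    rw [pow_one] at h₄
    linarith
  · exact Nat.le_floor (by linarith)
  · calc _ ≤ Real.exp (y * ((|R n| + 1) * (|R n| + 1))) / y ^ (j + 1) :=
          pow_div_factorial_le (by positivity) hy0 _
      _ ≤ Real.exp (Real.log n) / Real.exp ((K + 1) * Real.log n) := by
          gcongr
          · rw [one_div, ← div_eq_inv_mul, le_div_iff₀ hy0] at h₂
            linarith
          · rw [hy, ← Real.exp_nat_mul]
            refine Real.exp_le_exp.2 ?_
            calc (K + 1) * Real.log n = (α * Real.log n) * ((K + 1) / α) := by field_simp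
              _ ≤ _ := by gcongr
      _ = 1 / (n : ℝ) ^ K := by
          rw [add_mul, one_mul, Real.exp_add, Real.exp_nat_mul, Real.exp_log hn]
          field_simp
  · refine Nat.le_floor ((choose_le_exp hx0 _ _).trans ?_)
    have h₆ : (1 / x) ^ j = Real.exp (j * Real.log (1 / x)) := by
      rw [Real.exp_nat_mul, Real.exp_log (by positivity)]
    rw [h₆, ← Real.exp_add, Real.rpow_def_of_pos hn]
    refine Real.exp_le_exp.2 ?_
    have h₇ : x * (((d n + 2 : ℕ) : ℝ) + j) ≤ x * ((c + 1) * Real.log n) := by gcongr; linarith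
    have h₈ : j * Real.log (1 / x) ≤ α * Real.log n * Real.log (1 / x) := by gcongr
    nlinarith

end Sizes

end SecondOrderMeanFlow

/-- Almost quadratic time approximation of second-order MeanFlow on `n × n × d` inputs. -/
theorem mainTheorem6
    (d : ℕ → ℕ) (R : ℕ → ℝ)
    (hd : (fun n : ℕ => (d n : ℝ)) =O[Filter.atTop] fun n : ℕ => Real.log (n : ℝ))
    (hR : R =o[Filter.atTop] fun n : ℕ => Real.sqrt (Real.log (n : ℝ)))
    (m₁ m₂ T : ℕ) (ε₀ : ℝ) (hε₀ : 0 < ε₀) (k : ℕ) :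
    ∃ (P : SecondOrderMeanFlow.Prog) (C : ℝ) (γ : ℕ → ℝ),
      Filter.Tendsto γ Filter.atTop (nhds 0) ∧
      ∀ᶠ n : ℕ in Filter.atTop,
        ∀ I : SecondOrderMeanFlow.Inst n (d n) m₁ m₂ T, I.Admissible (R n) ε₀ →
          ∃ (t : ℕ) (s : SecondOrderMeanFlow.RamState),
            SecondOrderMeanFlow.Exec P I.initState t s ∧
            (t : ℝ) ≤ C * (n : ℝ) ^ (2 + γ n) ∧
            SecondOrderMeanFlow.EntriesLE (s.tensor n (d n) - I.output) (1 / (n : ℝ) ^ k) := by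
  open SecondOrderMeanFlow in
  -- The first summand pays for the error growth and `k` for the required accuracy; the extra `1`
  -- leaves a factor `1 / n`, which eventually is below `ε₀`.
  set M := (m₁ + m₂ + 1) * T + (k + 1) with hM
  obtain ⟨κ, h, bound⟩ := PB.mainC m₁ m₂ T (M + 1)
  refine ⟨(mainC m₁ m₂ T (M + 1)).comp 24, κ, ?_⟩
  -- The program and the constants `κ` and `h` are already fixed and independent of `x`, so each `x
  -- > 0` can be treated separately.
  refine exists_tendsto_zero_of_eventually (P := fun n x =>
    ∀ I : Inst n (d n) m₁ m₂ T, I.Admissible (R n) ε₀ → ∃ (t : ℕ) (s : RamState),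
      Exec ((mainC m₁ m₂ T (M + 1)).comp 24) I.initState t s ∧ (t : ℝ) ≤ κ * (n : ℝ) ^ (2 + x) ∧
      EntriesLE (s.tensor n (d n) - I.output) (1 / (n : ℝ) ^ k)) fun x hx => ?_
  obtain ⟨c, hc, hdim⟩ := eventually_dim hd
  -- With `S` at most `n ^ (x / (h + 1))`, the factor `S ^ h` in the time bound stays below `n ^ x`.
  have hδ : 0 < x / ((h : ℝ) + 1) := by positivity
  filter_upwards [eventually_sizes hd hR M, eventually_degBound hd hR (M + 1) hδ, hdim,
    eventually_log_le c hδ, eventually_log_le 16 hδ,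
    tendsto_log_nat.eventually_ge_atTop 1, Filter.eventually_ge_atTop 3,
    tendsto_natCast_atTop_atTop.eventually_ge_atTop (1 / ε₀)] with n hs hj h₁ h₂ h₃ h₄ hn h₅ I hA
  obtain ⟨j₀, hj⟩ := hj
  have hn3 : (3 : ℝ) ≤ n := by exact_mod_cast hn
  have hn0 : (0 : ℝ) < n := by linarith
  set S := ⌊(n : ℝ) ^ (x / ((h : ℝ) + 1))⌋₊ with hS
  have hS16 : 16 ≤ S := Nat.le_floor (by push_cast; linarith)
  have herr : (n : ℝ) ^ ((m₁ + m₂ + 1) * T) * (1 / (n : ℝ) ^ M) = 1 / (n : ℝ) ^ k * (1 / n) := by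
    rw [hM, pow_add, pow_succ]; field_simp
  have hk : 1 / (n : ℝ) ^ k ≤ 1 := by
    rw [div_le_one (by positivity)]; exact one_le_pow₀ (by linarith)
  have hk0 : 0 ≤ 1 / (n : ℝ) ^ k := by positivity
  have hn1 : 1 / (n : ℝ) ≤ 1 := by rw [div_le_one hn0]; linarith
  have hnε : 1 / (n : ℝ) ≤ ε₀ := by
    rw [div_le_iff₀ hε₀] at h₅
    rw [div_le_iff₀ hn0]
    linarith
  have hle : 1 / (n : ℝ) ^ k * (1 / n) ≤ 1 / n := mul_le_of_le_one_left (by positivity) hk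
  obtain ⟨t, s, hx', ht, err⟩ := mainC_spec I hA hs hj hn (Nat.le_floor (h₁.trans h₂)) hS16
    (by positivity) (by rw [herr]; linarith) (by rw [herr]; linarith)
  refine ⟨t, s, hx', ?_, fun p j => (err p j).trans ?_⟩
  · have hb := ht.trans (bound (n * n) S (Nat.mul_pos (by omega) (by omega)) (by omega))
    have hSn : (S : ℝ) ≤ (n : ℝ) ^ (x / ((h : ℝ) + 1)) := Nat.floor_le (by positivity)
    calc (t : ℝ) ≤ κ * (n * n : ℝ) ^ 1 * (S : ℝ) ^ h := by exact_mod_cast hb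
      _ ≤ κ * (n * n : ℝ) ^ 1 * ((n : ℝ) ^ (x / ((h : ℝ) + 1))) ^ h := by gcongr
      _ = κ * (n : ℝ) ^ (2 + x / ((h : ℝ) + 1) * h) := by
        rw [Real.rpow_add hn0, Real.rpow_mul hn0.le, Real.rpow_natCast, Real.rpow_two]
        ring
      _ ≤ _ := by
        gcongr
        · linarith
        · rw [div_mul_eq_mul_div, div_le_iff₀ (by positivity)]
          nlinarith
  · rw [herr]
    exact mul_le_of_le_one_right hk0 hn1
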